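/- Let $N\ge 2$. For $1<s<2$ and $1\le p<\infty$ let $B(s,p)$ be the Besov space of all functions $u:\mathbb{R}^N\to\mathbb{R}$ with weak gradient $Du$ and finite norm $$\|u\|_{s,p}:=\|u\|_{L^p}+\|Du\|_{L^p}+\bigg(\int_{\mathbb{R}^N}\int_{\mathbb{R}^N}\frac{|Du(x)-Du(y)|^p}{|x-y|^{N+(s-1)p}}\,dx\,dy\bigg)^{1/p}.$$ When $N=2$, $B(2-\tfrac2N,N)=B(1,2)$ is understood as the Sobolev space $W^{1,2}(\mathbb{R}^2)$. Let $B_{\mathrm{loc}}(2-\tfrac2N,N)$ be the space of all $f$ such that $\chi f\in B(2-\tfrac2N,N)$ for every $\chi\in C_c^\infty(\mathbb{R}^N)$. **Theorem (Optimality in the scale $B(s,p)$).** Let $1<p<\infty$ and $1<s<2$ be such that $B(s,p)\not\subset B_{\mathrm{loc}}(2-\tfrac2N,N)$. Then there exist functions $u_k\in C_c^\infty(\mathbb{R}^N)$, $k\in\mathbb{N}$, and a test function $\varphi\in C_c^\infty(\mathbb{R}^N)$ such that $$\|u_k\|_{s,p}\to 0\quad\text{and}\quad\int_{\mathbb{R}^N}\det(D^2u_k)\,\varphi\,dx\to+\infty\qquad\text{as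 }k\to\infty.$$ -/

import Mathlib

open MeasureTheory Filter Topology
open scoped ENNReal ContDiff

noncomputable section

namespace HessianDet

/-- `φ ∈ C_c^∞(ℝ^N)`, real valued. -/
def IsTest {N : ℕ} (φ : EuclideanSpace ℝ (Fin N) → ℝ) : Prop :=
  ContDiff ℝ ∞ φ ∧ HasCompactSupport φ

/-- `V` is the weak (distributional) gradient of `u` on `ℝ^N`. -/
def IsWeakGrad {N : ℕ} (u : EuclideanSpace ℝ (Fin N) → ℝ)
    (V : EuclideanSpace ℝ (Fin N) → EuclideanSpace ℝ (Fin N)) : Prop :=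
  LocallyIntegrable u ∧ LocallyIntegrable V ∧
    ∀ φ : EuclideanSpace ℝ (Fin N) → ℝ, IsTest φ → ∀ i : Fin N,
      ∫ x, u x * fderiv ℝ φ x (EuclideanSpace.single i 1) = -∫ x, V x i * φ x

/-- `(∬ |V(x) - V(y)|^p / |x - y|^(N + σ p) dx dy)^(1/p)`. -/
def gagliardo {N : ℕ} (σ p : ℝ)
    (V : EuclideanSpace ℝ (Fin N) → EuclideanSpace ℝ (Fin N)) : ℝ≥0∞ :=
  (∫⁻ x, ∫⁻ y, ‖V x - V y‖ₑ ^ p / ‖x - y‖ₑ ^ ((N : ℝ) + σ * p)) ^ (1 / p)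

/-- The norm of `W^{1,p}(ℝ^N)`; it is `∞` if `u` has no weak gradient. The weak gradient is
unique up to null sets, so the infimum is over a set with at most one element. -/
def sobolevNorm {N : ℕ} (p : ℝ) (u : EuclideanSpace ℝ (Fin N) → ℝ) : ℝ≥0∞ :=
  ⨅ (V : EuclideanSpace ℝ (Fin N) → EuclideanSpace ℝ (Fin N)) (_ : IsWeakGrad u V),
    (eLpNorm u (ENNReal.ofReal p) volume + eLpNorm V (ENNReal.ofReal p) volume)

/-- The norm `‖u‖_{s,p} = ‖u‖_{W^{1,p}} + [Du]_{s-1,p}` of `B(s,p)`, for `1 < s < 2` and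
`1 ≤ p < ∞`; it is `∞` if `u` has no weak gradient. -/
def besovNorm {N : ℕ} (s p : ℝ) (u : EuclideanSpace ℝ (Fin N) → ℝ) : ℝ≥0∞ :=
  ⨅ (V : EuclideanSpace ℝ (Fin N) → EuclideanSpace ℝ (Fin N)) (_ : IsWeakGrad u V),
    (eLpNorm u (ENNReal.ofReal p) volume + eLpNorm V (ENNReal.ofReal p) volume
      + gagliardo (s - 1) p V)

/-- `u ∈ W^{1,p}(ℝ^N)`. -/
def MemSobolev {N : ℕ} (p : ℝ) (u : EuclideanSpace ℝ (Fin N) → ℝ) : Prop :=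
  sobolevNorm p u < ⊤

/-- `u ∈ B(s,p)`, for `1 < s < 2` and `1 ≤ p < ∞`. -/
def MemBesov {N : ℕ} (s p : ℝ) (u : EuclideanSpace ℝ (Fin N) → ℝ) : Prop :=
  besovNorm s p u < ⊤

/-- `u ∈ B(2 - 2/N, N)`. In dimension `N = 2` the smoothness index is the integer `1`, and
`B(1,2)` is the Sobolev space `W^{1,2}(ℝ^2)`. -/
def MemCritical {N : ℕ} (u : EuclideanSpace ℝ (Fin N) → ℝ) : Prop :=
  if N = 2 then MemSobolev 2 u else MemBesov (2 - 2 / (N : ℝ)) (N : ℝ) u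

/-- `u ∈ B_loc(2 - 2/N, N)`. -/
def MemCriticalLoc {N : ℕ} (u : EuclideanSpace ℝ (Fin N) → ℝ) : Prop :=
  ∀ χ : EuclideanSpace ℝ (Fin N) → ℝ, IsTest χ → MemCritical (fun x => χ x * u x)

/-- The Hessian matrix `D²u(x)`. -/
def hessian {N : ℕ} (u : EuclideanSpace ℝ (Fin N) → ℝ) (x : EuclideanSpace ℝ (Fin N)) :
    Matrix (Fin N) (Fin N) ℝ :=
  Matrix.of fun i j =>
    fderiv ℝ (fun y => fderiv ℝ u y (EuclideanSpace.single j 1)) x (EuclideanSpace.single i 1)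

end HessianDet

end

noncomputable section

namespace HessianDet

/-! The argument proves a partial converse: `B(s,p)` embeds in the local critical space as soon as
`s ≥ N/p + 1 - 2/N`, `s ≥ 2 - 2/N`, and `p ≤ N` in case `s = 2 - 2/N`. If the inclusion fails, one
of these conditions is violated, and each violation has its own family of bad functions. It suffices
to bound the norms and make the determinant integrals `T_k` diverge: multiplying by `T_k ^
(-1/(2N))` sends the norms to zero and leaves integrals `T_k ^ (1/2)`
(`exists_sequence_of_bounded`).

Below the scaling line `s = N/p + 1 - 2/N`, concentration works. The functions `ρ^(N/p - s) g(ρx)`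
with `g` a radial bump are bounded in `B(s,p)`. The Hessian determinant is a double divergence, so
its moments of order zero and one vanish; tested against `±|x|²`, it gives a positive multiple of
`ρ^(N(N/p + 1 - 2/N - s))` (`exists_sequence_of_subscaling`, `integral_det_hessian_profile_pos`).

For `s < 2 - 2/N`, or `s = 2 - 2/N` and `p > N`, oscillation works. With `m = N - 1` and `f(t) = ∑
a_l 2^(-ls) cos(2^l t)`, take `u = ∑_{i ≤ m} f(x_i) + x_N² f(x_1 + ... + x_m) / 2`, cut off. In `det
D²u` every term except `f(∑ x_i) ∏ f''(x_i)` carries a factor `x_N²`, which a weight with zero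
second moment in `x_N` removes. Cutoffs orthogonal to all nonzero integer frequencies then leave
only the resonant terms, a multiple of `∑ a_l^N 2^(l(2m - sN))`. The Besov norm costs only `(∑
a_l^p)^(1/p)`, so a suitable choice of `a_l` separates the two sums (`integral_det_hessian_model`,
`besovNorm_le_of_lacunaryModulus`, `exists_sequence_of_lacunary`).

The embedding (`MemBesov.memCriticalLoc`) is proved from increments alone. A Chebyshev argument on
balls gives the fractional Sobolev inequality into `L^N` (`fractional_sobolev`). For `p < N`,
applying it to the increments `W(· + h) - W` and integrating in `h` gives the fractional embedding
(`energy_critical_lt_top`). For `p ≥ N`, compact support and a strict excess of smoothness suffice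
(`energy_critical_lt_top_of_large`). -/

/-- Euclidean space of dimension `N`. -/
abbrev Eu (N : ℕ) : Type := EuclideanSpace ℝ (Fin N)

/-! ### Radial integrals -/

theorem lintegral_comp_smul {N : ℕ} (f : Eu N → ℝ≥0∞) {r : ℝ} (hr : 0 < r) :
    ∫⁻ x, f (r • x) = ENNReal.ofReal (r ^ N)⁻¹ * ∫⁻ x, f x := by
  have h1 := lintegral_map_equiv (μ := (volume : Measure (Eu N))) f
    (Homeomorph.smulOfNeZero r hr.ne').toMeasurableEquiv
  have h2 : Measure.map ((Homeomorph.smulOfNeZero r hr.ne').toMeasurableEquiv)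
      (volume : Measure (Eu N)) = ENNReal.ofReal (r ^ N)⁻¹ • volume := by
    have := Measure.map_addHaar_smul (volume : Measure (Eu N)) hr.ne'
    rw [finrank_euclideanSpace_fin, abs_of_pos (by positivity)] at this
    exact this
  rw [h2, lintegral_smul_measure] at h1
  exact h1.symm

theorem lintegral_radial_lt_top {N : ℕ} (hN : 0 < N) {f : ℝ → ℝ}
    (hf : IntegrableOn (fun y => y ^ (N - 1) • f y) (Set.Ioi 0)) :
    ∫⁻ x : Eu N, ‖f ‖x‖‖ₑ < ⊤ := by
  have : Nonempty (Fin N) := ⟨⟨0, hN⟩⟩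
  have := (integrable_fun_norm_addHaar (E := Eu N) volume (f := f)).2
    (by simpa [finrank_euclideanSpace_fin] using hf)
  exact this.2

theorem enorm_rpow_eq {N : ℕ} {h : Eu N} (hh : h ≠ 0) (a : ℝ) :
    ‖h‖ₑ ^ a = ENNReal.ofReal (‖h‖ ^ a) := by
  rw [← ofReal_norm, ENNReal.ofReal_rpow_of_pos (norm_pos_iff.2 hh)]

theorem ae_ne_zero {N : ℕ} (hN : 0 < N) : ∀ᵐ h : Eu N, h ≠ 0 := by
  have : Nonempty (Fin N) := ⟨⟨0, hN⟩⟩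
  exact Measure.ae_ne volume 0

/-- In polar coordinates the integrand becomes `t ^ (ε - 1)` on `(0, 1]`, so the exponent is
normalised to converge for `ε > 0`; the exterior integral uses `-ε` in the same way. -/
theorem lintegral_unit_inner_lt_top {N : ℕ} (hN : 0 < N) {ε : ℝ} (hε : 0 < ε) :
    ∫⁻ h : Eu N in {h | ‖h‖ ≤ 1}, ‖h‖ₑ ^ (ε - N) < ⊤ := by
  have hm : MeasurableSet {h : Eu N | ‖h‖ ≤ 1} := measurableSet_le (by fun_prop) (by fun_prop)
  have h0 := lintegral_radial_lt_top hN
    (f := (Set.Iic (1 : ℝ)).indicator fun t => t ^ (ε - N)) (by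
      have h1 : IntegrableOn (fun t : ℝ => t ^ (ε - 1)) (Set.Ioc 0 1) := by
        rw [← intervalIntegrable_iff_integrableOn_Ioc_of_le zero_le_one]
        exact intervalIntegral.intervalIntegrable_rpow' (by linarith)
      have h2 : IntegrableOn ((Set.Iic (1 : ℝ)).indicator fun t : ℝ => t ^ (ε - 1))
          (Set.Ioi 0) := by
        rw [integrableOn_indicator_iff measurableSet_Iic]
        have : Set.Iic (1 : ℝ) ∩ Set.Ioi 0 = Set.Ioc 0 1 := by ext; simp [and_comm]
        rwa [this]
      refine h2.congr_fun (fun t ht => ?_) measurableSet_Ioi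
      simp only [Set.indicator_apply, smul_eq_mul]
      split_ifs
      · rw [← Real.rpow_natCast, ← Real.rpow_add ht]
        congr 1
        rw [Nat.cast_sub hN]; push_cast; ring
      · simp)
  refine lt_of_le_of_lt (le_of_eq ?_) h0
  rw [← lintegral_indicator hm]
  refine lintegral_congr_ae ?_
  filter_upwards [ae_ne_zero hN] with h hh
  simp only [Set.indicator_apply, Set.mem_ofPred_eq, Set.mem_Iic]
  split_ifs
  · rw [enorm_rpow_eq hh, Real.enorm_eq_ofReal (by positivity)]
  · simp

theorem lintegral_unit_outer_lt_top {N : ℕ} (hN : 0 < N) {ε : ℝ} (hε : 0 < ε) :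
    ∫⁻ h : Eu N in {h | 1 < ‖h‖}, ‖h‖ₑ ^ (-ε - N) < ⊤ := by
  have hm : MeasurableSet {h : Eu N | 1 < ‖h‖} := measurableSet_lt (by fun_prop) (by fun_prop)
  have h0 := lintegral_radial_lt_top hN
    (f := (Set.Ioi (1 : ℝ)).indicator fun t => t ^ (-ε - N)) (by
      have h1 : IntegrableOn (fun t : ℝ => t ^ (-ε - 1)) (Set.Ioi 1) :=
        integrableOn_Ioi_rpow_of_lt (by linarith) one_pos
      have h2 : IntegrableOn ((Set.Ioi (1 : ℝ)).indicator fun t : ℝ => t ^ (-ε - 1))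
          (Set.Ioi 0) := by
        rw [integrableOn_indicator_iff measurableSet_Ioi]
        exact h1.mono_set Set.inter_subset_left
      refine h2.congr_fun (fun t ht => ?_) measurableSet_Ioi
      simp only [Set.indicator_apply, smul_eq_mul]
      split_ifs
      · rw [← Real.rpow_natCast, ← Real.rpow_add ht]
        congr 1
        rw [Nat.cast_sub hN]; push_cast; ring
      · simp)
  refine lt_of_le_of_lt (le_of_eq ?_) h0
  rw [← lintegral_indicator hm]
  refine lintegral_congr_ae ?_
  filter_upwards [ae_ne_zero hN] with h hh
  simp only [Set.indicator_apply, Set.mem_ofPred_eq, Set.mem_Ioi]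
  split_ifs
  · rw [enorm_rpow_eq hh, Real.enorm_eq_ofReal (by positivity)]
  · simp

theorem enorm_smul_rpow {N : ℕ} {r : ℝ} (hr : 0 < r) (h : Eu N) (a : ℝ) :
    ‖r • h‖ₑ ^ a = ENNReal.ofReal (r ^ a) * ‖h‖ₑ ^ a := by
  rw [enorm_smul, Real.enorm_eq_ofReal hr.le, ← ENNReal.ofReal_rpow_of_pos hr]
  refine ENNReal.mul_rpow_of_ne_top ?_ ?_ a <;> simp

/-- Homogeneity under `h ↦ r • h`. The pair `S`, `T` is left abstract so that balls and their
exteriors are treated together. -/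
theorem setLIntegral_enorm_rpow_scale {N : ℕ} (a : ℝ) {r : ℝ} (hr : 0 < r) {S T : Set (Eu N)}
    (hS : MeasurableSet S) (hT : MeasurableSet T) (hST : ∀ h, r • h ∈ S ↔ h ∈ T) :
    ∫⁻ h in S, ‖h‖ₑ ^ a = ENNReal.ofReal (r ^ (a + N)) * ∫⁻ h in T, ‖h‖ₑ ^ a := by
  have key := lintegral_comp_smul (S.indicator fun h : Eu N => ‖h‖ₑ ^ a) hr
  have h1 : ∀ h : Eu N, (S.indicator fun h : Eu N => ‖h‖ₑ ^ a) (r • h) =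
      ENNReal.ofReal (r ^ a) * (T.indicator fun h : Eu N => ‖h‖ₑ ^ a) h := by
    intro h
    by_cases hh : h ∈ T
    · rw [Set.indicator_of_mem hh, Set.indicator_of_mem ((hST h).2 hh), enorm_smul_rpow hr]
    · rw [Set.indicator_of_notMem hh, Set.indicator_of_notMem (fun h' => hh ((hST h).1 h')),
        mul_zero]
  simp_rw [h1] at key
  rw [lintegral_const_mul' _ _ ENNReal.ofReal_ne_top, lintegral_indicator hS,
    lintegral_indicator hT] at key
  have hrN : (0 : ℝ) < r ^ N := by positivity
  rw [Real.rpow_add hr, ENNReal.ofReal_mul (by positivity), Real.rpow_natCast,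
    mul_comm (ENNReal.ofReal _) (ENNReal.ofReal (r ^ N)), mul_assoc, key, ← mul_assoc,
    ← ENNReal.ofReal_mul hrN.le, mul_inv_cancel₀ hrN.ne', ENNReal.ofReal_one, one_mul]

theorem measurableSet_norm_le {N : ℕ} (r : ℝ) : MeasurableSet {h : Eu N | ‖h‖ ≤ r} :=
  measurableSet_le (by fun_prop) (by fun_prop)

theorem measurableSet_lt_norm {N : ℕ} (r : ℝ) : MeasurableSet {h : Eu N | r < ‖h‖} :=
  measurableSet_lt (by fun_prop) (by fun_prop)

theorem setLIntegral_inner_eq {N : ℕ} (ε : ℝ) {r : ℝ} (hr : 0 < r) :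
    ∫⁻ h : Eu N in {h | ‖h‖ ≤ r}, ‖h‖ₑ ^ (ε - N) =
      ENNReal.ofReal (r ^ ε) * ∫⁻ h : Eu N in {h | ‖h‖ ≤ 1}, ‖h‖ₑ ^ (ε - N) := by
  rw [setLIntegral_enorm_rpow_scale _ hr (measurableSet_norm_le r) (measurableSet_norm_le 1),
    sub_add_cancel]
  intro h
  simp [norm_smul, abs_of_pos hr, hr]

theorem setLIntegral_outer_eq {N : ℕ} (ε : ℝ) {r : ℝ} (hr : 0 < r) :
    ∫⁻ h : Eu N in {h | r < ‖h‖}, ‖h‖ₑ ^ (-ε - N) =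
      ENNReal.ofReal (r ^ (-ε)) * ∫⁻ h : Eu N in {h | 1 < ‖h‖}, ‖h‖ₑ ^ (-ε - N) := by
  rw [setLIntegral_enorm_rpow_scale _ hr (measurableSet_lt_norm r) (measurableSet_lt_norm 1),
    sub_add_cancel]
  intro h
  simp [norm_smul, abs_of_pos hr, hr]

/-! ### Increments and energies -/

variable {F : Type*} [NormedAddCommGroup F]

/-- The `p`-th power of the `L^p` norm of an increment of `W`. -/
def incr {N : ℕ} (p : ℝ) (W : Eu N → F) (h : Eu N) : ℝ≥0∞ :=
  ∫⁻ x, ‖W (x + h) - W x‖ₑ ^ p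

/-- The double integral of `|W(x) - W(y)|^p / |x - y|^τ`. -/
def energy {N : ℕ} (p τ : ℝ) (W : Eu N → F) : ℝ≥0∞ :=
  ∫⁻ x, ∫⁻ y, ‖W x - W y‖ₑ ^ p * ‖x - y‖ₑ ^ (-τ)

/-- The energy keeps the whole exponent `τ = N + σ p` as one parameter, so that passing between
different `(σ, p)` becomes arithmetic in `τ`. -/
theorem gagliardo_eq_energy {N : ℕ} (σ p : ℝ) (V : Eu N → Eu N) :
    gagliardo σ p V = energy p (N + σ * p) V ^ (1 / p) := by
  simp only [gagliardo, energy, div_eq_mul_inv, ENNReal.rpow_neg]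

theorem energy_congr_ae {N : ℕ} {p τ : ℝ} {W W' : Eu N → F} (h : W =ᵐ[volume] W') :
    energy p τ W = energy p τ W' := by
  refine lintegral_congr_ae ?_
  filter_upwards [h] with x hx
  refine lintegral_congr_ae ?_
  filter_upwards [h] with y hy
  rw [hx, hy]

theorem measurable_incr_integrand {N : ℕ} {p : ℝ} {W : Eu N → F} (hW : StronglyMeasurable W) :
    Measurable fun z : Eu N × Eu N => ‖W (z.1 + z.2) - W z.1‖ₑ ^ p :=
  (((hW.comp_measurable (by fun_prop)).sub
    (hW.comp_measurable measurable_fst)).enorm).pow_const p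

theorem measurable_incr {N : ℕ} {p : ℝ} {W : Eu N → F} (hW : StronglyMeasurable W) :
    Measurable (incr p W) :=
  (measurable_incr_integrand hW).lintegral_prod_left'

/-- Substitute `y = x + h` and use Tonelli. From here on, bounds on energies are bounds on `incr`
integrated against a power of `‖h‖`. -/
theorem energy_eq_lintegral_incr {N : ℕ} {p τ : ℝ} {W : Eu N → F} (hW : StronglyMeasurable W) :
    energy p τ W = ∫⁻ h, incr p W h * ‖h‖ₑ ^ (-τ) := by
  have h1 : ∀ x, ∫⁻ y, ‖W x - W y‖ₑ ^ p * ‖x - y‖ₑ ^ (-τ) =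
      ∫⁻ h, ‖W (x + h) - W x‖ₑ ^ p * ‖h‖ₑ ^ (-τ) := by
    intro x
    rw [← lintegral_add_left_eq_self _ x]
    refine lintegral_congr fun h => ?_
    rw [← enorm_neg (W x - W (x + h)), neg_sub, ← enorm_neg (x - (x + h))]
    simp
  have hm : Measurable fun z : Eu N × Eu N => ‖W (z.1 + z.2) - W z.1‖ₑ ^ p * ‖z.2‖ₑ ^ (-τ) :=
    (measurable_incr_integrand hW).mul (by fun_prop)
  simp only [energy, h1]
  rw [lintegral_lintegral_swap hm.aemeasurable]
  refine lintegral_congr fun h => ?_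
  rw [lintegral_mul_const]
  · rfl
  · exact (measurable_incr_integrand hW).comp (measurable_id.prodMk measurable_const)

theorem incr_le_mul {N : ℕ} {p : ℝ} (hp : 1 ≤ p) {W : Eu N → F} (hW : StronglyMeasurable W)
    (h : Eu N) : incr p W h ≤ 2 ^ p * ∫⁻ x, ‖W x‖ₑ ^ p := by
  have h1 : ∀ x, ‖W (x + h) - W x‖ₑ ^ p ≤ 2 ^ (p - 1) * (‖W (x + h)‖ₑ ^ p + ‖W x‖ₑ ^ p) := by
    intro x
    refine le_trans ?_ (ENNReal.rpow_add_le_mul_rpow_add_rpow _ _ hp)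
    gcongr
    exact enorm_sub_le
  have hm : Measurable fun x => ‖W x‖ₑ ^ p := hW.enorm.pow_const p
  calc incr p W h ≤ ∫⁻ x, 2 ^ (p - 1) * (‖W (x + h)‖ₑ ^ p + ‖W x‖ₑ ^ p) := lintegral_mono h1
    _ = 2 ^ (p - 1) * ((∫⁻ x, ‖W x‖ₑ ^ p) + ∫⁻ x, ‖W x‖ₑ ^ p) := by
      rw [lintegral_const_mul' _ _ (by simp), lintegral_add_right _ hm,
        lintegral_add_right_eq_self (fun x => ‖W x‖ₑ ^ p) h]
    _ = 2 ^ p * ∫⁻ x, ‖W x‖ₑ ^ p := by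
      rw [← two_mul, ← mul_assoc]
      congr 1
      conv_lhs => rw [← ENNReal.rpow_one 2]
      rw [← ENNReal.rpow_mul, ← ENNReal.rpow_add _ _ (by simp) (by simp)]
      congr 1; ring

/-- The part of the energy coming from increments of length more than `1`. -/
theorem lintegral_incr_outer_lt_top {N : ℕ} (hN : 0 < N) {p τ : ℝ} (hp : 1 ≤ p)
    (hτ : (N : ℝ) < τ) {W : Eu N → F} (hW : StronglyMeasurable W)
    (hWp : ∫⁻ x, ‖W x‖ₑ ^ p < ⊤) :
    ∫⁻ h in {h : Eu N | 1 < ‖h‖}, incr p W h * ‖h‖ₑ ^ (-τ) < ⊤ := by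
  calc ∫⁻ h in {h : Eu N | 1 < ‖h‖}, incr p W h * ‖h‖ₑ ^ (-τ)
      ≤ ∫⁻ h in {h : Eu N | 1 < ‖h‖}, (2 ^ p * ∫⁻ x, ‖W x‖ₑ ^ p) * ‖h‖ₑ ^ (-(τ - N) - N) := by
        refine lintegral_mono fun h => ?_
        rw [show -(τ - (N : ℝ)) - N = -τ by ring]
        gcongr
        exact incr_le_mul hp hW h
    _ = (2 ^ p * ∫⁻ x, ‖W x‖ₑ ^ p) * ∫⁻ h in {h : Eu N | 1 < ‖h‖}, ‖h‖ₑ ^ (-(τ - N) - N) :=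
        lintegral_const_mul' _ _ (ENNReal.mul_ne_top
          (ENNReal.rpow_ne_top_of_nonneg (by linarith) (by simp)) hWp.ne)
    _ < ⊤ := ENNReal.mul_lt_top (ENNReal.mul_lt_top
        (ENNReal.rpow_lt_top_of_nonneg (by linarith) (by simp)) hWp)
        (lintegral_unit_outer_lt_top hN (by linarith))

/-- Long increments cost only the `L^p` norm, because the kernel is integrable at infinity when `τ >
N`. Finiteness of the energy is thus a question about `‖h‖ ≤ 1`. -/
theorem energy_lt_top_iff_inner {N : ℕ} (hN : 0 < N) {p τ : ℝ} (hp : 1 ≤ p)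
    (hτ : (N : ℝ) < τ) {W : Eu N → F} (hW : StronglyMeasurable W)
    (hWp : ∫⁻ x, ‖W x‖ₑ ^ p < ⊤) :
    energy p τ W < ⊤ ↔ ∫⁻ h in {h : Eu N | ‖h‖ ≤ 1}, incr p W h * ‖h‖ₑ ^ (-τ) < ⊤ := by
  have hc : {h : Eu N | ‖h‖ ≤ 1}ᶜ = {h : Eu N | 1 < ‖h‖} := by ext; simp
  rw [energy_eq_lintegral_incr hW, ← lintegral_add_compl _ (measurableSet_norm_le (N := N) 1), hc,
    ENNReal.add_lt_top]
  exact and_iff_left (lintegral_incr_outer_lt_top hN hp hτ hW hWp)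

/-- Lowering the smoothness exponent. -/
theorem energy_lt_top_of_le {N : ℕ} (hN : 0 < N) {p τ τ' : ℝ} (hp : 1 ≤ p)
    (hτ' : (N : ℝ) < τ') (hττ' : τ' ≤ τ) {W : Eu N → F} (hW : StronglyMeasurable W)
    (hWp : ∫⁻ x, ‖W x‖ₑ ^ p < ⊤) (hE : energy p τ W < ⊤) : energy p τ' W < ⊤ := by
  rw [energy_lt_top_iff_inner hN hp hτ' hW hWp]
  rw [energy_lt_top_iff_inner hN hp (hτ'.trans_le hττ') hW hWp] at hE
  refine lt_of_le_of_lt (setLIntegral_mono' (measurableSet_norm_le 1) fun h hh => ?_) hE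
  refine mul_le_mul' le_rfl ?_
  refine ENNReal.rpow_le_rpow_of_exponent_ge ?_ (by linarith)
  rw [← ofReal_norm]
  exact ENNReal.ofReal_le_one.2 hh

/-! ### The fractional Sobolev inequality -/

theorem volume_ball_eq {N : ℕ} (x : Eu N) {r : ℝ} (hr : 0 < r) :
    volume (Metric.ball x r) = ENNReal.ofReal (volume.real (Metric.ball (0 : Eu N) 1) * r ^ N) := by
  rw [Measure.addHaar_ball_of_pos volume x hr, finrank_euclideanSpace_fin, mul_comm,
    ENNReal.ofReal_mul measureReal_nonneg, ofReal_measureReal]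

theorem volume_real_unit_ball_pos (N : ℕ) : 0 < volume.real (Metric.ball (0 : Eu N) 1) :=
  ENNReal.toReal_pos (Metric.measure_ball_pos volume _ one_pos).ne' measure_ball_lt_top.ne

theorem le_two_mul_or_le_two_mul {a b v : ℝ≥0∞} (h : v ≤ a + b) : v ≤ 2 * a ∨ v ≤ 2 * b := by
  rcases le_total a b with hab | hab
  · right; rw [two_mul]; exact h.trans (by gcongr)
  · left; rw [two_mul]; exact h.trans (by gcongr)

/-- Chebyshev's inequality in pointwise form: `1` is dominated wherever `a` is at least half of `v`.
-/
theorem one_le_rpow_two_mul_div {v a : ℝ≥0∞} (hv0 : v ≠ 0) (hv : v ≠ ⊤) (h : v ≤ 2 * a) {p : ℝ}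
    (hp : 0 < p) : 1 ≤ (2 / v) ^ p * a ^ p := by
  rw [← ENNReal.mul_rpow_of_nonneg _ _ hp.le]
  refine ENNReal.one_le_rpow ?_ hp
  rw [← ENNReal.div_self hv0 hv, div_eq_mul_inv, div_eq_mul_inv, mul_right_comm]
  gcongr

/-- The averaging inequality behind the Sobolev inequality. -/
theorem volume_ball_le_of_truncation {N : ℕ} (hN : 0 < N) {p : ℝ} (hp : 1 ≤ p) (hpN : p < N)
    {W : Eu N → F} (hW : StronglyMeasurable W) {M : ℝ≥0∞} (hM : M ≠ ⊤) (x : Eu N)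
    (hx : min ‖W x‖ₑ M ≠ 0) {r : ℝ} (hr : 0 < r) :
    ENNReal.ofReal (volume.real (Metric.ball (0 : Eu N) 1) * r ^ N) ≤
      (2 / min ‖W x‖ₑ M) ^ (N : ℝ) * (∫⁻ y, (min ‖W y‖ₑ M) ^ (N : ℝ)) +
      (2 / min ‖W x‖ₑ M) ^ p * (ENNReal.ofReal (r ^ (2 * N - p)) *
        ∫⁻ y, ‖W x - W y‖ₑ ^ p * ‖x - y‖ₑ ^ (-(2 * N - p))) := by
  set v := min ‖W x‖ₑ M with hv
  have hvtop : v ≠ ⊤ := ne_top_of_le_ne_top hM (min_le_right _ _)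
  have hNpos : (0 : ℝ) < N := by exact_mod_cast hN
  have hmW : Measurable fun y => (2 / v) ^ (N : ℝ) * (min ‖W y‖ₑ M) ^ (N : ℝ) :=
    ((hW.enorm.min measurable_const).pow_const _).const_mul _
  have hc1 : (2 / v) ^ (N : ℝ) ≠ ⊤ :=
    ENNReal.rpow_ne_top_of_nonneg hNpos.le (ENNReal.div_ne_top (by simp) hx)
  have hc2 : (2 / v) ^ p ≠ ⊤ :=
    ENNReal.rpow_ne_top_of_nonneg (by linarith) (ENNReal.div_ne_top (by simp) hx)
  rw [← volume_ball_eq x hr, ← setLIntegral_one]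
  calc ∫⁻ _ in Metric.ball x r, (1 : ℝ≥0∞)
      ≤ ∫⁻ y in Metric.ball x r, ((2 / v) ^ (N : ℝ) * (min ‖W y‖ₑ M) ^ (N : ℝ) +
          (2 / v) ^ p * (ENNReal.ofReal (r ^ (2 * N - p)) *
            (‖W x - W y‖ₑ ^ p * ‖x - y‖ₑ ^ (-(2 * N - p))))) := by
        refine setLIntegral_mono' measurableSet_ball fun y hy => ?_
        have hle : v ≤ min ‖W y‖ₑ M + ‖W x - W y‖ₑ := by
          have h1 : ‖W x‖ₑ ≤ ‖W y‖ₑ + ‖W x - W y‖ₑ := by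
            calc ‖W x‖ₑ = ‖W y + (W x - W y)‖ₑ := by rw [add_sub_cancel]
              _ ≤ _ := enorm_add_le _ _
          rw [min_add]
          exact le_min ((min_le_left _ _).trans h1)
            ((min_le_right _ _).trans (le_add_of_nonneg_right zero_le))
        -- Each `y` in the ball either has truncated size at least `v / 2` or differs from `x` by at
        -- least `v / 2`; the two alternatives produce the two terms of the bound.
        rcases le_two_mul_or_le_two_mul hle with h | h
        · exact (one_le_rpow_two_mul_div hx hvtop h hNpos).trans le_self_add
        · refine (one_le_rpow_two_mul_div hx hvtop h (by linarith : 0 < p)).trans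
            (le_trans ?_ le_add_self)
          gcongr
          by_cases hxy : x = y
          · subst hxy
            simp [ENNReal.zero_rpow_of_pos (by linarith : 0 < p)]
          · have hxy' : x - y ≠ 0 := sub_ne_zero.2 hxy
            have hpos := norm_pos_iff.2 hxy'
            -- On the ball `‖x - y‖ < r`, so the normalised kernel is at least `1` and can be
            -- inserted.
            have h1 : (1 : ℝ≥0∞) ≤ ENNReal.ofReal (r ^ (2 * N - p)) * ‖x - y‖ₑ ^ (-(2 * N - p)) := by
              rw [enorm_rpow_eq hxy', ← ENNReal.ofReal_mul (by positivity), ENNReal.one_le_ofReal,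
                Real.rpow_neg hpos.le, ← div_eq_mul_inv, one_le_div (by positivity)]
              refine Real.rpow_le_rpow hpos.le ?_ (by linarith)
              rw [← dist_eq_norm, dist_comm]
              exact (Metric.mem_ball.1 hy).le
            calc ‖W x - W y‖ₑ ^ p = 1 * ‖W x - W y‖ₑ ^ p := (one_mul _).symm
              _ ≤ _ := by
                rw [mul_left_comm, mul_comm (‖W x - W y‖ₑ ^ p)]
                gcongr
    _ ≤ ∫⁻ y, ((2 / v) ^ (N : ℝ) * (min ‖W y‖ₑ M) ^ (N : ℝ) +
          (2 / v) ^ p * (ENNReal.ofReal (r ^ (2 * N - p)) *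
            (‖W x - W y‖ₑ ^ p * ‖x - y‖ₑ ^ (-(2 * N - p))))) := setLIntegral_le_lintegral _ _
    _ = _ := by
        rw [lintegral_add_left hmW, lintegral_const_mul' _ _ hc1, lintegral_const_mul' _ _ hc2,
          lintegral_const_mul' _ _ ENNReal.ofReal_ne_top]

/-- Choose `r` so that the first term absorbs half of the left side. What remains is `v ^ p ≤ C r ^
(N - p) D`; multiplying by `v ^ (N - p)` eliminates `r`, since `(r v) ^ N` is a constant times `X`.
-/
theorem pow_le_of_ball_inequality {N p c v X D : ℝ} (hpN : p < N) (hp : 0 < p) (hc : 0 < c)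
    (hv : 0 < v) (hX : 0 < X)
    (h : ∀ r : ℝ, 0 < r → c * r ^ N ≤ (2 / v) ^ N * X + (2 / v) ^ p * (r ^ (2 * N - p) * D)) :
    v ^ N ≤ 2 ^ (p + 1) / c * (2 ^ (N + 1) / c) ^ (1 - p / N) * (X ^ (1 - p / N) * D) := by
  have hN : 0 < N := hp.trans hpN
  -- `A` is the value of `r ^ N` for which `(2 / v) ^ N * X` equals `c * r ^ N / 2`.
  set A : ℝ := 2 ^ (N + 1) / c * (X / v ^ N) with hA
  have hApos : 0 < A := by positivity
  set r : ℝ := A ^ (1 / N) with hr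
  have hrpos : 0 < r := by positivity
  have hrN : r ^ N = A := by
    rw [hr, ← Real.rpow_mul hApos.le, one_div_mul_cancel hN.ne', Real.rpow_one]
  have h1 := h r hrpos
  have h2 : (2 / v) ^ N * X = c / 2 * r ^ N := by
    rw [hrN, hA, Real.div_rpow (by norm_num) hv.le, Real.rpow_add (by norm_num), Real.rpow_one]
    field_simp
  have h3 : r ^ (2 * N - p) = r ^ N * r ^ (N - p) := by
    rw [← Real.rpow_add hrpos]; congr 1; ring
  rw [h2, h3, Real.div_rpow (by norm_num) hv.le] at h1
  have hrNpos : 0 < r ^ N := by positivity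
  have hvp : 0 < v ^ p := by positivity
  have h4 : c / 2 ≤ 2 ^ p / v ^ p * (r ^ (N - p) * D) := by
    refine le_of_mul_le_mul_right ?_ hrNpos
    nlinarith
  have h5 : v ^ p ≤ 2 ^ (p + 1) / c * (r ^ (N - p) * D) := by
    rw [Real.rpow_add (by norm_num), Real.rpow_one]
    have : c / 2 * v ^ p ≤ 2 ^ p * (r ^ (N - p) * D) := by
      calc c / 2 * v ^ p ≤ 2 ^ p / v ^ p * (r ^ (N - p) * D) * v ^ p := by gcongr
        _ = _ := by field_simp
    calc v ^ p = 2 / c * (c / 2 * v ^ p) := by field_simp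
      _ ≤ 2 / c * (2 ^ p * (r ^ (N - p) * D)) := by gcongr
      _ = _ := by ring
  have h6 : r ^ (N - p) * v ^ (N - p) = (2 ^ (N + 1) / c) ^ (1 - p / N) * X ^ (1 - p / N) := by
    have e : N - p = N * (1 - p / N) := by field_simp
    rw [← Real.mul_rpow hrpos.le hv.le, e, Real.rpow_mul (by positivity),
      Real.mul_rpow hrpos.le hv.le, hrN, ← Real.mul_rpow (by positivity) hX.le]
    congr 1
    rw [hA]; field_simp
  calc v ^ N = v ^ p * v ^ (N - p) := by rw [← Real.rpow_add hv]; congr 1; ring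
    _ ≤ 2 ^ (p + 1) / c * (r ^ (N - p) * D) * v ^ (N - p) := by gcongr
    _ = 2 ^ (p + 1) / c * (r ^ (N - p) * v ^ (N - p)) * D := by ring
    _ = _ := by rw [h6]; ring

/-- The constant in the fractional Sobolev inequality for truncations. -/
def sobolevConst (N : ℕ) (p : ℝ) : ℝ :=
  2 ^ (p + 1) / volume.real (Metric.ball (0 : Eu N) 1) *
    (2 ^ ((N : ℝ) + 1) / volume.real (Metric.ball (0 : Eu N) 1)) ^ (1 - p / N)

theorem sobolevConst_pos (N : ℕ) (p : ℝ) : 0 < sobolevConst N p := by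
  have := volume_real_unit_ball_pos N
  unfold sobolevConst; positivity

/-- The optimised ball inequality in extended reals. Integrated over `x` it reads `X ≤ C X ^ (1 -
p/N) G`, with `X` on both sides and `G` the energy. -/
theorem truncation_rpow_le {N : ℕ} (hN : 0 < N) {p : ℝ} (hp : 1 ≤ p) (hpN : p < N)
    {W : Eu N → F} (hW : StronglyMeasurable W) {M : ℝ≥0∞} (hM : M ≠ ⊤)
    (hX0 : ∫⁻ y, (min ‖W y‖ₑ M) ^ (N : ℝ) ≠ 0) (hX : ∫⁻ y, (min ‖W y‖ₑ M) ^ (N : ℝ) ≠ ⊤)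
    (x : Eu N) :
    (min ‖W x‖ₑ M) ^ (N : ℝ) ≤ ENNReal.ofReal (sobolevConst N p) *
      ((∫⁻ y, (min ‖W y‖ₑ M) ^ (N : ℝ)) ^ (1 - p / N) *
        ∫⁻ y, ‖W x - W y‖ₑ ^ p * ‖x - y‖ₑ ^ (-(2 * N - p))) := by
  have hNpos : (0 : ℝ) < N := by exact_mod_cast hN
  by_cases hx : min ‖W x‖ₑ M = 0
  · rw [hx, ENNReal.zero_rpow_of_pos hNpos]; exact zero_le
  have hball := fun r hr => volume_ball_le_of_truncation (r := r) hN hp hpN hW hM x hx hr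
  have hvtop : min ‖W x‖ₑ M ≠ ⊤ := ne_top_of_le_ne_top hM (min_le_right _ _)
  generalize min ‖W x‖ₑ M = v at *
  generalize (∫⁻ y, (min ‖W y‖ₑ M) ^ (N : ℝ)) = X at *
  generalize (∫⁻ y, ‖W x - W y‖ₑ ^ p * ‖x - y‖ₑ ^ (-(2 * N - p))) = D at *
  have hθ : 0 < 1 - p / N := by rw [sub_pos, div_lt_one hNpos]; exact hpN
  have hC := sobolevConst_pos N p
  by_cases hD : D = ⊤
  · rw [hD, ENNReal.mul_top, ENNReal.mul_top]
    · exact le_top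
    · simpa using hC
    · simp [ENNReal.rpow_eq_zero_iff, hX0, hX]
  lift v to NNReal using hvtop
  lift X to NNReal using hX
  lift D to NNReal using hD
  have hv : (0 : ℝ) < v := by
    have : v ≠ 0 := by simpa using hx
    positivity
  have hX : (0 : ℝ) < X := by
    have : X ≠ 0 := by simpa using hX0
    positivity
  have key := pow_le_of_ball_inequality (N := N) (p := p) hpN (by linarith)
    (volume_real_unit_ball_pos N) hv hX (D := D) (by
      intro r hr
      have := hball r hr
      have h2v : 2 / ENNReal.ofReal (v : ℝ) = ENNReal.ofReal (2 / v) := by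
        rw [ENNReal.ofReal_div_of_pos hv]; simp
      rw [← ENNReal.ofReal_coe_nnreal (p := v), ← ENNReal.ofReal_coe_nnreal (p := X),
        ← ENNReal.ofReal_coe_nnreal (p := D), h2v, ENNReal.ofReal_rpow_of_pos (by positivity),
        ENNReal.ofReal_rpow_of_pos (by positivity), ← ENNReal.ofReal_mul (by positivity),
        ← ENNReal.ofReal_mul (by positivity), ← ENNReal.ofReal_mul (by positivity),
        ← ENNReal.ofReal_add (by positivity) (by positivity),
        ENNReal.ofReal_le_ofReal_iff (by positivity)] at this
      simpa using this)
  rw [← ENNReal.ofReal_coe_nnreal (p := v), ← ENNReal.ofReal_coe_nnreal (p := X),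
    ← ENNReal.ofReal_coe_nnreal (p := D), ENNReal.ofReal_rpow_of_pos hv,
    ENNReal.ofReal_rpow_of_pos hX, ← ENNReal.ofReal_mul (by positivity),
    ← ENNReal.ofReal_mul (by positivity)]
  exact ENNReal.ofReal_le_ofReal key

/-- Divide `X ≤ C X ^ (1 - p/N) G` by the power of `X`. This is legitimate because the truncation
makes `X` finite: `X ≤ M ^ (N - p) ∫ ‖W‖ ^ p`. -/
theorem truncation_sobolev {N : ℕ} (hN : 0 < N) {p : ℝ} (hp : 1 ≤ p) (hpN : p < N)
    {W : Eu N → F} (hW : StronglyMeasurable W) (hWp : ∫⁻ x, ‖W x‖ₑ ^ p < ⊤) {M : ℝ≥0∞}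
    (hM : M ≠ ⊤) :
    ∫⁻ y, (min ‖W y‖ₑ M) ^ (N : ℝ) ≤
      (ENNReal.ofReal (sobolevConst N p) * energy p (2 * N - p) W) ^ ((N : ℝ) / p) := by
  have hNpos : (0 : ℝ) < N := by exact_mod_cast hN
  have hp0 : 0 < p := by linarith
  by_cases hX0 : ∫⁻ y, (min ‖W y‖ₑ M) ^ (N : ℝ) = 0
  · rw [hX0]; exact zero_le
  have hX : ∫⁻ y, (min ‖W y‖ₑ M) ^ (N : ℝ) ≠ ⊤ := by
    refine ne_top_of_le_ne_top (b := M ^ ((N : ℝ) - p) * ∫⁻ x, ‖W x‖ₑ ^ p) ?_ ?_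
    · exact ENNReal.mul_ne_top (ENNReal.rpow_ne_top_of_nonneg (by linarith) hM) hWp.ne
    · rw [← lintegral_const_mul' _ _ (ENNReal.rpow_ne_top_of_nonneg (by linarith) hM)]
      refine lintegral_mono fun y => ?_
      have e : (N : ℝ) = (N - p) + p := by ring
      conv_lhs => rw [e, ENNReal.rpow_add_of_nonneg _ _ (by linarith) hp0.le]
      exact mul_le_mul' (ENNReal.rpow_le_rpow (min_le_right _ _) (by linarith))
        (ENNReal.rpow_le_rpow (min_le_left _ _) hp0.le)
  have h1 := lintegral_mono (μ := volume) (truncation_rpow_le hN hp hpN hW hM hX0 hX)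
  have hθ : 0 ≤ 1 - p / N := by rw [sub_nonneg, div_le_one hNpos]; exact hpN.le
  rw [lintegral_const_mul' _ _ ENNReal.ofReal_ne_top, lintegral_const_mul' _ _
    (ENNReal.rpow_ne_top_of_nonneg hθ hX)] at h1
  change _ ≤ _ * (_ * energy p (2 * N - p) W) at h1
  set X := ∫⁻ y, (min ‖W y‖ₑ M) ^ (N : ℝ)
  set G := energy p (2 * N - p) W
  have h2 : X ^ (p / N) ≤ ENNReal.ofReal (sobolevConst N p) * G := by
    have hne0 : X ^ (1 - p / N) ≠ 0 := by simp [ENNReal.rpow_eq_zero_iff, hX0, hX]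
    have hnet : X ^ (1 - p / N) ≠ ⊤ := ENNReal.rpow_ne_top_of_nonneg hθ hX
    rw [← ENNReal.mul_le_mul_iff_right hne0 hnet, ← ENNReal.rpow_add _ _ hX0 hX]
    rw [sub_add_cancel, ENNReal.rpow_one]
    calc X ≤ _ := h1
      _ = _ := by ring
  calc X = (X ^ (p / N)) ^ ((N : ℝ) / p) := by
        rw [← ENNReal.rpow_mul, div_mul_div_cancel₀ hNpos.ne', div_self hp0.ne', ENNReal.rpow_one]
    _ ≤ _ := by gcongr

/-- The fractional Sobolev inequality with target exponent `N`. -/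
theorem fractional_sobolev {N : ℕ} (hN : 0 < N) {p : ℝ} (hp : 1 ≤ p) (hpN : p < N)
    {W : Eu N → F} (hW : StronglyMeasurable W) (hWp : ∫⁻ x, ‖W x‖ₑ ^ p < ⊤) :
    ∫⁻ y, ‖W y‖ₑ ^ (N : ℝ) ≤
      (ENNReal.ofReal (sobolevConst N p) * energy p (2 * N - p) W) ^ ((N : ℝ) / p) := by
  have hNpos : (0 : ℝ) < N := by exact_mod_cast hN
  -- The truncated bound does not depend on `M`, so monotone convergence removes the truncation.
  have hlim : ∀ y, ‖W y‖ₑ ^ (N : ℝ) = ⨆ M : ℕ, (min ‖W y‖ₑ (M : ℝ≥0∞)) ^ (N : ℝ) := by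
    intro y
    refine le_antisymm ?_ (iSup_le fun M => by gcongr; exact min_le_left _ _)
    obtain ⟨M, hM⟩ := exists_nat_ge ‖W y‖
    refine le_trans (le_of_eq ?_) (le_iSup _ M)
    rw [min_eq_left]
    rw [← ofReal_norm, ← ENNReal.ofReal_natCast]
    exact ENNReal.ofReal_le_ofReal hM
  simp_rw [hlim]
  rw [lintegral_iSup]
  · exact iSup_le fun M => truncation_sobolev hN hp hpN hW hWp (ENNReal.natCast_ne_top M)
  · exact fun M => (hW.enorm.min measurable_const).pow_const _
  · intro M M' hMM' y
    dsimp only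
    gcongr

/-! ### Embedding between fractional Sobolev spaces -/

/-- The contribution of the increments shorter than `‖h‖` to the energy. -/
def shortEnergy {N : ℕ} (p τ : ℝ) (W : Eu N → F) (h : Eu N) : ℝ≥0∞ :=
  ∫⁻ k in {k | ‖k‖ < ‖h‖}, incr p W k * ‖k‖ₑ ^ (-τ)

theorem measurableSet_norm_lt {N : ℕ} (r : ℝ) : MeasurableSet {k : Eu N | ‖k‖ < r} :=
  measurableSet_lt (by fun_prop) (by fun_prop)

theorem two_rpow_sub_one_mul_two (p : ℝ) : (2 : ℝ≥0∞) ^ (p - 1) * 2 = 2 ^ p := by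
  nth_rewrite 2 [← ENNReal.rpow_one 2]
  rw [← ENNReal.rpow_add _ _ (by simp) (by simp), sub_add_cancel]

theorem incr_add_le {N : ℕ} {p : ℝ} (hp : 1 ≤ p) {W : Eu N → F} (hW : StronglyMeasurable W)
    (h k : Eu N) : incr p W h ≤ 2 ^ (p - 1) * (incr p W k + incr p W (h - k)) := by
  have hm : Measurable fun x => ‖W (x + k) - W x‖ₑ ^ p :=
    (measurable_incr_integrand hW).comp (measurable_id.prodMk measurable_const)
  have h1 : ∀ x, ‖W (x + h) - W x‖ₑ ^ p ≤
      2 ^ (p - 1) * (‖W (x + k) - W x‖ₑ ^ p + ‖W (x + k + (h - k)) - W (x + k)‖ₑ ^ p) := by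
    intro x
    refine le_trans ?_ (ENNReal.rpow_add_le_mul_rpow_add_rpow _ _ hp)
    gcongr
    refine le_trans (le_of_eq ?_) (enorm_add_le _ _)
    congr 1
    rw [show x + k + (h - k) = x + h by abel]
    abel
  calc incr p W h ≤ _ := lintegral_mono h1
    _ = _ := by
      rw [lintegral_const_mul' _ _ (by simp), lintegral_add_left hm,
        lintegral_add_right_eq_self (fun x => ‖W (x + (h - k)) - W x‖ₑ ^ p) k]
      rfl

/-- Average the splitting `h = k + (h - k)` over the ball having the segment from `0` to `h` as
diameter. There both `k` and `h - k` are shorter than `h`. -/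
theorem volume_mul_incr_le {N : ℕ} {p : ℝ} (hp : 1 ≤ p) {W : Eu N → F}
    (hW : StronglyMeasurable W) (h : Eu N) :
    volume (Metric.ball ((1 / 2 : ℝ) • h) (‖h‖ / 2)) * incr p W h ≤
      2 ^ p * ∫⁻ k in {k | ‖k‖ < ‖h‖}, incr p W k := by
  set S := {k : Eu N | ‖k‖ < ‖h‖}
  have hS : MeasurableSet S := measurableSet_norm_lt _
  have hg : Measurable (S.indicator (incr p W)) := (measurable_incr hW).indicator hS
  have hhalf : ‖(1 / 2 : ℝ) • h‖ = ‖h‖ / 2 := by rw [norm_smul]; norm_num; ring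
  rw [mul_comm, ← setLIntegral_const]
  calc ∫⁻ _ in Metric.ball ((1 / 2 : ℝ) • h) (‖h‖ / 2), incr p W h
      ≤ ∫⁻ k in Metric.ball ((1 / 2 : ℝ) • h) (‖h‖ / 2),
          2 ^ (p - 1) * (S.indicator (incr p W) k + S.indicator (incr p W) (h - k)) := by
        refine setLIntegral_mono' measurableSet_ball fun k hk => ?_
        rw [mem_ball_iff_norm] at hk
        have hk1 : k ∈ S := by
          change ‖k‖ < ‖h‖
          calc ‖k‖ = ‖(k - (1 / 2 : ℝ) • h) + (1 / 2 : ℝ) • h‖ := by rw [sub_add_cancel]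
            _ ≤ _ := norm_add_le _ _
            _ < ‖h‖ := by rw [hhalf]; linarith
        have hk2 : h - k ∈ S := by
          change ‖h - k‖ < ‖h‖
          calc ‖h - k‖ = ‖(1 / 2 : ℝ) • h - (k - (1 / 2 : ℝ) • h)‖ := by
                congr 1
                rw [sub_sub_eq_add_sub, ← add_smul]; norm_num
            _ ≤ _ := norm_sub_le _ _
            _ < ‖h‖ := by rw [hhalf]; linarith
        rw [Set.indicator_of_mem hk1, Set.indicator_of_mem hk2]
        exact incr_add_le hp hW h k
    _ ≤ ∫⁻ k, 2 ^ (p - 1) * (S.indicator (incr p W) k + S.indicator (incr p W) (h - k)) :=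
        setLIntegral_le_lintegral _ _
    _ = 2 ^ p * ∫⁻ k in S, incr p W k := by
        rw [lintegral_const_mul' _ _ (by simp), lintegral_add_left hg,
          lintegral_sub_left_eq_self (S.indicator (incr p W)) h, lintegral_indicator hS, ← two_mul,
          ← mul_assoc, two_rpow_sub_one_mul_two]

theorem lintegral_short_le {N : ℕ} {p τ : ℝ} (hτ : 0 ≤ τ) {W : Eu N → F}
    {h : Eu N} (hh : h ≠ 0) :
    ‖h‖ₑ ^ (-τ) * ∫⁻ k in {k | ‖k‖ < ‖h‖}, incr p W k ≤ shortEnergy p τ W h := by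
  have hfin : ‖h‖ₑ ^ (-τ) ≠ ⊤ := by
    rw [enorm_rpow_eq hh]; exact ENNReal.ofReal_ne_top
  rw [← lintegral_const_mul' _ _ hfin]
  refine setLIntegral_mono' (measurableSet_norm_lt _) fun k hk => ?_
  rw [mul_comm]
  refine mul_le_mul' le_rfl ?_
  rw [ENNReal.rpow_neg, ENNReal.rpow_neg, ENNReal.inv_le_inv]
  refine ENNReal.rpow_le_rpow ?_ hτ
  rw [← ofReal_norm, ← ofReal_norm]
  exact ENNReal.ofReal_le_ofReal (le_of_lt hk)

/-- One increment is controlled by all shorter ones: the averaging ball has volume comparable to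
`‖h‖ ^ N`, and `‖k‖ ^ (-τ)` exceeds `‖h‖ ^ (-τ)` for shorter `k`. -/
theorem incr_mul_le_shortEnergy {N : ℕ} {p : ℝ} (hp : 1 ≤ p) {τ : ℝ} (hτ : 0 ≤ τ) {W : Eu N → F}
    (hW : StronglyMeasurable W) {h : Eu N} (hh : h ≠ 0) :
    incr p W h * ‖h‖ₑ ^ ((N : ℝ) - τ) ≤
      ENNReal.ofReal (volume.real (Metric.ball (0 : Eu N) 1) / 2 ^ N)⁻¹ * 2 ^ p *
        shortEnergy p τ W h := by
  have hpos := norm_pos_iff.2 hh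
  set c := volume.real (Metric.ball (0 : Eu N) 1)
  have hc : 0 < c := volume_real_unit_ball_pos N
  have h1 := volume_mul_incr_le hp hW h
  rw [volume_ball_eq _ (by positivity)] at h1
  have h2 := lintegral_short_le (p := p) hτ (W := W) hh
  have e : ‖h‖ₑ ^ ((N : ℝ) - τ) = ENNReal.ofReal (c / 2 ^ N)⁻¹ *
      (ENNReal.ofReal (c * (‖h‖ / 2) ^ N) * ‖h‖ₑ ^ (-τ)) := by
    rw [enorm_rpow_eq hh, enorm_rpow_eq hh, ← ENNReal.ofReal_mul (by positivity),
      ← ENNReal.ofReal_mul (by positivity), Real.rpow_sub hpos, Real.rpow_neg hpos.le,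
      Real.rpow_natCast]
    congr 1
    rw [div_pow]
    field_simp
  calc incr p W h * ‖h‖ₑ ^ ((N : ℝ) - τ)
      = ENNReal.ofReal (c / 2 ^ N)⁻¹ * (‖h‖ₑ ^ (-τ) *
          (ENNReal.ofReal (c * (‖h‖ / 2) ^ N) * incr p W h)) := by rw [e]; ring
    _ ≤ ENNReal.ofReal (c / 2 ^ N)⁻¹ * (‖h‖ₑ ^ (-τ) *
          (2 ^ p * ∫⁻ k in {k | ‖k‖ < ‖h‖}, incr p W k)) := by gcongr
    _ = ENNReal.ofReal (c / 2 ^ N)⁻¹ * 2 ^ p * (‖h‖ₑ ^ (-τ) *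
          ∫⁻ k in {k | ‖k‖ < ‖h‖}, incr p W k) := by ring
    _ ≤ _ := by gcongr

/-- Differences in `h` and `k` commute, so the trivial bound can be spent on the difference in `h`.
-/
theorem incr_incr_le {N : ℕ} {p : ℝ} (hp : 1 ≤ p) {W : Eu N → F} (hW : StronglyMeasurable W)
    (h k : Eu N) : incr p (fun x => W (x + h) - W x) k ≤ 2 ^ p * incr p W k := by
  have hV : StronglyMeasurable fun x => W (x + k) - W x :=
    (hW.comp_measurable (by fun_prop)).sub hW
  have := incr_le_mul hp hV h
  refine le_trans (le_of_eq (lintegral_congr fun x => ?_)) this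
  congr 2
  dsimp only
  rw [show x + k + h = x + h + k by abel]
  abel

/-- The outer radial integral. -/
def outerConst (N : ℕ) (ε : ℝ) : ℝ≥0∞ := ∫⁻ h : Eu N in {h | 1 < ‖h‖}, ‖h‖ₑ ^ (-ε - N)

/-- Split the second differences at `‖k‖ = ‖h‖`. For short `k`, discard the difference in `h`; for
long `k`, discard the one in `k`, integrate the kernel, and absorb the resulting `incr p W h * ‖h‖ ^
(N - τ)` by `incr_mul_le_shortEnergy`. -/
theorem energy_increment_le {N : ℕ} (hN : 0 < N) {p τ : ℝ} (hp : 1 ≤ p) (hτ : (N : ℝ) < τ) :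
    ∃ C : ℝ≥0∞, C ≠ ⊤ ∧ ∀ W : Eu N → F, StronglyMeasurable W →
      ∫⁻ x, ‖W x‖ₑ ^ p < ⊤ → ∀ h : Eu N, h ≠ 0 →
      energy p τ (fun x => W (x + h) - W x) ≤ C * shortEnergy p τ W h := by
  have hNpos : (0 : ℝ) < N := by exact_mod_cast hN
  set c := volume.real (Metric.ball (0 : Eu N) 1)
  have h2p : (2 : ℝ≥0∞) ^ p ≠ ⊤ := ENNReal.rpow_ne_top_of_nonneg (by linarith) (by simp)
  refine ⟨2 ^ p + 2 ^ p * (ENNReal.ofReal ((1 / 2) ^ (-(τ - N))) * outerConst N (τ - N)) *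
    (ENNReal.ofReal (c / 2 ^ N)⁻¹ * 2 ^ p), ?_, ?_⟩
  · refine ENNReal.add_ne_top.2 ⟨h2p, ENNReal.mul_ne_top (ENNReal.mul_ne_top h2p
      (ENNReal.mul_ne_top ENNReal.ofReal_ne_top ?_)) (ENNReal.mul_ne_top ENNReal.ofReal_ne_top h2p)⟩
    exact (lintegral_unit_outer_lt_top hN (by linarith)).ne
  intro W hW hWp h hh
  have hpos := norm_pos_iff.2 hh
  have hw : StronglyMeasurable fun x => W (x + h) - W x :=
    (hW.comp_measurable (by fun_prop)).sub hW
  have hout : ∫⁻ k in {k : Eu N | ‖k‖ < ‖h‖}ᶜ,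
      incr p (fun x => W (x + h) - W x) k * ‖k‖ₑ ^ (-τ) ≤
      2 ^ p * (ENNReal.ofReal ((1 / 2) ^ (-(τ - N))) * outerConst N (τ - N)) *
        (incr p W h * ‖h‖ₑ ^ ((N : ℝ) - τ)) := by
    have hi : incr p W h ≠ ⊤ := ((incr_le_mul hp hW h).trans_lt
      (ENNReal.mul_lt_top h2p.lt_top hWp)).ne
    calc _ ≤ ∫⁻ k in {k : Eu N | ‖k‖ < ‖h‖}ᶜ, 2 ^ p * incr p W h * ‖k‖ₑ ^ (-(τ - N) - N) := by
          refine lintegral_mono fun k => ?_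
          rw [show -(τ - (N : ℝ)) - N = -τ by ring]
          gcongr
          exact incr_le_mul hp hw k
      -- The complement is the closed exterior `‖h‖ ≤ ‖k‖`, while the scaling formula concerns open
      -- exteriors. Halving the radius accounts for the factor `(1 / 2) ^ (-(τ - N))` in `C`.
      _ ≤ ∫⁻ k in {k : Eu N | ‖h‖ / 2 < ‖k‖}, 2 ^ p * incr p W h * ‖k‖ₑ ^ (-(τ - N) - N) := by
          refine lintegral_mono_set fun k hk => ?_
          have : ‖h‖ ≤ ‖k‖ := by simpa using hk
          change ‖h‖ / 2 < ‖k‖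
          linarith
      _ = 2 ^ p * incr p W h * (ENNReal.ofReal ((‖h‖ / 2) ^ (-(τ - N))) * outerConst N (τ - N)) := by
          rw [lintegral_const_mul' _ _ (ENNReal.mul_ne_top h2p hi),
            setLIntegral_outer_eq _ (by positivity)]
          rfl
      _ = _ := by
          rw [enorm_rpow_eq hh, show ‖h‖ / 2 = 1 / 2 * ‖h‖ by ring,
            Real.mul_rpow (by norm_num) hpos.le, ENNReal.ofReal_mul (by positivity), neg_sub]
          ring
  rw [energy_eq_lintegral_incr hw, ← lintegral_add_compl _ (measurableSet_norm_lt (N := N) ‖h‖)]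
  rw [add_mul]
  refine add_le_add ?_ (hout.trans ?_)
  · unfold shortEnergy
    rw [← lintegral_const_mul' _ _ h2p]
    refine lintegral_mono fun k => ?_
    rw [← mul_assoc]
    gcongr
    exact incr_incr_le hp hW h k
  · rw [mul_assoc (2 ^ p * (_ * outerConst N (τ - N)))]
    refine mul_le_mul' le_rfl ?_
    exact incr_mul_le_shortEnergy hp (hNpos.le.trans hτ.le) hW hh

/-- For `‖k‖ < ‖h‖` one may trade `‖k‖ ^ a ≤ ‖h‖ ^ a`: the short part of a weaker energy gains a
power of `‖h‖` over the stronger one. -/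
theorem shortEnergy_le {N : ℕ} {p τ a : ℝ} (ha : 0 ≤ a) {W : Eu N → F}
    (hW : StronglyMeasurable W) (hp : 0 < p) (h : Eu N) :
    shortEnergy p τ W h ≤ ‖h‖ₑ ^ a * energy p (τ + a) W := by
  rw [energy_eq_lintegral_incr hW, ← lintegral_const_mul' _ _
    (ENNReal.rpow_ne_top_of_nonneg ha enorm_ne_top)]
  refine le_trans (setLIntegral_mono' (measurableSet_norm_lt _) fun k hk => ?_)
    (setLIntegral_le_lintegral {k : Eu N | ‖k‖ < ‖h‖} _)
  by_cases hk0 : k = 0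
  · subst hk0
    simp [incr, ENNReal.zero_rpow_of_pos hp]
  have hkpos := norm_pos_iff.2 hk0
  rw [mul_left_comm]
  refine mul_le_mul' le_rfl ?_
  have hh : h ≠ 0 := by
    rintro rfl
    simp only [Set.mem_ofPred_eq, norm_zero] at hk
    linarith
  rw [enorm_rpow_eq hk0, enorm_rpow_eq hk0, enorm_rpow_eq hh, ← ENNReal.ofReal_mul (by positivity)]
  refine ENNReal.ofReal_le_ofReal ?_
  have : ‖k‖ ^ (-τ) = ‖k‖ ^ a * ‖k‖ ^ (-(τ + a)) := by
    rw [← Real.rpow_add hkpos]; congr 1; ring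
  rw [this]
  gcongr
  exact le_of_lt hk

/-- Tonelli: for fixed `k` the integral of `‖h‖ ^ (-ε - N)` over `‖h‖ > ‖k‖` is a constant times
`‖k‖ ^ (-ε)`, which raises the exponent from `τ` to `τ + ε`. -/
theorem lintegral_shortEnergy_le {N : ℕ} {p τ ε : ℝ} (hp : 0 < p) {W : Eu N → F}
    (hW : StronglyMeasurable W) :
    ∫⁻ h, shortEnergy p τ W h * ‖h‖ₑ ^ (-ε - N) ≤ outerConst N ε * energy p (τ + ε) W := by
  have hmS : MeasurableSet {z : Eu N × Eu N | ‖z.2‖ < ‖z.1‖} :=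
    measurableSet_lt (by fun_prop) (by fun_prop)
  have hm : Measurable fun z : Eu N × Eu N =>
      {z : Eu N × Eu N | ‖z.2‖ < ‖z.1‖}.indicator
        (fun z => incr p W z.2 * ‖z.2‖ₑ ^ (-τ) * ‖z.1‖ₑ ^ (-ε - N)) z := by
    refine Measurable.indicator ?_ hmS
    exact (((measurable_incr hW).comp measurable_snd).mul (by fun_prop)).mul (by fun_prop)
  have h1 : ∀ h : Eu N, shortEnergy p τ W h * ‖h‖ₑ ^ (-ε - N) =
      ∫⁻ k, {z : Eu N × Eu N | ‖z.2‖ < ‖z.1‖}.indicator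
        (fun z => incr p W z.2 * ‖z.2‖ₑ ^ (-τ) * ‖z.1‖ₑ ^ (-ε - N)) (h, k) := by
    intro h
    have hm' : Measurable fun k : Eu N => incr p W k * ‖k‖ₑ ^ (-τ) :=
      (measurable_incr hW).mul (by fun_prop)
    rw [shortEnergy, ← lintegral_mul_const _ hm',
      ← lintegral_indicator (measurableSet_norm_lt _)]
    rfl
  simp_rw [h1]
  rw [lintegral_lintegral_swap hm.aemeasurable, energy_eq_lintegral_incr hW]
  have hm' : Measurable fun k : Eu N => incr p W k * ‖k‖ₑ ^ (-(τ + ε)) :=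
    (measurable_incr hW).mul (by fun_prop)
  rw [← lintegral_const_mul _ hm']
  refine lintegral_mono fun k => ?_
  by_cases hk : k = 0
  · subst hk
    refine le_trans (le_of_eq ?_) zero_le
    rw [lintegral_eq_zero_iff]
    · refine Eventually.of_forall fun h => ?_
      simp [Set.indicator_apply, incr, ENNReal.zero_rpow_of_pos hp]
    · exact hm.comp (measurable_id.prodMk measurable_const)
  have hkpos := norm_pos_iff.2 hk
  have h2 : ∫⁻ h, {z : Eu N × Eu N | ‖z.2‖ < ‖z.1‖}.indicator
        (fun z => incr p W z.2 * ‖z.2‖ₑ ^ (-τ) * ‖z.1‖ₑ ^ (-ε - N)) (h, k) =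
      incr p W k * ‖k‖ₑ ^ (-τ) * ∫⁻ h in {h : Eu N | ‖k‖ < ‖h‖}, ‖h‖ₑ ^ (-ε - N) := by
    rw [← lintegral_const_mul _ (by fun_prop), ← lintegral_indicator (measurableSet_lt_norm _)]
    rfl
  rw [h2, setLIntegral_outer_eq _ hkpos, ← enorm_rpow_eq hk, neg_add, ← outerConst]
  rw [ENNReal.rpow_add _ _ (by simpa using hk) enorm_ne_top]
  refine le_of_eq ?_
  ring

/-- The embedding of fractional Sobolev spaces into the critical one. -/
theorem energy_critical_lt_top {N : ℕ} (hN : 3 ≤ N) {p : ℝ} (hp : 1 ≤ p) (hpN : p < N)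
    {W : Eu N → F} (hW : StronglyMeasurable W) (hWp : ∫⁻ x, ‖W x‖ₑ ^ p < ⊤)
    (hE : energy p (2 * N - 2 * p / N) W < ⊤) : energy (N : ℝ) (2 * N - 2) W < ⊤ := by
  have hN3 : (3 : ℝ) ≤ N := by exact_mod_cast hN
  have hN0 : 0 < N := by omega
  have hp0 : 0 < p := by linarith
  obtain ⟨C, hC, hCle⟩ := energy_increment_le (F := F) (τ := 2 * N - p) hN0 hp (by linarith)
  -- `ε` is the gap between the exponent `2N - 2p/N` of the hypothesis and the exponent `2N - p` of
  -- the Sobolev inequality; it is positive because `N > 2`.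
  set ε : ℝ := p - 2 * p / N with hε
  have hεpos : 0 < ε := by
    have : 2 * p / N < p := by
      rw [div_lt_iff₀ (by linarith)]; nlinarith
    linarith
  set K : ℝ≥0∞ := ENNReal.ofReal (sobolevConst N p) * C
  set G := energy p (2 * N - 2 * p / N) W
  have hτε : 2 * (N : ℝ) - p + ε = 2 * N - 2 * p / N := by rw [hε]; ring
  have hNp : 0 ≤ (N : ℝ) / p - 1 := by
    rw [sub_nonneg, le_div_iff₀ hp0]; linarith
  have hkey : ∀ h : Eu N, h ≠ 0 → incr N W h * ‖h‖ₑ ^ (-(2 * N - 2 : ℝ)) ≤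
      K ^ ((N : ℝ) / p) * G ^ ((N : ℝ) / p - 1) *
        (shortEnergy p (2 * N - p) W h * ‖h‖ₑ ^ (-ε - N)) := by
    intro h hh
    have hw : StronglyMeasurable fun x => W (x + h) - W x :=
      (hW.comp_measurable (by fun_prop)).sub hW
    have hwp : ∫⁻ x, ‖W (x + h) - W x‖ₑ ^ p < ⊤ :=
      (incr_le_mul hp hW h).trans_lt
        (ENNReal.mul_lt_top (ENNReal.rpow_lt_top_of_nonneg hp0.le (by simp)) hWp)
    have h1 := fractional_sobolev hN0 hp hpN hw hwp
    have h2 : incr N W h ≤ (K * shortEnergy p (2 * N - p) W h) ^ ((N : ℝ) / p) := by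
      refine h1.trans ?_
      rw [mul_assoc]
      gcongr
      exact hCle W hW hWp h hh
    have h3 := shortEnergy_le (τ := 2 * N - p) hεpos.le hW hp0 h
    rw [hτε] at h3
    set J := shortEnergy p (2 * N - p) W h
    -- One factor `J` is kept for the integration in `h`; the remaining power `N/p - 1` is estimated
    -- by `‖h‖ ^ ε * G`.
    have h4 : J ^ ((N : ℝ) / p) ≤ J * (‖h‖ₑ ^ (ε * (N / p - 1)) * G ^ ((N : ℝ) / p - 1)) := by
      calc J ^ ((N : ℝ) / p) = J ^ (1 + ((N : ℝ) / p - 1)) := by congr 1; ring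
        _ = J * J ^ ((N : ℝ) / p - 1) := by
          rw [ENNReal.rpow_add_of_nonneg _ _ zero_le_one hNp, ENNReal.rpow_one]
        _ ≤ J * (‖h‖ₑ ^ ε * G) ^ ((N : ℝ) / p - 1) := by gcongr
        _ = _ := by rw [ENNReal.mul_rpow_of_nonneg _ _ hNp, ENNReal.rpow_mul]
    -- The exponents match because `ε * N / p = N - 2`.
    have h5 : ‖h‖ₑ ^ (ε * (N / p - 1)) * ‖h‖ₑ ^ (-(2 * N - 2 : ℝ)) = ‖h‖ₑ ^ (-ε - N) := by
      rw [← ENNReal.rpow_add _ _ (by simpa using hh) enorm_ne_top]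
      congr 1
      rw [hε]
      field_simp
      ring
    calc incr N W h * ‖h‖ₑ ^ (-(2 * N - 2 : ℝ))
        ≤ (K * J) ^ ((N : ℝ) / p) * ‖h‖ₑ ^ (-(2 * N - 2 : ℝ)) := by gcongr
      _ = K ^ ((N : ℝ) / p) * J ^ ((N : ℝ) / p) * ‖h‖ₑ ^ (-(2 * N - 2 : ℝ)) := by
          rw [ENNReal.mul_rpow_of_nonneg _ _ (by positivity)]
      _ ≤ K ^ ((N : ℝ) / p) * (J * (‖h‖ₑ ^ (ε * (N / p - 1)) * G ^ ((N : ℝ) / p - 1))) *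
          ‖h‖ₑ ^ (-(2 * N - 2 : ℝ)) := by gcongr
      _ = K ^ ((N : ℝ) / p) * G ^ ((N : ℝ) / p - 1) *
          (J * (‖h‖ₑ ^ (ε * (N / p - 1)) * ‖h‖ₑ ^ (-(2 * N - 2 : ℝ)))) := by ring
      _ = _ := by rw [h5]
  have hconst : K ^ ((N : ℝ) / p) * G ^ ((N : ℝ) / p - 1) ≠ ⊤ :=
    ENNReal.mul_ne_top (ENNReal.rpow_ne_top_of_nonneg (by positivity)
      (ENNReal.mul_ne_top ENNReal.ofReal_ne_top hC)) (ENNReal.rpow_ne_top_of_nonneg hNp hE.ne)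
  rw [energy_eq_lintegral_incr hW]
  calc ∫⁻ h, incr N W h * ‖h‖ₑ ^ (-(2 * N - 2 : ℝ))
      ≤ ∫⁻ h, K ^ ((N : ℝ) / p) * G ^ ((N : ℝ) / p - 1) *
          (shortEnergy p (2 * N - p) W h * ‖h‖ₑ ^ (-ε - N)) := by
        refine lintegral_mono_ae ?_
        filter_upwards [ae_ne_zero hN0] with h hh using hkey h hh
    _ = K ^ ((N : ℝ) / p) * G ^ ((N : ℝ) / p - 1) *
          ∫⁻ h, shortEnergy p (2 * N - p) W h * ‖h‖ₑ ^ (-ε - N) := lintegral_const_mul' _ _ hconst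
    _ ≤ K ^ ((N : ℝ) / p) * G ^ ((N : ℝ) / p - 1) *
          (outerConst N ε * energy p (2 * N - p + ε) W) := by
        gcongr
        exact lintegral_shortEnergy_le hp0 hW
    _ < ⊤ := by
        rw [hτε]
        exact ENNReal.mul_lt_top hconst.lt_top
          (ENNReal.mul_lt_top (lintegral_unit_outer_lt_top hN0 hεpos) hE)

/-! ### Weak gradients -/

theorem gradient_apply {N : ℕ} (u : Eu N → ℝ) (x : Eu N) (i : Fin N) :
    gradient u x i = fderiv ℝ u x (EuclideanSpace.single i 1) := by
  have h1 : inner ℝ (gradient u x) (EuclideanSpace.single i (1 : ℝ)) =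
      fderiv ℝ u x (EuclideanSpace.single i 1) := by
    simp [gradient]
  rw [← h1, EuclideanSpace.inner_single_right]
  simp

theorem norm_gradient {N : ℕ} (u : Eu N → ℝ) (x : Eu N) : ‖gradient u x‖ = ‖fderiv ℝ u x‖ := by
  simp [gradient]

theorem norm_gradient_sub {N : ℕ} (u : Eu N → ℝ) (x y : Eu N) :
    ‖gradient u x - gradient u y‖ = ‖fderiv ℝ u x - fderiv ℝ u y‖ := by
  simp only [gradient, ← map_sub, LinearIsometryEquiv.norm_map]

theorem contDiff_gradient {N : ℕ} {u : Eu N → ℝ} (hu : ContDiff ℝ ∞ u) :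
    ContDiff ℝ ∞ (gradient u) :=
  (InnerProductSpace.toDual ℝ (Eu N)).symm.contDiff.comp
    (hu.fderiv_right (m := ∞) (by norm_num))

theorem integrable_mul_test {N : ℕ} {u φ : Eu N → ℝ} (hu : LocallyIntegrable u)
    (hφ : Continuous φ) (hc : HasCompactSupport φ) : Integrable fun x => u x * φ x := by
  simpa [mul_comm] using hu.integrable_smul_left_of_hasCompactSupport hφ hc

theorem locallyIntegrable_clm_comp {N : ℕ} {V : Eu N → Eu N} (hV : LocallyIntegrable V)
    (L : Eu N →L[ℝ] ℝ) : LocallyIntegrable fun x => L (V x) := by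
  rw [locallyIntegrable_iff] at hV ⊢
  exact fun K hK => L.integrable_comp (hV K hK)

theorem locallyIntegrable_coord {N : ℕ} {V : Eu N → Eu N} (hV : LocallyIntegrable V) (i : Fin N) :
    LocallyIntegrable fun x => V x i :=
  locallyIntegrable_clm_comp hV (EuclideanSpace.proj i : Eu N →L[ℝ] ℝ)

theorem isTest_fderiv {N : ℕ} {φ : Eu N → ℝ} (hφ : IsTest φ) (v : Eu N) :
    IsTest fun x => fderiv ℝ φ x v :=
  ⟨(hφ.1.fderiv_right (m := ∞) (by norm_num)).clm_apply contDiff_const,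
    hφ.2.fderiv_apply (𝕜 := ℝ) v⟩

theorem isTest_mul {N : ℕ} {χ φ : Eu N → ℝ} (hχ : ContDiff ℝ ∞ χ) (hφ : IsTest φ) :
    IsTest fun x => χ x * φ x :=
  ⟨hχ.mul hφ.1, hφ.2.mul_left⟩

theorem IsWeakGrad.directional {N : ℕ} {u : Eu N → ℝ} {V : Eu N → Eu N} (h : IsWeakGrad u V)
    {φ : Eu N → ℝ} (hφ : IsTest φ) (v : Eu N) :
    ∫ x, u x * fderiv ℝ φ x v = -∫ x, inner ℝ (V x) v * φ x := by
  have hv : v = ∑ i, v i • EuclideanSpace.single i (1 : ℝ) := by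
    ext j; simp [Pi.single_apply]
  have h1 : ∀ x, u x * fderiv ℝ φ x v =
      ∑ i, v i * (u x * fderiv ℝ φ x (EuclideanSpace.single i 1)) := by
    intro x
    conv_lhs => rw [hv]
    rw [map_sum, Finset.mul_sum]
    refine Finset.sum_congr rfl fun i _ => ?_
    rw [map_smul, smul_eq_mul]; ring
  have h2 : ∀ x, inner ℝ (V x) v * φ x = ∑ i, v i * (V x i * φ x) := by
    intro x
    rw [PiLp.inner_apply, Finset.sum_mul]
    refine Finset.sum_congr rfl fun i _ => ?_
    simp; ring
  simp_rw [h1, h2]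
  rw [integral_finsetSum, integral_finsetSum, ← Finset.sum_neg_distrib]
  · refine Finset.sum_congr rfl fun i _ => ?_
    rw [integral_const_mul, integral_const_mul, h.2.2 φ hφ i]; ring
  · intro i _
    exact (integrable_mul_test (locallyIntegrable_coord h.2.1 i) hφ.1.continuous hφ.2).const_mul _
  · intro i _
    have := isTest_fderiv hφ (EuclideanSpace.single i 1)
    exact (integrable_mul_test h.1 this.1.continuous this.2).const_mul _

theorem isWeakGrad_congr_ae {N : ℕ} {u u' : Eu N → ℝ} {V V' : Eu N → Eu N}
    (hu : u =ᵐ[volume] u') (hV : V =ᵐ[volume] V') (h : IsWeakGrad u V) : IsWeakGrad u' V' := by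
  refine ⟨h.1.congr hu, h.2.1.congr hV, fun φ hφ i => ?_⟩
  have h1 : (fun x => u x * fderiv ℝ φ x (EuclideanSpace.single i 1)) =ᵐ[volume]
      fun x => u' x * fderiv ℝ φ x (EuclideanSpace.single i 1) :=
    hu.mono fun x hx => by simp only [hx]
  have h2 : (fun x => V x i * φ x) =ᵐ[volume] fun x => V' x i * φ x :=
    hV.mono fun x hx => by simp only [hx]
  rw [← integral_congr_ae h1, h.2.2 φ hφ i, integral_congr_ae h2]

theorem isWeakGrad_gradient {N : ℕ} {u : Eu N → ℝ} (hu : IsTest u) :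
    IsWeakGrad u (gradient u) := by
  refine ⟨hu.1.continuous.locallyIntegrable, (contDiff_gradient hu.1).continuous.locallyIntegrable,
    fun φ hφ i => ?_⟩
  simp_rw [gradient_apply]
  have h1 := isTest_fderiv hu (EuclideanSpace.single i 1)
  have h2 := isTest_fderiv hφ (EuclideanSpace.single i 1)
  exact integral_mul_fderiv_eq_neg_fderiv_mul_of_integrable
    (integrable_mul_test h1.1.continuous.locallyIntegrable hφ.1.continuous hφ.2)
    (integrable_mul_test hu.1.continuous.locallyIntegrable h2.1.continuous h2.2)
    (integrable_mul_test hu.1.continuous.locallyIntegrable hφ.1.continuous hφ.2)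
    (fun x _ => hu.1.differentiable (by norm_num) x)
    (fun x _ => hφ.1.differentiable (by norm_num) x)

/-- The product rule for weak gradients. -/
theorem IsWeakGrad.mul_test {N : ℕ} {f χ : Eu N → ℝ} {V : Eu N → Eu N} (h : IsWeakGrad f V)
    (hχ : IsTest χ) :
    IsWeakGrad (fun x => χ x * f x) (fun x => χ x • V x + f x • gradient χ x) := by
  have hg := (contDiff_gradient hχ.1).continuous
  have hVl : LocallyIntegrable fun x => χ x • V x := by
    exact h.2.1.continuous_smul hχ.1.continuous
  have hfl : LocallyIntegrable fun x => χ x * f x := by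
    exact h.1.continuous_smul hχ.1.continuous
  have hfg : LocallyIntegrable fun x => f x • gradient χ x := h.1.smul_continuous hg
  refine ⟨hfl, hVl.add hfg, fun φ hφ i => ?_⟩
  set e : Eu N := EuclideanSpace.single i 1
  have h1 : ∫ x, f x * fderiv ℝ (fun x => χ x * φ x) x e = -∫ x, V x i * (χ x * φ x) :=
    h.2.2 (fun x => χ x * φ x) (isTest_mul hχ.1 hφ) i
  have hd : ∀ x, fderiv ℝ (fun x => χ x * φ x) x e = χ x * fderiv ℝ φ x e + φ x * fderiv ℝ χ x e := by
    intro x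
    rw [fderiv_fun_mul (hχ.1.differentiable (by norm_num) x) (hφ.1.differentiable (by norm_num) x)]
    simp
  have hφe := isTest_fderiv hφ e
  have hχe := isTest_fderiv hχ e
  have i1 : Integrable fun x => f x * (χ x * fderiv ℝ φ x e) :=
    integrable_mul_test h.1 (isTest_mul hχ.1 hφe).1.continuous (isTest_mul hχ.1 hφe).2
  have i2 : Integrable fun x => f x * (φ x * fderiv ℝ χ x e) :=
    integrable_mul_test h.1 (isTest_mul hφ.1 hχe).1.continuous (isTest_mul hφ.1 hχe).2
  have i3 : Integrable fun x => V x i * (χ x * φ x) :=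
    integrable_mul_test (locallyIntegrable_coord h.2.1 i) (isTest_mul hχ.1 hφ).1.continuous (isTest_mul hχ.1 hφ).2
  simp_rw [hd, mul_add] at h1
  rw [integral_add i1 i2] at h1
  have h2 : ∫ x, χ x * f x * fderiv ℝ φ x e = ∫ x, f x * (χ x * fderiv ℝ φ x e) := by
    congr 1; ext x; ring
  have h3 : ∫ x, (χ x • V x + f x • gradient χ x) i * φ x =
      ∫ x, (V x i * (χ x * φ x) + f x * (φ x * fderiv ℝ χ x e)) := by
    congr 1; ext x
    simp only [PiLp.add_apply, PiLp.smul_apply, smul_eq_mul, gradient_apply]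
    ring
  rw [h2, h3, integral_add i3 i2]
  linarith

/-! ### Increments of weakly differentiable functions -/

/-- This supplies the integrability needed for Fubini in `(x, t)`: for `x ∈ K` and `t ∈ (0, 1]` the
points `x + t • h` stay in one ball, over which `g` is integrable. -/
theorem integrable_shear {N : ℕ} {g : Eu N → ℝ} (hg : StronglyMeasurable g)
    (hgl : LocallyIntegrable g) (h : Eu N) {K : Set (Eu N)} (hK : IsCompact K) :
    Integrable (fun z : Eu N × ℝ => g (z.1 + z.2 • h))
      ((volume.restrict K).prod (volume.restrict (Set.Ioc 0 1))) := by
  obtain ⟨R, hR⟩ := hK.isBounded.subset_closedBall 0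
  have hsm : StronglyMeasurable fun z : Eu N × ℝ => g (z.1 + z.2 • h) :=
    hg.comp_measurable (by fun_prop)
  refine ⟨hsm.aestronglyMeasurable, ?_⟩
  set B := Metric.closedBall (0 : Eu N) (R + ‖h‖)
  have hB : ∫⁻ x in B, ‖g x‖ₑ < ⊤ := (hgl.integrableOn_isCompact (isCompact_closedBall _ _)).2
  unfold HasFiniteIntegral
  rw [lintegral_prod_symm' _ hsm.enorm]
  calc ∫⁻ t in Set.Ioc (0 : ℝ) 1, ∫⁻ x in K, ‖g (x + t • h)‖ₑ
      ≤ ∫⁻ t in Set.Ioc (0 : ℝ) 1, ∫⁻ x in B, ‖g x‖ₑ := by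
        refine setLIntegral_mono' measurableSet_Ioc fun t ht => ?_
        rw [← lintegral_indicator hK.measurableSet, ← lintegral_indicator measurableSet_closedBall,
          ← lintegral_add_right_eq_self (B.indicator fun x => ‖g x‖ₑ) (t • h)]
        refine lintegral_mono fun x => ?_
        by_cases hx : x ∈ K
        · have hxB : x + t • h ∈ B := by
            rw [mem_closedBall_zero_iff]
            have h1 := mem_closedBall_zero_iff.1 (hR hx)
            have h2 : ‖t • h‖ ≤ ‖h‖ := by
              rw [norm_smul, Real.norm_of_nonneg ht.1.le]
              exact mul_le_of_le_one_left (norm_nonneg _) ht.2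
            exact (norm_add_le _ _).trans (by linarith)
          rw [Set.indicator_of_mem hx, Set.indicator_of_mem hxB]
        · rw [Set.indicator_of_notMem hx]; exact zero_le
    _ < ⊤ := by
        rw [setLIntegral_const]
        exact ENNReal.mul_lt_top hB (by simp)

/-- The fundamental theorem of calculus along `h`, by duality. Against a test function the
translation moves onto `φ`, where the classical theorem applies to `t ↦ φ (x - t • h)`; the weak
gradient identity for each translated test function brings the derivative back. -/
theorem IsWeakGrad.increment_eq {N : ℕ} {u : Eu N → ℝ} {V : Eu N → Eu N} (huV : IsWeakGrad u V)
    (hV : StronglyMeasurable V) (h : Eu N) :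
    ∀ᵐ x, u (x + h) - u x = ∫ t in Set.Ioc (0 : ℝ) 1, inner ℝ (V (x + t • h)) h := by
  set g : Eu N → ℝ := fun x => inner ℝ (V x) h with hgdef
  have hg : StronglyMeasurable g := hV.inner stronglyMeasurable_const
  have hgl : LocallyIntegrable g := by
    have := locallyIntegrable_clm_comp huV.2.1 (innerSL ℝ h)
    refine this.congr (Eventually.of_forall fun x => ?_)
    exact real_inner_comm (V x) h
  have hul : LocallyIntegrable fun x => u (x + h) := by
    rw [locallyIntegrable_iff]
    intro K hK
    have := huV.1.integrableOn_isCompact (hK.image (continuous_add_const h))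
    exact ((measurePreserving_add_right volume h).integrableOn_image
      (MeasurableEquiv.addRight h).measurableEmbedding).1 this
  have hIl : LocallyIntegrable fun x => ∫ t in Set.Ioc (0 : ℝ) 1, g (x + t • h) := by
    rw [locallyIntegrable_iff]
    intro K hK
    exact (integrable_shear hg hgl h hK).integral_prod_left
  refine ae_eq_of_integral_contDiff_smul_eq (hul.sub huV.1) hIl fun φ hφ hφc => ?_
  have hφt : IsTest φ := ⟨hφ, hφc⟩
  have hφcont := hφ.continuous
  simp only [smul_eq_mul]
  -- the right-hand side
  have hR : ∫ x, φ x * ∫ t in Set.Ioc (0 : ℝ) 1, g (x + t • h) =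
      ∫ t in Set.Ioc (0 : ℝ) 1, ∫ x, g x * φ (x - t • h) := by
    have hz : ∀ (a : Eu N → ℝ), ∫ x, φ x * a x = ∫ x in tsupport φ, φ x * a x := fun a =>
      (setIntegral_eq_integral_of_forall_compl_eq_zero fun x hx => by
        rw [image_eq_zero_of_notMem_tsupport hx, zero_mul]).symm
    rw [hz]
    simp_rw [← integral_const_mul]
    rw [integral_integral_swap]
    · refine integral_congr_ae (Eventually.of_forall fun t => ?_)
      dsimp only
      rw [← hz, ← integral_add_right_eq_self (fun x => g x * φ (x - t • h)) (t • h)]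
      simp only [add_sub_cancel_right]
      congr 1; ext x; ring
    · obtain ⟨C, hC⟩ := hφc.exists_bound_of_continuous hφcont
      exact (integrable_shear hg hgl h hφc).bdd_mul (c := C)
        (hφcont.comp continuous_fst).aestronglyMeasurable
        (Eventually.of_forall fun z => hC z.1)
  -- the left-hand side
  have hL : ∫ x, φ x * (u (x + h) - u x) =
      ∫ x, u x * (φ (x - h) - φ x) := by
    have e1 : ∫ x, φ x * u (x + h) = ∫ x, u x * φ (x - h) := by
      rw [← integral_add_right_eq_self (fun x => u x * φ (x - h)) h]
      simp only [add_sub_cancel_right]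
      congr 1; ext x; ring
    have i1 : Integrable fun x => φ x * u (x + h) := by
      simpa [mul_comm] using integrable_mul_test hul hφcont hφc
    have i2 : Integrable fun x => φ x * u x := by
      simpa [mul_comm] using integrable_mul_test huV.1 hφcont hφc
    have i3 : Integrable fun x => u x * φ (x - h) :=
      integrable_mul_test huV.1 (by fun_prop) (hφc.comp_homeomorph (Homeomorph.subRight h))
    have i4 : Integrable fun x => u x * φ x := integrable_mul_test huV.1 hφcont hφc
    simp_rw [mul_sub]
    rw [integral_sub i1 i2, integral_sub i3 i4, e1]
    congr 2; ext x; ring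
  have hftc : ∀ x, φ (x - h) - φ x = -∫ t in Set.Ioc (0 : ℝ) 1, fderiv ℝ φ (x - t • h) h := by
    intro x
    have hder : ∀ t ∈ Set.uIcc (0 : ℝ) 1,
        HasDerivAt (fun t : ℝ => φ (x - t • h)) (-fderiv ℝ φ (x - t • h) h) t := by
      intro t _
      have h1 : HasDerivAt (fun t : ℝ => x - t • h) (-h) t := by
        simpa using ((hasDerivAt_id t).smul_const h).const_sub x
      have := ((hφ.differentiable (by norm_num) (x - t • h)).hasFDerivAt).comp_hasDerivAt t h1
      exact this.congr_deriv (by simp)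
    have hcont : Continuous fun t : ℝ => -fderiv ℝ φ (x - t • h) h := by
      have := (isTest_fderiv hφt h).1.continuous
      exact (this.comp (by fun_prop : Continuous fun t : ℝ => x - t • h)).neg
    have := intervalIntegral.integral_eq_sub_of_hasDerivAt hder (hcont.intervalIntegrable _ _)
    rw [intervalIntegral.integral_of_le zero_le_one, integral_neg] at this
    simpa using this.symm
  rw [hL, hR]
  have hswap : ∫ x, u x * (φ (x - h) - φ x) =
      ∫ t in Set.Ioc (0 : ℝ) 1, -∫ x, u x * fderiv ℝ φ (x - t • h) h := by
    obtain ⟨R, hRφ⟩ := hφc.isCompact.isBounded.subset_closedBall 0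
    -- `K` contains the supports of all translates `φ (· - t • h)` with `0 < t ≤ 1`, so the exchange
    -- of integrals takes place on a set of finite measure where `u` is integrable.
    set K := Metric.closedBall (0 : Eu N) (R + ‖h‖)
    have hzero : ∀ x ∉ K, ∀ t ∈ Set.Ioc (0 : ℝ) 1, fderiv ℝ φ (x - t • h) h = 0 := by
      intro x hx t ht
      have : x - t • h ∉ tsupport φ := by
        intro hmem
        apply hx
        have h1 := mem_closedBall_zero_iff.1 (hRφ hmem)
        have h2 : ‖t • h‖ ≤ ‖h‖ := by
          rw [norm_smul, Real.norm_of_nonneg ht.1.le]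
          exact mul_le_of_le_one_left (norm_nonneg _) ht.2
        rw [mem_closedBall_zero_iff]
        calc ‖x‖ = ‖(x - t • h) + t • h‖ := by rw [sub_add_cancel]
          _ ≤ _ := norm_add_le _ _
          _ ≤ _ := by linarith
      rw [image_eq_zero_of_notMem_tsupport fun h' => this (tsupport_fderiv_subset ℝ h')]
      simp
    simp_rw [hftc]
    have e1 : ∫ x, u x * -∫ t in Set.Ioc (0 : ℝ) 1, fderiv ℝ φ (x - t • h) h =
        ∫ x in K, u x * -∫ t in Set.Ioc (0 : ℝ) 1, fderiv ℝ φ (x - t • h) h := by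
      refine (setIntegral_eq_integral_of_forall_compl_eq_zero fun x hx => ?_).symm
      rw [setIntegral_congr_fun measurableSet_Ioc fun t ht => hzero x hx t ht]
      simp
    rw [e1]
    simp_rw [← integral_neg, ← integral_const_mul]
    rw [integral_integral_swap]
    · refine setIntegral_congr_fun measurableSet_Ioc fun t ht => ?_
      rw [setIntegral_eq_integral_of_forall_compl_eq_zero fun x hx => ?_]
      · simp
      · rw [hzero x hx t ht]; simp
    · have hd := isTest_fderiv hφt h
      obtain ⟨C, hC⟩ := hd.2.exists_bound_of_continuous hd.1.continuous
      have hu1 : Integrable (fun z : Eu N × ℝ => u z.1)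
          ((volume.restrict K).prod (volume.restrict (Set.Ioc (0 : ℝ) 1))) :=
        (huV.1.integrableOn_isCompact (isCompact_closedBall _ _)).comp_fst _
      have := hu1.mul_bdd (c := C)
        (g := fun z : Eu N × ℝ => -fderiv ℝ φ (z.1 - z.2 • h) h)
        (hd.1.continuous.comp (by fun_prop : Continuous fun z : Eu N × ℝ =>
          z.1 - z.2 • h)).neg.aestronglyMeasurable
        (Eventually.of_forall fun z => by rw [norm_neg]; exact hC _)
      exact this
  rw [hswap]
  refine integral_congr_ae (Eventually.of_forall fun t => ?_)
  have ht : IsTest fun x => φ (x - t • h) :=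
    ⟨hφ.comp (by fun_prop), hφc.comp_homeomorph (Homeomorph.subRight (t • h))⟩
  have := huV.directional ht h
  have hfd : ∀ x, fderiv ℝ (fun x => φ (x - t • h)) x = fderiv ℝ φ (x - t • h) := by
    exact fun x => fderiv_comp_sub _
  simp_rw [hfd] at this
  dsimp only
  rw [this, neg_neg]

theorem lintegral_unit_rpow_le {g : ℝ → ℝ} (hg : StronglyMeasurable g) {p : ℝ} (hp : 1 ≤ p) :
    ‖∫ t in Set.Ioc (0 : ℝ) 1, g t‖ₑ ^ p ≤ ∫⁻ t in Set.Ioc (0 : ℝ) 1, ‖g t‖ₑ ^ p := by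
  have : IsProbabilityMeasure (volume.restrict (Set.Ioc (0 : ℝ) 1)) := ⟨by simp⟩
  have h1 := eLpNorm'_le_eLpNorm'_of_exponent_le one_pos hp
    (volume.restrict (Set.Ioc (0 : ℝ) 1)) hg.aestronglyMeasurable
  simp only [eLpNorm', ENNReal.rpow_one, div_one] at h1
  have h2 := (enorm_integral_le_lintegral_enorm (μ := volume.restrict (Set.Ioc (0 : ℝ) 1)) g).trans h1
  have hp0 : 0 < p := by linarith
  calc _ ≤ ((∫⁻ t in Set.Ioc (0 : ℝ) 1, ‖g t‖ₑ ^ p) ^ (1 / p)) ^ p := by gcongr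
    _ = _ := by rw [← ENNReal.rpow_mul, one_div_mul_cancel hp0.ne', ENNReal.rpow_one]

/-- Jensen in `t`, then Tonelli, then translation invariance of the `x`-integral for each `t`. -/
theorem IsWeakGrad.incr_le {N : ℕ} {u : Eu N → ℝ} {V : Eu N → Eu N} (huV : IsWeakGrad u V)
    (hV : StronglyMeasurable V) {p : ℝ} (hp : 1 ≤ p) (h : Eu N) :
    incr p u h ≤ ‖h‖ₑ ^ p * ∫⁻ x, ‖V x‖ₑ ^ p := by
  have hp0 : 0 < p := by linarith
  have hsm : StronglyMeasurable fun z : Eu N × ℝ => inner ℝ (V (z.1 + z.2 • h)) h :=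
    (hV.comp_measurable (by fun_prop)).inner stronglyMeasurable_const
  calc incr p u h = ∫⁻ x, ‖∫ t in Set.Ioc (0 : ℝ) 1, inner ℝ (V (x + t • h)) h‖ₑ ^ p :=
        lintegral_congr_ae ((huV.increment_eq hV h).mono fun x hx => by simp only [hx])
    _ ≤ ∫⁻ x, ∫⁻ t in Set.Ioc (0 : ℝ) 1, ‖inner ℝ (V (x + t • h)) h‖ₑ ^ p :=
        lintegral_mono fun x => lintegral_unit_rpow_le
          (hsm.comp_measurable (measurable_const.prodMk measurable_id)) hp
    _ = ∫⁻ t in Set.Ioc (0 : ℝ) 1, ∫⁻ x, ‖inner ℝ (V (x + t • h)) h‖ₑ ^ p :=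
        lintegral_lintegral_swap (hsm.enorm.pow_const p).aemeasurable
    _ ≤ ∫⁻ t in Set.Ioc (0 : ℝ) 1, ‖h‖ₑ ^ p * ∫⁻ x, ‖V x‖ₑ ^ p := by
        refine lintegral_mono fun t => ?_
        rw [lintegral_add_right_eq_self (fun x => ‖inner ℝ (V x) h‖ₑ ^ p) (t • h),
          ← lintegral_const_mul' _ _ (ENNReal.rpow_ne_top_of_nonneg hp0.le enorm_ne_top)]
        refine lintegral_mono fun x => ?_
        rw [← ENNReal.mul_rpow_of_nonneg _ _ hp0.le, mul_comm]
        gcongr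
        rw [← ofReal_norm, ← ofReal_norm, ← ofReal_norm, ← ENNReal.ofReal_mul (norm_nonneg _)]
        exact ENNReal.ofReal_le_ofReal (norm_inner_le_norm _ _)
    _ = _ := by rw [setLIntegral_const]; simp

/-! ### Stability of fractional regularity -/

theorem setLIntegral_inner_power_lt_top {N : ℕ} (hN : 0 < N) {p τ : ℝ} (hτ : τ < N + p) :
    ∫⁻ h : Eu N in {h | ‖h‖ ≤ 1}, ‖h‖ₑ ^ (p - τ) < ⊤ := by
  have := lintegral_unit_inner_lt_top hN (ε := p - τ + N) (by linarith)
  rwa [add_sub_cancel_right] at this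

/-- A term `‖h‖ ^ p`, as for `W^{1,p}` functions, is harmless near `h = 0` because `τ < N + p`, that
is, because the fractional order is below one. -/
theorem energy_lt_top_of_incr_le {G : Type*} [NormedAddCommGroup G] {N : ℕ} (hN : 0 < N)
    {p τ : ℝ} (hp : 1 ≤ p) (hτ : (N : ℝ) < τ)
    (hτ' : τ < N + p) {P : Eu N → G} {V : Eu N → F} (hP : StronglyMeasurable P)
    (hPp : ∫⁻ x, ‖P x‖ₑ ^ p < ⊤)
    (hE : energy p τ V < ⊤) (hV : StronglyMeasurable V) {A L : ℝ≥0∞} (hA : A ≠ ⊤) (hL : L ≠ ⊤)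
    (hle : ∀ h, incr p P h ≤ A * incr p V h + L * ‖h‖ₑ ^ p) : energy p τ P < ⊤ := by
  have hp0 : 0 < p := by linarith
  rw [energy_lt_top_iff_inner hN hp hτ hP hPp]
  have hm : Measurable fun h : Eu N => A * (incr p V h * ‖h‖ₑ ^ (-τ)) :=
    ((measurable_incr hV).mul (by fun_prop)).const_mul _
  calc ∫⁻ h in {h : Eu N | ‖h‖ ≤ 1}, incr p P h * ‖h‖ₑ ^ (-τ)
      ≤ ∫⁻ h in {h : Eu N | ‖h‖ ≤ 1},
          (A * (incr p V h * ‖h‖ₑ ^ (-τ)) + L * ‖h‖ₑ ^ (p - τ)) := by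
        refine lintegral_mono_ae (ae_restrict_of_ae ?_)
        filter_upwards [ae_ne_zero hN] with h hh
        rw [sub_eq_add_neg, ENNReal.rpow_add _ _ (by simpa using hh) enorm_ne_top, ← mul_assoc,
          ← mul_assoc, ← add_mul]
        gcongr
        exact hle h
    _ = A * (∫⁻ h in {h : Eu N | ‖h‖ ≤ 1}, incr p V h * ‖h‖ₑ ^ (-τ)) +
          L * ∫⁻ h in {h : Eu N | ‖h‖ ≤ 1}, ‖h‖ₑ ^ (p - τ) := by
        rw [lintegral_add_left hm, lintegral_const_mul' _ _ hA, lintegral_const_mul' _ _ hL]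
    _ < ⊤ := by
        refine ENNReal.add_lt_top.2 ⟨ENNReal.mul_lt_top hA.lt_top ?_,
          ENNReal.mul_lt_top hL.lt_top (setLIntegral_inner_power_lt_top hN hτ')⟩
        rw [energy_eq_lintegral_incr hV] at hE
        exact (setLIntegral_le_lintegral _ _).trans_lt hE

theorem incr_le_of_enorm_sub_le {G : Type*} [NormedAddCommGroup G] {N : ℕ} {p : ℝ} (hp : 1 ≤ p)
    {P : Eu N → G} {V : Eu N → F} (hV : StronglyMeasurable V)
    {A L : ℝ≥0∞} (hA : A ≠ ⊤) (hL : L ≠ ⊤)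
    (hle : ∀ x y, ‖P x - P y‖ₑ ≤ A * ‖V x - V y‖ₑ + L * ‖x - y‖ₑ * ‖V y‖ₑ) (h : Eu N) :
    incr p P h ≤ (2 ^ (p - 1) * A ^ p) * incr p V h +
      (2 ^ (p - 1) * L ^ p * ∫⁻ x, ‖V x‖ₑ ^ p) * ‖h‖ₑ ^ p := by
  have hp0 : 0 < p := by linarith
  have hm : Measurable fun x => (2 ^ (p - 1) * A ^ p) * ‖V (x + h) - V x‖ₑ ^ p :=
    ((measurable_incr_integrand hV).comp (measurable_id.prodMk measurable_const)).const_mul _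
  have hAp : A ^ p ≠ ⊤ := ENNReal.rpow_ne_top_of_nonneg hp0.le hA
  have hLp : L ^ p ≠ ⊤ := ENNReal.rpow_ne_top_of_nonneg hp0.le hL
  have h2 : (2 : ℝ≥0∞) ^ (p - 1) ≠ ⊤ := ENNReal.rpow_ne_top_of_nonneg (by linarith) (by simp)
  have hhp : ‖h‖ₑ ^ p ≠ ⊤ := ENNReal.rpow_ne_top_of_nonneg hp0.le enorm_ne_top
  calc incr p P h ≤ ∫⁻ x, ((2 ^ (p - 1) * A ^ p) * ‖V (x + h) - V x‖ₑ ^ p +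
          (2 ^ (p - 1) * L ^ p * ‖h‖ₑ ^ p) * ‖V x‖ₑ ^ p) := by
        refine lintegral_mono fun x => ?_
        have h1 := hle (x + h) x
        rw [add_sub_cancel_left] at h1
        calc ‖P (x + h) - P x‖ₑ ^ p
            ≤ (A * ‖V (x + h) - V x‖ₑ + L * ‖h‖ₑ * ‖V x‖ₑ) ^ p := by gcongr
          _ ≤ 2 ^ (p - 1) * ((A * ‖V (x + h) - V x‖ₑ) ^ p + (L * ‖h‖ₑ * ‖V x‖ₑ) ^ p) :=
              ENNReal.rpow_add_le_mul_rpow_add_rpow _ _ hp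
          _ = _ := by
              rw [ENNReal.mul_rpow_of_nonneg _ _ hp0.le, ENNReal.mul_rpow_of_nonneg _ _ hp0.le,
                ENNReal.mul_rpow_of_nonneg _ _ hp0.le]
              ring
    _ = _ := by
        rw [lintegral_add_left hm, lintegral_const_mul' _ _ (ENNReal.mul_ne_top h2 hAp),
          lintegral_const_mul' _ _ (ENNReal.mul_ne_top (ENNReal.mul_ne_top h2 hLp) hhp)]
        unfold incr
        ring

/-- Multiplication by bounded Lipschitz factors preserves finite energy. -/
theorem energy_lt_top_of_enorm_sub_le {G : Type*} [NormedAddCommGroup G] {N : ℕ} (hN : 0 < N)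
    {p τ : ℝ} (hp : 1 ≤ p) (hτ : (N : ℝ) < τ)
    (hτ' : τ < N + p) {P : Eu N → G} {V : Eu N → F} (hP : StronglyMeasurable P)
    (hPp : ∫⁻ x, ‖P x‖ₑ ^ p < ⊤) (hE : energy p τ V < ⊤) (hV : StronglyMeasurable V)
    (hVp : ∫⁻ x, ‖V x‖ₑ ^ p < ⊤) {A L : ℝ≥0∞} (hA : A ≠ ⊤) (hL : L ≠ ⊤)
    (hle : ∀ x y, ‖P x - P y‖ₑ ≤ A * ‖V x - V y‖ₑ + L * ‖x - y‖ₑ * ‖V y‖ₑ) :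
    energy p τ P < ⊤ := by
  have hp0 : 0 < p := by linarith
  have h2 : (2 : ℝ≥0∞) ^ (p - 1) ≠ ⊤ := ENNReal.rpow_ne_top_of_nonneg (by linarith) (by simp)
  exact energy_lt_top_of_incr_le hN hp hτ hτ' hP hPp hE hV
    (ENNReal.mul_ne_top h2 (ENNReal.rpow_ne_top_of_nonneg hp0.le hA))
    (ENNReal.mul_ne_top (ENNReal.mul_ne_top h2 (ENNReal.rpow_ne_top_of_nonneg hp0.le hL)) hVp.ne)
    (incr_le_of_enorm_sub_le hp hV hA hL hle)

theorem lintegral_rpow_add_lt_top {N : ℕ} {p : ℝ} (hp : 1 ≤ p) {P Q : Eu N → F}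
    (hP : StronglyMeasurable P) (hPp : ∫⁻ x, ‖P x‖ₑ ^ p < ⊤) (hQp : ∫⁻ x, ‖Q x‖ₑ ^ p < ⊤) :
    ∫⁻ x, ‖P x + Q x‖ₑ ^ p < ⊤ := by
  have h2 : (2 : ℝ≥0∞) ^ (p - 1) ≠ ⊤ := ENNReal.rpow_ne_top_of_nonneg (by linarith) (by simp)
  calc ∫⁻ x, ‖P x + Q x‖ₑ ^ p ≤ ∫⁻ x, 2 ^ (p - 1) * (‖P x‖ₑ ^ p + ‖Q x‖ₑ ^ p) := by
        refine lintegral_mono fun x => le_trans ?_ (ENNReal.rpow_add_le_mul_rpow_add_rpow _ _ hp)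
        gcongr
        exact enorm_add_le _ _
    _ < ⊤ := by
        rw [lintegral_const_mul' _ _ h2, lintegral_add_left (hP.enorm.pow_const p)]
        exact ENNReal.mul_lt_top h2.lt_top (ENNReal.add_lt_top.2 ⟨hPp, hQp⟩)

theorem energy_add_lt_top {N : ℕ} {p τ : ℝ} (hp : 1 ≤ p) {P Q : Eu N → F}
    (hP : StronglyMeasurable P) (hQ : StronglyMeasurable Q) (hPE : energy p τ P < ⊤)
    (hQE : energy p τ Q < ⊤) : energy p τ (fun x => P x + Q x) < ⊤ := by
  have h2 : (2 : ℝ≥0∞) ^ (p - 1) ≠ ⊤ := ENNReal.rpow_ne_top_of_nonneg (by linarith) (by simp)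
  have hm : Measurable fun h : Eu N => incr p P h * ‖h‖ₑ ^ (-τ) :=
    (measurable_incr hP).mul (by fun_prop)
  have hPQ : StronglyMeasurable fun x => P x + Q x := hP.add hQ
  rw [energy_eq_lintegral_incr hPQ]
  rw [energy_eq_lintegral_incr hP] at hPE
  rw [energy_eq_lintegral_incr hQ] at hQE
  calc ∫⁻ h, incr p (fun x => P x + Q x) h * ‖h‖ₑ ^ (-τ)
      ≤ ∫⁻ h, 2 ^ (p - 1) * (incr p P h * ‖h‖ₑ ^ (-τ) + incr p Q h * ‖h‖ₑ ^ (-τ)) := by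
        refine lintegral_mono fun h => ?_
        rw [← add_mul, ← mul_assoc]
        gcongr
        have hm' : Measurable fun x => ‖P (x + h) - P x‖ₑ ^ p :=
          (measurable_incr_integrand hP).comp (measurable_id.prodMk measurable_const)
        unfold incr
        rw [← lintegral_add_left hm', ← lintegral_const_mul' _ _ h2]
        refine lintegral_mono fun x => le_trans ?_ (ENNReal.rpow_add_le_mul_rpow_add_rpow _ _ hp)
        gcongr
        rw [add_sub_add_comm]
        exact enorm_add_le _ _
    _ < ⊤ := by
        rw [lintegral_const_mul' _ _ h2, lintegral_add_left hm]
        exact ENNReal.mul_lt_top h2.lt_top (ENNReal.add_lt_top.2 ⟨hPE, hQE⟩)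

/-- A function in `W^{1,p}` has all fractional regularity below one. This is needed because the
gradient of `χ f` contains `f • gradient χ`. -/
theorem IsWeakGrad.energy_lt_top {N : ℕ} (hN : 0 < N) {u : Eu N → ℝ} {V : Eu N → Eu N}
    (huV : IsWeakGrad u V) (hu : StronglyMeasurable u) (hV : StronglyMeasurable V) {p τ : ℝ}
    (hp : 1 ≤ p) (hτ : (N : ℝ) < τ) (hτ' : τ < N + p) (hup : ∫⁻ x, ‖u x‖ₑ ^ p < ⊤)
    (hVp : ∫⁻ x, ‖V x‖ₑ ^ p < ⊤) : energy p τ u < ⊤ := by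
  have hp0 : 0 < p := by linarith
  -- The comparison function is zero: the Lipschitz-type term alone bounds the increments.
  refine energy_lt_top_of_incr_le (V := fun _ : Eu N => (0 : ℝ)) hN hp hτ hτ' hu hup ?_
    stronglyMeasurable_const ENNReal.zero_ne_top hVp.ne fun h => ?_
  · simp [energy, ENNReal.zero_rpow_of_pos hp0]
  · rw [zero_mul, zero_add, mul_comm]
    exact huV.incr_le hV hp h

/-! ### Local embeddings for compactly supported functions -/

theorem rpow_le_rpow_add_one {a : ℝ≥0∞} {p q : ℝ} (hp : 0 ≤ q) (hpq : q ≤ p) :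
    a ^ q ≤ a ^ p + 1 := by
  rcases le_total a 1 with h | h
  · exact (ENNReal.rpow_le_one h hp).trans le_add_self
  · exact (ENNReal.rpow_le_rpow_of_exponent_le h hpq).trans le_self_add

/-- For `p < N` this is the fractional Sobolev inequality, which requires `τ ≥ 2N - p`; for `p ≥ N`
the bounded support alone lowers the integrability exponent. -/
theorem lintegral_rpow_dim_lt_top {N : ℕ} (hN : 0 < N) {p τ : ℝ} (hp : 1 ≤ p)
    (hpτ : p < N → 2 * N - p ≤ τ) {W : Eu N → F} (hW : StronglyMeasurable W)
    (hWp : ∫⁻ x, ‖W x‖ₑ ^ p < ⊤) (hE : energy p τ W < ⊤) {R : ℝ}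
    (hR : ∀ x, x ∉ Metric.closedBall (0 : Eu N) R → W x = 0) :
    ∫⁻ x, ‖W x‖ₑ ^ (N : ℝ) < ⊤ := by
  have hNpos : (0 : ℝ) < N := by exact_mod_cast hN
  have hp0 : 0 < p := by linarith
  by_cases hpN : p < N
  · have h1 := energy_lt_top_of_le hN hp (by linarith) (hpτ hpN) hW hWp hE
    refine (fractional_sobolev hN hp hpN hW hWp).trans_lt ?_
    exact ENNReal.rpow_lt_top_of_nonneg (by positivity)
      (ENNReal.mul_ne_top ENNReal.ofReal_ne_top h1.ne)
  · push Not at hpN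
    calc ∫⁻ x, ‖W x‖ₑ ^ (N : ℝ)
        ≤ ∫⁻ x, (‖W x‖ₑ ^ p + (Metric.closedBall (0 : Eu N) R).indicator 1 x) := by
          refine lintegral_mono fun x => ?_
          by_cases hx : x ∈ Metric.closedBall (0 : Eu N) R
          · rw [Set.indicator_of_mem hx]
            exact rpow_le_rpow_add_one hNpos.le hpN
          · rw [hR x hx]
            simp [ENNReal.zero_rpow_of_pos hNpos]
      _ < ⊤ := by
          rw [lintegral_add_left (hW.enorm.pow_const p),
            lintegral_indicator_one measurableSet_closedBall]
          exact ENNReal.add_lt_top.2 ⟨hWp, measure_closedBall_lt_top⟩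

/-- With `q = |ΔW| ‖h‖ ^ (-σ)` one has `q ^ N ≤ q ^ p + 1`. The constant `1` lives on a bounded set,
and the strict excess of smoothness supplies the factor `‖h‖ ^ ε` that makes it integrable near `h =
0`. -/
theorem energy_critical_lt_top_of_large {N : ℕ} (hN : 0 < N) {p τ : ℝ} (hp : 1 ≤ p)
    (hpN : N ≤ p) (hN2 : (N : ℝ) < 2 * N - 2) (hτ : N + (1 - 2 / (N : ℝ)) * p < τ) {W : Eu N → F}
    (hW : StronglyMeasurable W) (hWN : ∫⁻ x, ‖W x‖ₑ ^ (N : ℝ) < ⊤)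
    (hE : energy p τ W < ⊤) {R : ℝ}
    (hR : ∀ x, x ∉ Metric.closedBall (0 : Eu N) R → W x = 0) :
    energy (N : ℝ) (2 * N - 2) W < ⊤ := by
  have hNpos : (0 : ℝ) < N := by exact_mod_cast hN
  have hp0 : 0 < p := by linarith
  rw [energy_lt_top_iff_inner hN (by exact_mod_cast hN) hN2 hW hWN]
  -- `σ` is the order of smoothness encoded by `τ`, and `ε` below is `N` times its excess over the
  -- critical order `1 - 2/N`.
  set σ : ℝ := (τ - N) / p with hσ
  have hστ : τ = N + σ * p := by rw [hσ]; field_simp; ring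
  set ε : ℝ := (σ - (1 - 2 / (N : ℝ))) * N with hε
  have hεpos : 0 < ε := by
    refine mul_pos ?_ hNpos
    rw [hστ] at hτ
    nlinarith
  -- Enlarging the radius by one makes every increment with `‖h‖ ≤ 1` vanish outside `B`.
  set B := Metric.closedBall (0 : Eu N) (R + 1)
  have hpt : ∀ h : Eu N, h ≠ 0 → ‖h‖ ≤ 1 → ∀ x, ‖W (x + h) - W x‖ₑ ^ (N : ℝ) *
      ‖h‖ₑ ^ (-(2 * N - 2 : ℝ)) ≤ ‖W (x + h) - W x‖ₑ ^ p * ‖h‖ₑ ^ (-τ) +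
        B.indicator 1 x * ‖h‖ₑ ^ (ε - N) := by
    intro h hh hh1 x
    have hh0 : ‖h‖ₑ ≠ 0 := by simpa using hh
    by_cases hx : x ∈ B
    · rw [Set.indicator_of_mem hx, Pi.one_apply, one_mul]
      have hle1 : ‖h‖ₑ ^ ε ≤ 1 := by
        refine ENNReal.rpow_le_one ?_ hεpos.le
        rw [← ofReal_norm]; exact ENNReal.ofReal_le_one.2 hh1
      have e1 : ‖W (x + h) - W x‖ₑ ^ (N : ℝ) * ‖h‖ₑ ^ (-(2 * N - 2 : ℝ)) =
          (‖W (x + h) - W x‖ₑ * ‖h‖ₑ ^ (-σ)) ^ (N : ℝ) * ‖h‖ₑ ^ ε * ‖h‖ₑ ^ (-(N : ℝ)) := by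
        rw [ENNReal.mul_rpow_of_nonneg _ _ hNpos.le, ← ENNReal.rpow_mul, mul_assoc, mul_assoc,
          ← ENNReal.rpow_add _ _ hh0 enorm_ne_top, ← ENNReal.rpow_add _ _ hh0 enorm_ne_top]
        congr 2
        rw [hε]; field_simp; ring
      have e2 : ‖W (x + h) - W x‖ₑ ^ p * ‖h‖ₑ ^ (-τ) =
          (‖W (x + h) - W x‖ₑ * ‖h‖ₑ ^ (-σ)) ^ p * ‖h‖ₑ ^ (-(N : ℝ)) := by
        rw [ENNReal.mul_rpow_of_nonneg _ _ hp0.le, ← ENNReal.rpow_mul, mul_assoc,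
          ← ENNReal.rpow_add _ _ hh0 enorm_ne_top]
        congr 2
        rw [hστ]; ring
      rw [e1, e2, sub_eq_add_neg ε, ENNReal.rpow_add _ _ hh0 enorm_ne_top, ← add_mul]
      gcongr
      calc (‖W (x + h) - W x‖ₑ * ‖h‖ₑ ^ (-σ)) ^ (N : ℝ) * ‖h‖ₑ ^ ε
          ≤ ((‖W (x + h) - W x‖ₑ * ‖h‖ₑ ^ (-σ)) ^ p + 1) * ‖h‖ₑ ^ ε := by
            gcongr; exact rpow_le_rpow_add_one hNpos.le hpN
        _ = (‖W (x + h) - W x‖ₑ * ‖h‖ₑ ^ (-σ)) ^ p * ‖h‖ₑ ^ ε + ‖h‖ₑ ^ ε := by ring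
        _ ≤ _ := by gcongr; exact mul_le_of_le_one_right' hle1
    · have hxn : R + 1 < ‖x‖ := by simpa [B] using hx
      have h1 : W x = 0 := hR x (by simp; linarith)
      have h2 : W (x + h) = 0 := by
        refine hR _ ?_
        simp only [mem_closedBall_zero_iff, not_le]
        have : ‖x‖ ≤ ‖x + h‖ + ‖h‖ := by
          calc ‖x‖ = ‖(x + h) - h‖ := by rw [add_sub_cancel_right]
            _ ≤ _ := norm_sub_le _ _
        linarith
      rw [h1, h2]
      simp [ENNReal.zero_rpow_of_pos hNpos]
  have hB : volume B ≠ ⊤ := measure_closedBall_lt_top.ne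
  calc ∫⁻ h in {h : Eu N | ‖h‖ ≤ 1}, incr N W h * ‖h‖ₑ ^ (-(2 * N - 2 : ℝ))
      ≤ ∫⁻ h in {h : Eu N | ‖h‖ ≤ 1}, (incr p W h * ‖h‖ₑ ^ (-τ) + volume B * ‖h‖ₑ ^ (ε - N)) := by
        refine lintegral_mono_ae ?_
        filter_upwards [ae_restrict_of_ae (ae_ne_zero hN),
          ae_restrict_mem (measurableSet_norm_le 1)] with h hh hh1
        have hfin : ∀ a : ℝ, ‖h‖ₑ ^ a ≠ ⊤ := fun a => by
          rw [enorm_rpow_eq hh]; exact ENNReal.ofReal_ne_top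
        have hm : Measurable fun x => ‖W (x + h) - W x‖ₑ ^ p * ‖h‖ₑ ^ (-τ) :=
          ((measurable_incr_integrand hW).comp (measurable_id.prodMk measurable_const)).mul_const _
        unfold incr
        rw [← lintegral_mul_const' _ _ (hfin _), ← lintegral_mul_const' _ _ (hfin _),
          ← lintegral_indicator_one (measurableSet_closedBall (x := (0 : Eu N)) (ε := R + 1)),
          ← lintegral_mul_const' _ _ (hfin _), ← lintegral_add_left hm]
        exact lintegral_mono (hpt h hh hh1)
    _ = (∫⁻ h in {h : Eu N | ‖h‖ ≤ 1}, incr p W h * ‖h‖ₑ ^ (-τ)) +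
          volume B * ∫⁻ h in {h : Eu N | ‖h‖ ≤ 1}, ‖h‖ₑ ^ (ε - N) := by
        have hm : Measurable fun h : Eu N => incr p W h * ‖h‖ₑ ^ (-τ) :=
          (measurable_incr hW).mul (by fun_prop)
        rw [lintegral_add_left hm, lintegral_const_mul' _ _ hB]
    _ < ⊤ := by
        rw [energy_eq_lintegral_incr hW] at hE
        exact ENNReal.add_lt_top.2 ⟨(setLIntegral_le_lintegral _ _).trans_lt hE,
          ENNReal.mul_lt_top hB.lt_top (lintegral_unit_inner_lt_top hN hεpos)⟩

/-! ### The inclusion into the critical space -/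

theorem eLpNorm_lt_top_iff {N : ℕ} {p : ℝ} (hp : 0 < p) {W : Eu N → F} :
    eLpNorm W (ENNReal.ofReal p) volume < ⊤ ↔ ∫⁻ x, ‖W x‖ₑ ^ p < ⊤ := by
  rw [eLpNorm_lt_top_iff_lintegral_rpow_enorm_lt_top (by simpa using hp) ENNReal.ofReal_ne_top,
    ENNReal.toReal_ofReal hp.le]

theorem lintegral_enorm_rpow_congr {N : ℕ} {p : ℝ} {P Q : Eu N → F} (h : P =ᵐ[volume] Q) :
    ∫⁻ x, ‖P x‖ₑ ^ p = ∫⁻ x, ‖Q x‖ₑ ^ p :=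
  lintegral_congr_ae (h.mono fun x hx => by simp only [hx])

theorem exists_bound_lipschitz_of_test {N : ℕ} {G : Type*} [NormedAddCommGroup G] [NormedSpace ℝ G]
    {χ : Eu N → G} (hχ : ContDiff ℝ ∞ χ) (hc : HasCompactSupport χ) :
    ∃ A L : NNReal, (∀ x, ‖χ x‖ₑ ≤ A) ∧ ∀ x y, ‖χ x - χ y‖ₑ ≤ L * ‖x - y‖ₑ := by
  obtain ⟨A, hA⟩ := hc.exists_bound_of_continuous hχ.continuous
  obtain ⟨L, hL⟩ := hχ.lipschitzWith_of_hasCompactSupport hc (by simp)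
  refine ⟨A.toNNReal, L, fun x => ?_, fun x y => ?_⟩
  · rw [← ofReal_norm]
    exact ENNReal.ofReal_le_ofReal (hA x)
  · rw [← edist_eq_enorm_sub, ← edist_eq_enorm_sub]
    exact hL x y

/-- A function in `B(s,p)`, cut off by `χ`, together with its gradient, in measurable
representatives. -/
theorem MemBesov.exists_cutoff {N : ℕ} (hN : 0 < N) {s p : ℝ} (hp : 1 < p) (hs1 : 1 < s)
    (hs2 : s < 2) {f χ : Eu N → ℝ} (hf : MemBesov s p f) (hχ : IsTest χ) :
    ∃ (u : Eu N → ℝ) (W : Eu N → Eu N) (R : ℝ), (fun x => χ x * f x) =ᵐ[volume] u ∧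
      IsWeakGrad (fun x => χ x * f x) W ∧ StronglyMeasurable u ∧ StronglyMeasurable W ∧
      (∀ x, x ∉ Metric.closedBall (0 : Eu N) R → u x = 0) ∧
      (∀ x, x ∉ Metric.closedBall (0 : Eu N) R → W x = 0) ∧
      ∫⁻ x, ‖u x‖ₑ ^ p < ⊤ ∧ ∫⁻ x, ‖W x‖ₑ ^ p < ⊤ ∧
      energy p (N + (s - 1) * p) u < ⊤ ∧ energy p (N + (s - 1) * p) W < ⊤ := by
  have hp0 : 0 < p := by linarith
  have hτ : (N : ℝ) < N + (s - 1) * p := by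
    have := mul_pos (sub_pos.2 hs1) hp0; linarith
  have hτ' : N + (s - 1) * p < N + p := by nlinarith
  obtain ⟨V₀, hV₀⟩ := iInf_lt_iff.1 hf
  obtain ⟨hfV₀, hlt⟩ := iInf_lt_iff.1 hV₀
  rw [ENNReal.add_lt_top, ENNReal.add_lt_top, eLpNorm_lt_top_iff hp0, eLpNorm_lt_top_iff hp0,
    gagliardo_eq_energy] at hlt
  obtain ⟨⟨hfp₀, hVp₀⟩, hEV₀⟩ := hlt
  have hEV₀' : energy p (N + (s - 1) * p) V₀ < ⊤ :=
    (ENNReal.rpow_lt_top_iff_of_pos (by positivity)).1 hEV₀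
  -- The Tonelli arguments need strongly measurable functions, so both `f` and its gradient are
  -- replaced by representatives; energies and norms do not see the change.
  have hfm := hfV₀.1.aestronglyMeasurable
  have hVm := hfV₀.2.1.aestronglyMeasurable
  set g := hfm.mk f with hg
  set V := hVm.mk V₀ with hVdef
  have hfg : f =ᵐ[volume] g := hfm.ae_eq_mk
  have hVV : V₀ =ᵐ[volume] V := hVm.ae_eq_mk
  have hgm : StronglyMeasurable g := hfm.stronglyMeasurable_mk
  have hVsm : StronglyMeasurable V := hVm.stronglyMeasurable_mk
  have hgV : IsWeakGrad g V := isWeakGrad_congr_ae hfg hVV hfV₀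
  have hgp : ∫⁻ x, ‖g x‖ₑ ^ p < ⊤ := by
    rwa [← lintegral_enorm_rpow_congr hfg]
  have hVp : ∫⁻ x, ‖V x‖ₑ ^ p < ⊤ := by
    rwa [← lintegral_enorm_rpow_congr hVV]
  have hEV : energy p (N + (s - 1) * p) V < ⊤ := by rwa [← energy_congr_ae hVV]
  have hEg := hgV.energy_lt_top hN hgm hVsm hp.le hτ hτ' hgp hVp
  have hgradc := contDiff_gradient hχ.1
  have hgradcs : HasCompactSupport (gradient χ) := by
    exact (hχ.2.fderiv ℝ).comp_left (g := (InnerProductSpace.toDual ℝ (Eu N)).symm) (map_zero _)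
  obtain ⟨A, L, hA, hL⟩ := exists_bound_lipschitz_of_test hχ.1 hχ.2
  obtain ⟨A', L', hA', hL'⟩ := exists_bound_lipschitz_of_test hgradc hgradcs
  obtain ⟨R, hR⟩ := hχ.2.isCompact.isBounded.subset_closedBall 0
  have hχ0 : ∀ x, x ∉ Metric.closedBall (0 : Eu N) R → χ x = 0 := fun x hx =>
    image_eq_zero_of_notMem_tsupport fun h => hx (hR h)
  have hgrad0 : ∀ x, x ∉ Metric.closedBall (0 : Eu N) R → gradient χ x = 0 := by
    intro x hx
    have : fderiv ℝ χ x = 0 :=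
      image_eq_zero_of_notMem_tsupport fun h => hx (hR (tsupport_fderiv_subset ℝ h))
    simp [gradient, this]
  have hχsm : StronglyMeasurable χ := hχ.1.continuous.stronglyMeasurable
  have hgrsm : StronglyMeasurable (gradient χ) := hgradc.continuous.stronglyMeasurable
  have bound : ∀ {G H : Type} [NormedAddCommGroup G] [NormedAddCommGroup H] {P : Eu N → G}
      {Q : Eu N → H} {c : NNReal}, (∀ x, ‖P x‖ₑ ≤ c * ‖Q x‖ₑ) → ∫⁻ x, ‖Q x‖ₑ ^ p < ⊤ →
      ∫⁻ x, ‖P x‖ₑ ^ p < ⊤ := by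
    intro G H _ _ P Q c hle hQ
    calc ∫⁻ x, ‖P x‖ₑ ^ p ≤ ∫⁻ x, (c : ℝ≥0∞) ^ p * ‖Q x‖ₑ ^ p := by
          refine lintegral_mono fun x => ?_
          rw [← ENNReal.mul_rpow_of_nonneg _ _ hp0.le]
          gcongr
          exact hle x
      _ < ⊤ := by
          have : (c : ℝ≥0∞) ^ p ≠ ⊤ := ENNReal.rpow_ne_top_of_nonneg hp0.le ENNReal.coe_ne_top
          rw [lintegral_const_mul' _ _ this]
          exact ENNReal.mul_lt_top this.lt_top hQ
  -- the three products
  have hu1 : StronglyMeasurable fun x => χ x * g x := hχsm.mul hgm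
  have hW1 : StronglyMeasurable fun x => χ x • V x := hχsm.smul hVsm
  have hW2 : StronglyMeasurable fun x => g x • gradient χ x := hgm.smul hgrsm
  have hu1p : ∫⁻ x, ‖χ x * g x‖ₑ ^ p < ⊤ :=
    bound (c := A) (fun x => by rw [enorm_mul]; gcongr; exact hA x) hgp
  have hW1p : ∫⁻ x, ‖χ x • V x‖ₑ ^ p < ⊤ :=
    bound (c := A) (fun x => by rw [enorm_smul]; gcongr; exact hA x) hVp
  have hW2p : ∫⁻ x, ‖g x • gradient χ x‖ₑ ^ p < ⊤ :=
    bound (c := A') (fun x => by rw [enorm_smul, mul_comm]; gcongr; exact hA' x) hgp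
  have hu1E : energy p (N + (s - 1) * p) (fun x => χ x * g x) < ⊤ := by
    refine energy_lt_top_of_enorm_sub_le hN hp.le hτ hτ' hu1 hu1p hEg hgm hgp
      (A := A) (L := L) ENNReal.coe_ne_top ENNReal.coe_ne_top fun x y => ?_
    have : χ x * g x - χ y * g y = χ x * (g x - g y) + (χ x - χ y) * g y := by ring
    rw [this]
    refine (enorm_add_le _ _).trans ?_
    rw [enorm_mul, enorm_mul]
    gcongr
    · exact hA x
    · exact hL x y
  have hW1E : energy p (N + (s - 1) * p) (fun x => χ x • V x) < ⊤ := by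
    refine energy_lt_top_of_enorm_sub_le hN hp.le hτ hτ' hW1 hW1p hEV hVsm hVp
      (A := A) (L := L) ENNReal.coe_ne_top ENNReal.coe_ne_top fun x y => ?_
    have : χ x • V x - χ y • V y = χ x • (V x - V y) + (χ x - χ y) • V y := by
      rw [smul_sub, sub_smul]; abel
    rw [this]
    refine (enorm_add_le _ _).trans ?_
    rw [enorm_smul, enorm_smul]
    gcongr
    · exact hA x
    · exact hL x y
  have hW2E : energy p (N + (s - 1) * p) (fun x => g x • gradient χ x) < ⊤ := by
    refine energy_lt_top_of_enorm_sub_le hN hp.le hτ hτ' hW2 hW2p hEg hgm hgp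
      (A := A') (L := L') ENNReal.coe_ne_top ENNReal.coe_ne_top fun x y => ?_
    have : g x • gradient χ x - g y • gradient χ y =
        (g x - g y) • gradient χ x + g y • (gradient χ x - gradient χ y) := by
      rw [smul_sub, sub_smul]; abel
    rw [this]
    refine (enorm_add_le _ _).trans ?_
    rw [enorm_smul, enorm_smul, mul_comm, mul_comm ‖g y‖ₑ]
    gcongr
    · exact hA' x
    · exact hL' x y
  have hae : (fun x => χ x * f x) =ᵐ[volume] fun x => χ x * g x :=
    hfg.mono fun x hx => by simp only [hx]
  refine ⟨fun x => χ x * g x, fun x => χ x • V x + g x • gradient χ x, R, hae,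
    isWeakGrad_congr_ae hae.symm (ae_eq_refl _) (hgV.mul_test hχ), hu1, hW1.add hW2,
    fun x hx => by simp [hχ0 x hx], fun x hx => by simp [hχ0 x hx, hgrad0 x hx], hu1p,
    lintegral_rpow_add_lt_top hp.le hW1 hW1p hW2p, hu1E,
    energy_add_lt_top hp.le hW1 hW2 hW1E hW2E⟩

/-- The inclusion of `B(s,p)` in the local critical space. -/
theorem MemBesov.memCriticalLoc {N : ℕ} (hN : 2 ≤ N) {s p : ℝ} (hp : 1 < p) (hs1 : 1 < s)
    (hs2 : s < 2) (hscale : N / p + 1 - 2 / (N : ℝ) ≤ s) (hcrit : 2 - 2 / (N : ℝ) ≤ s)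
    (hcrit' : s = 2 - 2 / (N : ℝ) → p ≤ N) {f : Eu N → ℝ} (hf : MemBesov s p f) :
    MemCriticalLoc f := by
  intro χ hχ
  have hN0 : 0 < N := by omega
  have hN2 : (2 : ℝ) ≤ N := by exact_mod_cast hN
  have hNpos : (0 : ℝ) < N := by linarith
  have hp0 : 0 < p := by linarith
  obtain ⟨u, W, R, hae, hweak, hu, hW, huR, hWR, hup, hWp, huE, hWE⟩ :=
    hf.exists_cutoff hN0 hp hs1 hs2 hχ
  -- The scaling condition multiplied by `p`, as an inequality between energy exponents.
  have hsp : N + p - 2 * p / N ≤ s * p := by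
    have := mul_le_mul_of_nonneg_right hscale hp0.le
    have e : (N / p + 1 - 2 / (N : ℝ)) * p = N + p - 2 * p / N := by field_simp
    linarith
  have h2pN : 2 * p / N ≤ p := by
    rw [div_le_iff₀ hNpos]; nlinarith
  -- The scaling condition more than suffices for integrability `L^N`, since `2p/N ≤ p`.
  have hτ1 : p < N → 2 * N - p ≤ N + (s - 1) * p := fun _ => by nlinarith
  have huN := lintegral_rpow_dim_lt_top hN0 hp.le hτ1 hu hup huE huR
  have hWN := lintegral_rpow_dim_lt_top hN0 hp.le hτ1 hW hWp hWE hWR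
  have hNe : (∫⁻ x, ‖χ x * f x‖ₑ ^ (N : ℝ)) < ⊤ := by
    rwa [lintegral_enorm_rpow_congr hae]
  unfold MemCritical
  split_ifs with h2
  · subst h2
    refine (iInf₂_le W hweak).trans_lt (ENNReal.add_lt_top.2 ⟨?_, ?_⟩)
    · rw [eLpNorm_lt_top_iff (by norm_num)]; simpa using hNe
    · rw [eLpNorm_lt_top_iff (by norm_num)]; simpa using hWN
  · have hN3 : 3 ≤ N := by omega
    have hN3' : (3 : ℝ) ≤ N := by exact_mod_cast hN3
    refine (iInf₂_le W hweak).trans_lt (ENNReal.add_lt_top.2 ⟨ENNReal.add_lt_top.2 ⟨?_, ?_⟩, ?_⟩)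
    · rwa [eLpNorm_lt_top_iff hNpos]
    · rwa [eLpNorm_lt_top_iff hNpos]
    · rw [gagliardo_eq_energy]
      refine ENNReal.rpow_lt_top_of_nonneg (by positivity) (ne_of_lt ?_)
      have e : (N : ℝ) + (2 - 2 / (N : ℝ) - 1) * N = 2 * N - 2 := by field_simp; ring
      rw [e]
      by_cases hpN : p < N
      · refine energy_critical_lt_top hN3 hp.le hpN hW hWp
          (energy_lt_top_of_le hN0 hp.le ?_ ?_ hW hWp hWE)
        · linarith
        · nlinarith
      · push Not at hpN
        -- At `s = 2 - 2/N` the hypothesis forces `p = N`, and the given energy is already the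
        -- critical one. Otherwise the strict excess of smoothness is used.
        rcases hcrit.eq_or_lt with hs | hs
        · have hpe : p = N := le_antisymm (hcrit' hs.symm) hpN
          have : (N : ℝ) + (s - 1) * p = 2 * N - 2 := by rw [← hs, hpe, e]
          rw [this, hpe] at hWE
          exact hWE
        · refine energy_critical_lt_top_of_large hN0 hp.le hpN (by linarith) ?_ hW hWN hWE hWR
          have : (1 - 2 / (N : ℝ)) * p < (s - 1) * p :=
            mul_lt_mul_of_pos_right (by linarith) hp0
          linarith

/-! ### The norm of lacunary sums -/

/-- The kernel `t^(-σ) min(1,t)` comparing increments of length `t` with unit frequency. -/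
def kern (σ t : ℝ) : ℝ := t ^ (-σ) * min 1 t

theorem kern_nonneg {σ t : ℝ} (ht : 0 ≤ t) : 0 ≤ kern σ t :=
  mul_nonneg (Real.rpow_nonneg ht _) (le_min zero_le_one ht)

theorem kern_of_le_one {σ t : ℝ} (ht : 0 < t) (h1 : t ≤ 1) : kern σ t = t ^ (1 - σ) := by
  rw [kern, min_eq_right h1, sub_eq_neg_add, Real.rpow_add ht, Real.rpow_one]

theorem kern_of_one_le {σ t : ℝ} (h1 : 1 ≤ t) : kern σ t = t ^ (-σ) := by
  rw [kern, min_eq_left h1, mul_one]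

/-- A bounded increasing function whose dyadic increments dominate `kern`. -/
def dyadicPotential (β t : ℝ) : ℝ := t ^ β / (1 + t ^ β)

/-- The difference on the right simplifies to `4 q w / ((1 + w)(1 + q w))`, which has the same
two-sided decay as `min w w⁻¹` but telescopes along `w, q w, q² w, ...`. -/
theorem min_le_increment {q w : ℝ} (hq : 1 < q) (hw : 0 < w) :
    min w w⁻¹ ≤ 4 * q / (q - 1) * (q * w / (1 + q * w) - w / (1 + w)) := by
  have hq1 : 0 < q - 1 := by linarith
  have e : 4 * q / (q - 1) * (q * w / (1 + q * w) - w / (1 + w)) =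
      4 * q * w / ((1 + w) * (1 + q * w)) := by
    field_simp; ring
  rw [e]
  rcases le_total w 1 with h | h
  · refine (min_le_left _ _).trans ?_
    rw [le_div_iff₀ (by positivity)]
    have : (1 + w) * (1 + q * w) ≤ 4 * q := by
      have h1 : q * w ≤ q := by nlinarith
      nlinarith [mul_nonneg hw.le (by positivity : (0:ℝ) ≤ q * w)]
    nlinarith
  · refine (min_le_right _ _).trans ?_
    rw [inv_le_iff_one_le_mul₀ hw, div_mul_eq_mul_div, one_le_div (by positivity)]
    have h1 : 1 + w ≤ 2 * w := by linarith
    have h2 : 1 + q * w ≤ 2 * (q * w) := by nlinarith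
    calc (1 + w) * (1 + q * w) ≤ (2 * w) * (2 * (q * w)) := by gcongr
      _ = _ := by ring

/-- With `β = min σ (1 - σ)` the kernel is at most `min (t ^ β) (t ^ (-β))`, and doubling `t`
multiplies `w = t ^ β` by `q = 2 ^ β`. -/
theorem kern_le_increment {σ : ℝ} (h0 : 0 < σ) (h1 : σ < 1) {t : ℝ} (ht : 0 < t) :
    kern σ t ≤ 4 * 2 ^ min σ (1 - σ) / (2 ^ min σ (1 - σ) - 1) *
      (dyadicPotential (min σ (1 - σ)) (2 * t) - dyadicPotential (min σ (1 - σ)) t) := by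
  set β := min σ (1 - σ)
  have hβ : 0 < β := lt_min h0 (by linarith)
  have hq : (1 : ℝ) < 2 ^ β := Real.one_lt_rpow (by norm_num) hβ
  have hw : 0 < t ^ β := Real.rpow_pos_of_pos ht _
  rw [dyadicPotential, dyadicPotential, Real.mul_rpow (by norm_num) ht.le]
  refine le_trans (le_min ?_ ?_) (min_le_increment hq hw)
  · rcases le_total t 1 with h | h
    · rw [kern_of_le_one ht h]
      exact Real.rpow_le_rpow_of_exponent_ge ht h (min_le_right _ _)
    · rw [kern_of_one_le h]
      exact Real.rpow_le_rpow_of_exponent_le h (by linarith)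
  · rw [← Real.rpow_neg ht.le]
    rcases le_total t 1 with h | h
    · rw [kern_of_le_one ht h]
      exact Real.rpow_le_rpow_of_exponent_ge ht h (by linarith)
    · rw [kern_of_one_le h]
      exact Real.rpow_le_rpow_of_exponent_le h (neg_le_neg (min_le_left _ _))

/-- The increments telescope and the potential takes values in `[0, 1]`, so the bound is uniform in
`t` and `k`. -/
theorem sum_kern_le {σ : ℝ} (h0 : 0 < σ) (h1 : σ < 1) :
    ∃ C : ℝ, 0 < C ∧ ∀ t : ℝ, 0 < t → ∀ k : ℕ,
      ∑ l ∈ Finset.range k, kern σ (2 ^ l * t) ≤ C := by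
  set β := min σ (1 - σ)
  have hβ : 0 < β := lt_min h0 (by linarith)
  have hq : (1 : ℝ) < 2 ^ β := Real.one_lt_rpow (by norm_num) hβ
  have hq1 : (0 : ℝ) < 2 ^ β - 1 := by linarith
  refine ⟨4 * 2 ^ β / (2 ^ β - 1), by positivity, fun t ht k => ?_⟩
  calc ∑ l ∈ Finset.range k, kern σ (2 ^ l * t)
      ≤ ∑ l ∈ Finset.range k, 4 * 2 ^ β / (2 ^ β - 1) *
          (dyadicPotential β (2 ^ (l + 1) * t) - dyadicPotential β (2 ^ l * t)) := by
        refine Finset.sum_le_sum fun l _ => ?_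
        have := kern_le_increment h0 h1 (t := 2 ^ l * t) (by positivity)
        rwa [← mul_assoc, ← pow_succ'] at this
    _ = 4 * 2 ^ β / (2 ^ β - 1) *
          (dyadicPotential β (2 ^ k * t) - dyadicPotential β (2 ^ 0 * t)) := by
        rw [← Finset.mul_sum, Finset.sum_range_sub fun l => dyadicPotential β (2 ^ l * t)]
    _ ≤ 4 * 2 ^ β / (2 ^ β - 1) * 1 := by
        gcongr
        have h2 : dyadicPotential β (2 ^ k * t) ≤ 1 := by
          have : 0 < (2 ^ k * t) ^ β := by positivity
          rw [dyadicPotential, div_le_one (by positivity)]; linarith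
        have h3 : 0 ≤ dyadicPotential β (2 ^ 0 * t) := by
          unfold dyadicPotential; positivity
        linarith
    _ = _ := mul_one _

/-- The inner radial integral. -/
def innerConst (N : ℕ) (ε : ℝ) : ℝ≥0∞ := ∫⁻ h : Eu N in {h | ‖h‖ ≤ 1}, ‖h‖ₑ ^ (ε - N)

/-- The measure `‖h‖ ^ (-N) dh` is invariant under dilations, so the frequency `n` cancels after
splitting at `‖h‖ = 1/n`. -/
theorem lintegral_kern_le {N : ℕ} (hN : 0 < N) (σ : ℝ) {n : ℝ} (hn : 0 < n) :
    ∫⁻ h : Eu N, ENNReal.ofReal (kern σ (n * ‖h‖)) * ‖h‖ₑ ^ (-(N : ℝ)) ≤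
      innerConst N (1 - σ) + outerConst N σ := by
  have hc : {h : Eu N | ‖h‖ ≤ n⁻¹}ᶜ = {h : Eu N | n⁻¹ < ‖h‖} := by ext; simp
  have hni : 0 < n⁻¹ := inv_pos.2 hn
  rw [← lintegral_add_compl _ (measurableSet_norm_le (N := N) n⁻¹), hc]
  refine add_le_add ?_ ?_
  · calc _ ≤ ∫⁻ h in {h : Eu N | ‖h‖ ≤ n⁻¹}, ENNReal.ofReal (n ^ (1 - σ)) *
          ‖h‖ₑ ^ (1 - σ - N) := by
          refine lintegral_mono_ae ?_
          filter_upwards [ae_restrict_of_ae (ae_ne_zero hN),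
            ae_restrict_mem (measurableSet_norm_le n⁻¹)] with h hh hle
          have hpos := norm_pos_iff.2 hh
          have : n * ‖h‖ ≤ 1 := by
            calc n * ‖h‖ ≤ n * n⁻¹ := by gcongr
              _ = 1 := mul_inv_cancel₀ hn.ne'
          rw [kern_of_le_one (by positivity) this, enorm_rpow_eq hh, enorm_rpow_eq hh,
            ← ENNReal.ofReal_mul (by positivity), ← ENNReal.ofReal_mul (by positivity),
            Real.mul_rpow hn.le hpos.le, sub_eq_add_neg (1 - σ) (N : ℝ), Real.rpow_add hpos,
            mul_assoc]
      _ = innerConst N (1 - σ) := by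
          rw [lintegral_const_mul' _ _ ENNReal.ofReal_ne_top, setLIntegral_inner_eq _ hni,
            ← mul_assoc, ← ENNReal.ofReal_mul (by positivity), ← Real.mul_rpow hn.le hni.le,
            mul_inv_cancel₀ hn.ne', Real.one_rpow, ENNReal.ofReal_one, one_mul, innerConst]
  · calc _ ≤ ∫⁻ h in {h : Eu N | n⁻¹ < ‖h‖}, ENNReal.ofReal (n ^ (-σ)) *
          ‖h‖ₑ ^ (-σ - N) := by
          refine lintegral_mono_ae ?_
          filter_upwards [ae_restrict_of_ae (ae_ne_zero hN),
            ae_restrict_mem (measurableSet_lt_norm n⁻¹)] with h hh hle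
          have hpos := norm_pos_iff.2 hh
          have : 1 ≤ n * ‖h‖ := by
            calc 1 = n * n⁻¹ := (mul_inv_cancel₀ hn.ne').symm
              _ ≤ _ := by gcongr
          rw [kern_of_one_le this, enorm_rpow_eq hh, enorm_rpow_eq hh,
            ← ENNReal.ofReal_mul (by positivity), ← ENNReal.ofReal_mul (by positivity),
            Real.mul_rpow hn.le hpos.le, sub_eq_add_neg (-σ) (N : ℝ), Real.rpow_add hpos,
            mul_assoc]
      _ = outerConst N σ := by
          rw [lintegral_const_mul' _ _ ENNReal.ofReal_ne_top, setLIntegral_outer_eq _ hni,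
            ← mul_assoc, ← ENNReal.ofReal_mul (by positivity), ← Real.mul_rpow hn.le hni.le,
            mul_inv_cancel₀ hn.ne', Real.one_rpow, ENNReal.ofReal_one, one_mul, outerConst]

/-- The modulus of continuity of a lacunary sum with amplitudes `a` and frequencies `n₀ 2^l`. -/
def lacunaryModulus (σ n₀ : ℝ) (k : ℕ) (a : ℕ → ℝ) (t : ℝ) : ℝ :=
  ∑ l ∈ Finset.range k, a l * (2 ^ l * n₀) ^ (-σ) * min 1 (2 ^ l * n₀ * t)

/-- Each summand of the modulus is `t ^ σ * kern σ (n t) * a`. Hölder with weights `kern`, whose sum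
is at most `C`, brings the power `p` inside the sum without loss in `k`. -/
theorem lacunaryModulus_rpow_le {σ p : ℝ} (hp : 1 < p) {C : ℝ} (hC : 0 < C)
    (hsum : ∀ t : ℝ, 0 < t → ∀ k : ℕ, ∑ l ∈ Finset.range k, kern σ (2 ^ l * t) ≤ C)
    {n₀ : ℝ} (hn : 0 < n₀) (k : ℕ) {a : ℕ → ℝ} (ha : ∀ l, 0 ≤ a l) {t : ℝ} (ht : 0 < t) :
    lacunaryModulus σ n₀ k a t ^ p ≤
      t ^ (σ * p) * (C ^ (p - 1) * ∑ l ∈ Finset.range k, kern σ (2 ^ l * n₀ * t) * a l ^ p) := by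
  have hp0 : 0 < p := by linarith
  have e : lacunaryModulus σ n₀ k a t =
      t ^ σ * ∑ l ∈ Finset.range k, kern σ (2 ^ l * n₀ * t) * a l := by
    rw [lacunaryModulus, Finset.mul_sum]
    refine Finset.sum_congr rfl fun l _ => ?_
    have hl : (0 : ℝ) < 2 ^ l * n₀ := by positivity
    rw [kern, Real.mul_rpow hl.le ht.le, Real.rpow_neg ht.le]
    have := Real.rpow_pos_of_pos ht σ
    field_simp
  have hk : ∀ l, 0 ≤ kern σ (2 ^ l * n₀ * t) := fun l => kern_nonneg (by positivity)
  have hH := Real.inner_le_weight_mul_Lp_of_nonneg (Finset.range k) hp.le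
    (fun l => kern σ (2 ^ l * n₀ * t)) a hk ha
  have hT : 0 ≤ ∑ l ∈ Finset.range k, kern σ (2 ^ l * n₀ * t) * a l ^ p :=
    Finset.sum_nonneg fun l _ => mul_nonneg (hk l) (Real.rpow_nonneg (ha l) _)
  have hS : 0 ≤ ∑ l ∈ Finset.range k, kern σ (2 ^ l * n₀ * t) := Finset.sum_nonneg fun l _ => hk l
  have hSC : ∑ l ∈ Finset.range k, kern σ (2 ^ l * n₀ * t) ≤ C := by
    simpa [mul_assoc] using hsum (n₀ * t) (by positivity) k
  have hU : 0 ≤ ∑ l ∈ Finset.range k, kern σ (2 ^ l * n₀ * t) * a l :=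
    Finset.sum_nonneg fun l _ => mul_nonneg (hk l) (ha l)
  rw [e, Real.mul_rpow (by positivity) hU, ← Real.rpow_mul ht.le]
  gcongr
  have hp1 : 0 ≤ 1 - p⁻¹ := by rw [sub_nonneg]; exact inv_le_one_of_one_le₀ hp.le
  calc (∑ l ∈ Finset.range k, kern σ (2 ^ l * n₀ * t) * a l) ^ p
      ≤ (C ^ (1 - p⁻¹) * (∑ l ∈ Finset.range k, kern σ (2 ^ l * n₀ * t) * a l ^ p) ^ p⁻¹) ^ p := by
        gcongr
        refine hH.trans ?_
        gcongr
    _ = _ := by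
        rw [Real.mul_rpow (by positivity) (by positivity), ← Real.rpow_mul hC.le,
          ← Real.rpow_mul hT, inv_mul_cancel₀ hp0.ne', Real.rpow_one, sub_mul,
          inv_mul_cancel₀ hp0.ne', one_mul]

/-- The increment vanishes outside `B` and its translate by `-h`, whose union has measure at most `2
* volume B`. -/
theorem incr_le_of_modulus {F : Type*} [NormedAddCommGroup F] {N : ℕ} {p : ℝ} (hp : 0 < p)
    {V : Eu N → F} {B : Set (Eu N)} (hB : MeasurableSet B) (hV0 : ∀ x, x ∉ B → V x = 0)
    {m : ℝ} (h : Eu N) (hb : ∀ x, ‖V (x + h) - V x‖ ≤ m) :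
    incr p V h ≤ 2 * volume B * ENNReal.ofReal (m ^ p) := by
  have hm : Measurable (B.indicator (1 : Eu N → ℝ≥0∞)) := measurable_one.indicator hB
  calc incr p V h ≤ ∫⁻ x, (B.indicator 1 x + B.indicator 1 (x + h)) * ENNReal.ofReal (m ^ p) := by
        refine lintegral_mono fun x => ?_
        have hle : ‖V (x + h) - V x‖ₑ ^ p ≤ ENNReal.ofReal (m ^ p) := by
          rw [← ofReal_norm, ENNReal.ofReal_rpow_of_nonneg (norm_nonneg _) hp.le]
          exact ENNReal.ofReal_le_ofReal (Real.rpow_le_rpow (norm_nonneg _) (hb x) hp.le)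
        by_cases hx : x ∈ B
        · rw [Set.indicator_of_mem hx, Pi.one_apply, add_mul, one_mul]
          exact hle.trans le_self_add
        by_cases hxh : x + h ∈ B
        · rw [Set.indicator_of_mem hxh, Pi.one_apply, add_mul, one_mul]
          exact hle.trans le_add_self
        · rw [hV0 x hx, hV0 _ hxh]
          simp [ENNReal.zero_rpow_of_pos hp]
    _ = _ := by
        rw [lintegral_mul_const' _ _ ENNReal.ofReal_ne_top, lintegral_add_left hm,
          lintegral_add_right_eq_self (B.indicator 1) h, lintegral_indicator_one hB, two_mul]

/-- The factor `‖h‖ ^ (σ p)` cancels against the kernel, and each frequency contributes a multiple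
of `a l ^ p` independent of the frequency. The volume of `B` stays explicit because the
concentrating functions have shrinking supports. -/
theorem energy_le_of_lacunaryModulus {F : Type*} [NormedAddCommGroup F] {N : ℕ} (hN : 0 < N)
    {σ p : ℝ} (hσ0 : 0 < σ) (hσ1 : σ < 1) (hp : 1 < p) :
    ∃ C : ℝ, 0 ≤ C ∧ ∀ (B : Set (Eu N)), MeasurableSet B → ∀ (n₀ : ℝ), 0 < n₀ →
      ∀ (k : ℕ) (a : ℕ → ℝ), (∀ l, 0 ≤ a l) → ∀ V : Eu N → F, StronglyMeasurable V →
      (∀ x, x ∉ B → V x = 0) →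
      (∀ x y, ‖V x - V y‖ ≤ lacunaryModulus σ n₀ k a ‖x - y‖) →
      energy p (N + σ * p) V ≤
        volume B * ENNReal.ofReal (C * ∑ l ∈ Finset.range k, a l ^ p) := by
  have hp0 : 0 < p := by linarith
  obtain ⟨C, hC, hsum⟩ := sum_kern_le hσ0 hσ1
  set I : ℝ≥0∞ := innerConst N (1 - σ) + outerConst N σ
  have hI : I ≠ ⊤ := ENNReal.add_ne_top.2 ⟨(lintegral_unit_inner_lt_top hN (by linarith)).ne,
    (lintegral_unit_outer_lt_top hN hσ0).ne⟩
  refine ⟨2 * C ^ (p - 1) * I.toReal, by positivity, ?_⟩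
  intro B hB n₀ hn₀ k a ha V hV hV0 hmod
  rw [energy_eq_lintegral_incr hV]
  have hterm : ∀ l, Measurable fun h : Eu N =>
      ENNReal.ofReal (a l ^ p) * (ENNReal.ofReal (kern σ (2 ^ l * n₀ * ‖h‖)) * ‖h‖ₑ ^ (-(N : ℝ))) := by
    intro l
    unfold kern
    fun_prop
  calc ∫⁻ h, incr p V h * ‖h‖ₑ ^ (-(N + σ * p))
      ≤ ∫⁻ h, 2 * volume B * (ENNReal.ofReal (C ^ (p - 1)) * ∑ l ∈ Finset.range k,
          ENNReal.ofReal (a l ^ p) *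
            (ENNReal.ofReal (kern σ (2 ^ l * n₀ * ‖h‖)) * ‖h‖ₑ ^ (-(N : ℝ)))) := by
        refine lintegral_mono_ae ?_
        filter_upwards [ae_ne_zero hN] with h hh
        have hpos := norm_pos_iff.2 hh
        have h1 := incr_le_of_modulus hp0 hB hV0 (m := lacunaryModulus σ n₀ k a ‖h‖) h
          (fun x => by simpa using hmod (x + h) x)
        have h2 := lacunaryModulus_rpow_le hp hC hsum hn₀ k ha hpos
        have hk : ∀ l, 0 ≤ kern σ (2 ^ l * n₀ * ‖h‖) := fun l => kern_nonneg (by positivity)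
        have hT : 0 ≤ ∑ l ∈ Finset.range k, kern σ (2 ^ l * n₀ * ‖h‖) * a l ^ p :=
          Finset.sum_nonneg fun l _ => mul_nonneg (hk l) (Real.rpow_nonneg (ha l) _)
        calc incr p V h * ‖h‖ₑ ^ (-(N + σ * p))
            ≤ 2 * volume B * ENNReal.ofReal (‖h‖ ^ (σ * p) * (C ^ (p - 1) *
                ∑ l ∈ Finset.range k, kern σ (2 ^ l * n₀ * ‖h‖) * a l ^ p)) *
                ‖h‖ₑ ^ (-(N + σ * p)) := by
              gcongr
              exact h1.trans (by gcongr)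
          _ = 2 * volume B * (ENNReal.ofReal (C ^ (p - 1)) *
                (ENNReal.ofReal (∑ l ∈ Finset.range k, kern σ (2 ^ l * n₀ * ‖h‖) * a l ^ p) *
                  ‖h‖ₑ ^ (-(N : ℝ)))) := by
              rw [enorm_rpow_eq hh, enorm_rpow_eq hh, mul_assoc, ← ENNReal.ofReal_mul (by positivity),
                ← ENNReal.ofReal_mul (by positivity), ← ENNReal.ofReal_mul (by positivity)]
              congr 2
              have : ‖h‖ ^ (-(N : ℝ)) = ‖h‖ ^ (σ * p) * ‖h‖ ^ (-(N + σ * p)) := by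
                rw [← Real.rpow_add hpos]; congr 1; ring
              rw [this]; ring
          _ = _ := by
              rw [ENNReal.ofReal_sum_of_nonneg fun l _ => mul_nonneg (hk l)
                (Real.rpow_nonneg (ha l) _), Finset.sum_mul]
              congr 2
              refine Finset.sum_congr rfl fun l _ => ?_
              rw [ENNReal.ofReal_mul (hk l)]; ring
    _ ≤ 2 * volume B * (ENNReal.ofReal (C ^ (p - 1)) * ∑ l ∈ Finset.range k,
          ENNReal.ofReal (a l ^ p) * I) := by
        have hms : Measurable fun h : Eu N => ∑ l ∈ Finset.range k, ENNReal.ofReal (a l ^ p) *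
            (ENNReal.ofReal (kern σ (2 ^ l * n₀ * ‖h‖)) * ‖h‖ₑ ^ (-(N : ℝ))) :=
          Finset.measurable_fun_sum _ fun l _ => hterm l
        rw [lintegral_const_mul _ (hms.const_mul _), lintegral_const_mul _ hms,
          lintegral_finsetSum _ fun l _ => hterm l]
        gcongr with l _
        rw [lintegral_const_mul' _ _ ENNReal.ofReal_ne_top]
        gcongr
        exact lintegral_kern_le hN σ (by positivity)
    _ = _ := by
        have hA : ∀ l ∈ Finset.range k, 0 ≤ a l ^ p := fun l _ => Real.rpow_nonneg (ha l) _
        rw [← Finset.sum_mul, ← ENNReal.ofReal_sum_of_nonneg hA]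
        have hI' : I = ENNReal.ofReal I.toReal := (ENNReal.ofReal_toReal hI).symm
        rw [ENNReal.ofReal_mul (by positivity), ENNReal.ofReal_mul (by positivity),
          ENNReal.ofReal_mul (by norm_num), ← hI']
        simp only [ENNReal.ofReal_ofNat]
        ring

/-- Bound the minimum by `1` and each amplitude by the `ℓ^p` norm; the factors `2 ^ (-σ l)` form a
geometric series. -/
theorem lacunaryModulus_le {σ p : ℝ} (hσ : 0 < σ) (hp : 1 < p) {n₀ : ℝ} (hn : 1 ≤ n₀) (k : ℕ)
    {a : ℕ → ℝ} (ha : ∀ l, 0 ≤ a l) (t : ℝ) :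
    lacunaryModulus σ n₀ k a t ≤
      (1 - 2 ^ (-σ))⁻¹ * (∑ l ∈ Finset.range k, a l ^ p) ^ (1 / p) := by
  have hp0 : 0 < p := by linarith
  set A := (∑ l ∈ Finset.range k, a l ^ p) ^ (1 / p)
  have hA0 : 0 ≤ A := Real.rpow_nonneg (Finset.sum_nonneg fun l _ => Real.rpow_nonneg (ha l) _) _
  have hr0 : (0 : ℝ) < 2 ^ (-σ) := by positivity
  have hr1 : (2 : ℝ) ^ (-σ) < 1 := Real.rpow_lt_one_of_one_lt_of_neg (by norm_num) (by linarith)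
  have hle : ∀ l ∈ Finset.range k, a l ≤ A := by
    intro l hl
    have h1 : a l ^ p ≤ ∑ l ∈ Finset.range k, a l ^ p :=
      Finset.single_le_sum (f := fun l => a l ^ p) (fun l _ => Real.rpow_nonneg (ha l) _) hl
    calc a l = (a l ^ p) ^ (1 / p) := by
          rw [← Real.rpow_mul (ha l), mul_one_div_cancel hp0.ne', Real.rpow_one]
      _ ≤ A := Real.rpow_le_rpow (Real.rpow_nonneg (ha l) _) h1 (by positivity)
  calc lacunaryModulus σ n₀ k a t ≤ ∑ l ∈ Finset.range k, A * (2 ^ (-σ)) ^ l := by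
        refine Finset.sum_le_sum fun l hl => ?_
        have h1 : ((2 : ℝ) ^ l * n₀) ^ (-σ) ≤ (2 ^ (-σ)) ^ l := by
          rw [Real.mul_rpow (by positivity) (by positivity), ← Real.rpow_natCast,
            ← Real.rpow_natCast, ← Real.rpow_mul (by norm_num), ← Real.rpow_mul (by norm_num),
            mul_comm (l : ℝ)]
          exact mul_le_of_le_one_right (by positivity)
            (Real.rpow_le_one_of_one_le_of_nonpos hn (by linarith))
        have hal := ha l
        calc a l * (2 ^ l * n₀) ^ (-σ) * min 1 (2 ^ l * n₀ * t)
            ≤ a l * (2 ^ l * n₀) ^ (-σ) * 1 := by gcongr; exact min_le_left _ _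
          _ ≤ _ := by rw [mul_one]; gcongr; exact hle l hl
    _ = A * ∑ l ∈ Finset.range k, ((2 : ℝ) ^ (-σ)) ^ l := by rw [Finset.mul_sum]
    _ ≤ A * (1 - 2 ^ (-σ))⁻¹ := by
        gcongr
        rw [← tsum_geometric_of_lt_one hr0.le hr1]
        exact (summable_geometric_of_lt_one hr0.le hr1).sum_le_tsum _ fun _ _ => by positivity
    _ = _ := mul_comm _ _

theorem eLpNorm_le_of_bound {F : Type*} [NormedAddCommGroup F] {N : ℕ} {p : ℝ} (hp : 0 < p)
    {W : Eu N → F} {B : Set (Eu N)} (hB : MeasurableSet B) (hW0 : ∀ x, x ∉ B → W x = 0) {c : ℝ}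
    (hc : ∀ x, ‖W x‖ ≤ c) :
    eLpNorm W (ENNReal.ofReal p) volume ≤ ENNReal.ofReal c * volume B ^ (1 / p) := by
  rw [eLpNorm_eq_lintegral_rpow_enorm_toReal (by simpa using hp) ENNReal.ofReal_ne_top,
    ENNReal.toReal_ofReal hp.le]
  calc (∫⁻ x, ‖W x‖ₑ ^ p) ^ (1 / p)
      ≤ (∫⁻ x, ENNReal.ofReal c ^ p * B.indicator 1 x) ^ (1 / p) := by
        gcongr with x
        by_cases hx : x ∈ B
        · rw [Set.indicator_of_mem hx, Pi.one_apply, mul_one, ← ofReal_norm]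
          gcongr
          exact hc x
        · rw [hW0 x hx]; simp [ENNReal.zero_rpow_of_pos hp]
    _ = _ := by
        rw [lintegral_const_mul' _ _ (ENNReal.rpow_ne_top_of_nonneg hp.le ENNReal.ofReal_ne_top),
          lintegral_indicator_one hB, ENNReal.mul_rpow_of_nonneg _ _ (by positivity),
          ← ENNReal.rpow_mul, mul_one_div_cancel hp.ne', ENNReal.rpow_one]

/-- The Besov norm of a test function whose gradient has a lacunary modulus of continuity. -/
theorem besovNorm_le_of_lacunaryModulus {N : ℕ} (hN : 0 < N) {s p : ℝ} (hp : 1 < p) (hs1 : 1 < s)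
    (hs2 : s < 2) :
    ∃ C : ℝ, 0 ≤ C ∧ ∀ (R : ℝ), 0 ≤ R → ∀ (n₀ : ℝ), 1 ≤ n₀ → ∀ (k : ℕ) (a : ℕ → ℝ),
      (∀ l, 0 ≤ a l) → ∀ u : Eu N → ℝ, IsTest u →
      (∀ x, x ∉ Metric.closedBall (0 : Eu N) R → u x = 0) →
      (∀ x y, ‖gradient u x - gradient u y‖ ≤ lacunaryModulus (s - 1) n₀ k a ‖x - y‖) →
      besovNorm s p u ≤ ENNReal.ofReal
        (C * (1 + R) * R ^ (N / p) * (∑ l ∈ Finset.range k, a l ^ p) ^ (1 / p)) := by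
  have hp0 : 0 < p := by linarith
  have hσ : 0 < s - 1 := by linarith
  obtain ⟨C, hC, hE⟩ := energy_le_of_lacunaryModulus (F := Eu N) hN hσ (by linarith) hp
  set c := volume.real (Metric.ball (0 : Eu N) 1) with hc
  have hcpos : 0 < c := volume_real_unit_ball_pos N
  set d : ℝ := (1 - 2 ^ (-(s - 1)))⁻¹ with hd
  have hd0 : 0 ≤ d := by
    have : (2 : ℝ) ^ (-(s - 1)) < 1 := Real.rpow_lt_one_of_one_lt_of_neg (by norm_num) (by linarith)
    exact inv_nonneg.2 (by linarith)
  refine ⟨c ^ (1 / p) * (3 * d + C ^ (1 / p)), by positivity, ?_⟩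
  intro R hR n₀ hn₀ k a ha u hu hu0 hmod
  set B := Metric.closedBall (0 : Eu N) R with hB
  set T := ∑ l ∈ Finset.range k, a l ^ p with hT
  have hT0 : 0 ≤ T := Finset.sum_nonneg fun l _ => Real.rpow_nonneg (ha l) _
  have hgrad0 : ∀ x, x ∉ B → gradient u x = 0 := by
    intro x hx
    have h1 : u =ᶠ[𝓝 x] fun _ => 0 := by
      filter_upwards [Metric.isClosed_closedBall.isOpen_compl.mem_nhds hx] with y hy using hu0 y hy
    simp [gradient, h1.fderiv_eq]
  have : Nonempty (Fin N) := ⟨⟨0, hN⟩⟩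
  obtain ⟨z, hz⟩ := NormedSpace.exists_lt_norm ℝ (Eu N) 0
  -- A reference point where `u` and its gradient vanish turns the modulus of continuity into sup
  -- bounds, for the gradient directly and for `u` by the mean value inequality.
  obtain ⟨y, hy⟩ : ∃ y : Eu N, ‖y‖ = R + 1 := by
    refine ⟨((R + 1) / ‖z‖) • z, ?_⟩
    rw [norm_smul, Real.norm_of_nonneg (by positivity), div_mul_cancel₀ _ hz.ne']
  have hyB : y ∉ B := by rw [hB, mem_closedBall_zero_iff, hy]; linarith
  have hgb : ∀ x, ‖gradient u x‖ ≤ d * T ^ (1 / p) := by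
    intro x
    have h1 := hmod x y
    rw [hgrad0 y hyB, sub_zero] at h1
    exact h1.trans (lacunaryModulus_le hσ hp hn₀ k ha _)
  have hub : ∀ x, ‖u x‖ ≤ 2 * (1 + R) * (d * T ^ (1 / p)) := by
    intro x
    by_cases hx : x ∈ B
    · have h1 := convex_univ.norm_image_sub_le_of_norm_fderiv_le (𝕜 := ℝ) (f := u) (x := y) (y := x)
        (C := d * T ^ (1 / p)) (fun x _ => hu.1.differentiable (by simp) x)
        (fun x _ => by rw [← norm_gradient]; exact hgb x) (Set.mem_univ _) (Set.mem_univ _)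
      rw [hu0 y hyB, sub_zero] at h1
      refine h1.trans ?_
      rw [mul_comm]
      gcongr
      refine (norm_sub_le _ _).trans ?_
      rw [hy]
      have := mem_closedBall_zero_iff.1 hx
      linarith
    · rw [hu0 x hx, norm_zero]; positivity
  have hvol : volume B = ENNReal.ofReal (c * R ^ N) := by
    rw [hB, Measure.addHaar_closedBall volume _ hR, finrank_euclideanSpace_fin, mul_comm,
      ENNReal.ofReal_mul hcpos.le, hc, ofReal_measureReal]
  have hvolp : volume B ^ (1 / p) = ENNReal.ofReal (c ^ (1 / p) * R ^ (N / p)) := by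
    rw [hvol, ENNReal.ofReal_rpow_of_nonneg (by positivity) (by positivity),
      Real.mul_rpow hcpos.le (by positivity), ← Real.rpow_natCast, ← Real.rpow_mul hR,
      mul_one_div]
  have hmB : MeasurableSet B := measurableSet_closedBall
  have h1 := eLpNorm_le_of_bound hp0 hmB hu0 hub
  have h2 := eLpNorm_le_of_bound hp0 hmB hgrad0 hgb
  have h3 : gagliardo (s - 1) p (gradient u) ≤ volume B ^ (1 / p) *
      ENNReal.ofReal (C ^ (1 / p) * T ^ (1 / p)) := by
    rw [gagliardo_eq_energy, ← Real.mul_rpow hC hT0,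
      ← ENNReal.ofReal_rpow_of_nonneg (by positivity) (by positivity),
      ← ENNReal.mul_rpow_of_nonneg _ _ (by positivity)]
    gcongr
    exact hE B hmB n₀ (by linarith) k a ha _
      (contDiff_gradient hu.1).continuous.stronglyMeasurable hgrad0 hmod
  refine (iInf₂_le (gradient u) (isWeakGrad_gradient hu)).trans ?_
  refine (add_le_add (add_le_add h1 h2) h3).trans ?_
  rw [hvolp, ← ENNReal.ofReal_mul (by positivity), ← ENNReal.ofReal_mul (by positivity),
    ← ENNReal.ofReal_mul (by positivity), ← ENNReal.ofReal_add (by positivity) (by positivity),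
    ← ENNReal.ofReal_add (by positivity) (by positivity)]
  refine ENNReal.ofReal_le_ofReal ?_
  have hX : 0 ≤ c ^ (1 / p) * R ^ (N / p) * T ^ (1 / p) := by positivity
  have hCp : 0 ≤ C ^ (1 / p) := by positivity
  have e1 : 2 * (1 + R) * (d * T ^ (1 / p)) * (c ^ (1 / p) * R ^ (N / p)) +
      d * T ^ (1 / p) * (c ^ (1 / p) * R ^ (N / p)) +
      c ^ (1 / p) * R ^ (N / p) * (C ^ (1 / p) * T ^ (1 / p)) =
      (2 * (1 + R) * d + d + C ^ (1 / p)) * (c ^ (1 / p) * R ^ (N / p) * T ^ (1 / p)) := by ring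
  have e2 : c ^ (1 / p) * (3 * d + C ^ (1 / p)) * (1 + R) * R ^ (N / p) * T ^ (1 / p) =
      (3 * d + C ^ (1 / p)) * (1 + R) * (c ^ (1 / p) * R ^ (N / p) * T ^ (1 / p)) := by ring
  rw [e1, e2]
  gcongr
  nlinarith [mul_nonneg hd0 hR, mul_nonneg hCp hR]

/-! ### Rescaling amplitudes -/

theorem IsWeakGrad.const_mul {N : ℕ} {u : Eu N → ℝ} {V : Eu N → Eu N} (h : IsWeakGrad u V) (c : ℝ) :
    IsWeakGrad (fun x => c * u x) (fun x => c • V x) := by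
  refine ⟨h.1.smul c, h.2.1.smul c, fun φ hφ i => ?_⟩
  have h1 := h.2.2 φ hφ i
  simp only [PiLp.smul_apply, smul_eq_mul, mul_assoc]
  rw [integral_const_mul, integral_const_mul, h1, mul_neg]

theorem gagliardo_const_smul {N : ℕ} {σ p : ℝ} (hp : 0 < p) (c : ℝ) (V : Eu N → Eu N) :
    gagliardo σ p (fun x => c • V x) = ‖c‖ₑ * gagliardo σ p V := by
  have hc : ‖c‖ₑ ^ p ≠ ⊤ := ENNReal.rpow_ne_top_of_nonneg hp.le enorm_ne_top
  simp only [gagliardo_eq_energy, energy, ← smul_sub, enorm_smul]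
  simp_rw [ENNReal.mul_rpow_of_nonneg _ _ hp.le, mul_assoc, lintegral_const_mul' _ _ hc]
  rw [ENNReal.mul_rpow_of_nonneg _ _ (by positivity), ← ENNReal.rpow_mul,
    mul_one_div_cancel hp.ne', ENNReal.rpow_one]

/-- The strict inequality extracts an actual weak gradient from the infimum, so uniqueness of weak
gradients is never needed. -/
theorem besovNorm_const_mul_le {N : ℕ} {s p : ℝ} (hp : 0 < p) {u : Eu N → ℝ} {C : ℝ≥0∞}
    (hu : besovNorm s p u < C) (c : ℝ) : besovNorm s p (fun x => c * u x) ≤ ‖c‖ₑ * C := by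
  obtain ⟨V, hV⟩ := iInf_lt_iff.1 hu
  obtain ⟨huV, hlt⟩ := iInf_lt_iff.1 hV
  refine (iInf₂_le _ (huV.const_mul c)).trans ?_
  have h1 : eLpNorm (fun x => c * u x) (ENNReal.ofReal p) volume =
      ‖c‖ₑ * eLpNorm u (ENNReal.ofReal p) volume := eLpNorm_const_smul c u _ _
  have h2 : eLpNorm (fun x => c • V x) (ENNReal.ofReal p) volume =
      ‖c‖ₑ * eLpNorm V (ENNReal.ofReal p) volume := eLpNorm_const_smul c V _ _
  rw [h1, h2, gagliardo_const_smul hp, ← mul_add, ← mul_add]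
  gcongr

theorem differentiable_fderiv_apply {N : ℕ} {u : Eu N → ℝ} (hu : ContDiff ℝ ∞ u) (v : Eu N) :
    Differentiable ℝ fun y => fderiv ℝ u y v :=
  ((hu.fderiv_right (m := ∞) (by norm_num)).clm_apply contDiff_const).differentiable (by simp)

theorem hessian_const_mul {N : ℕ} {u : Eu N → ℝ} (hu : ContDiff ℝ ∞ u) (c : ℝ) (x : Eu N) :
    hessian (fun y => c * u y) x = c • hessian u x := by
  ext i j
  simp only [hessian, Matrix.of_apply, Matrix.smul_apply, smul_eq_mul]
  have h1 : ∀ y, fderiv ℝ (fun y => c * u y) y = c • fderiv ℝ u y := fun y =>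
    fderiv_const_mul (hu.differentiable (by simp) y) c
  simp only [h1, smul_apply, smul_eq_mul]
  rw [fderiv_const_mul (differentiable_fderiv_apply hu _ x)]
  simp

/-- The conclusion of the theorem follows from bounded norms and unbounded determinants. -/
theorem exists_sequence_of_bounded {N : ℕ} (hN : 0 < N) {s p : ℝ} (hp : 0 < p)
    {v : ℕ → Eu N → ℝ} {φ : Eu N → ℝ} (hv : ∀ k, IsTest (v k)) (hφ : IsTest φ) {C : ℝ}
    (hC : ∀ k, besovNorm s p (v k) ≤ ENNReal.ofReal C)
    (hdet : Tendsto (fun k => ∫ x, (hessian (v k) x).det * φ x) atTop atTop) :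
    ∃ (u : ℕ → Eu N → ℝ) (φ : Eu N → ℝ), (∀ k, IsTest (u k)) ∧ IsTest φ ∧
      Tendsto (fun k => besovNorm s p (u k)) atTop (𝓝 0) ∧
      Tendsto (fun k => ∫ x, (hessian (u k) x).det * φ x) atTop atTop := by
  have hNpos : (0 : ℝ) < N := by exact_mod_cast hN
  set T : ℕ → ℝ := fun k => ∫ x, (hessian (v k) x).det * φ x with hT
  -- With this exponent `c k → 0`, while the determinant scales by `c k ^ N = T k ^ (-1/2)` and the
  -- integral becomes `T k ^ (1/2)`.
  set c : ℕ → ℝ := fun k => T k ^ (-(1 / (2 * N)) : ℝ) with hc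
  refine ⟨fun k x => c k * v k x, φ, fun k => isTest_mul contDiff_const (hv k), hφ, ?_, ?_⟩
  · have hc0 : Tendsto c atTop (𝓝 0) :=
      (tendsto_rpow_neg_atTop (by positivity)).comp hdet
    have h1 : Tendsto (fun k => ‖c k‖ₑ * (ENNReal.ofReal C + 1)) atTop (𝓝 0) := by
      have h2 : Tendsto (fun k => ‖c k‖ₑ) atTop (𝓝 0) := by
        have := (continuous_enorm.tendsto (0 : ℝ)).comp hc0
        rw [enorm_zero] at this
        exact this
      have := ENNReal.Tendsto.mul_const (b := ENNReal.ofReal C + 1) h2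
        (Or.inr (by simp))
      simpa using this
    refine tendsto_of_tendsto_of_tendsto_of_le_of_le tendsto_const_nhds h1 (fun _ => zero_le)
      fun k => ?_
    refine besovNorm_const_mul_le hp ((hC k).trans_lt ?_) _
    exact ENNReal.lt_add_right ENNReal.ofReal_ne_top one_ne_zero
  · have h1 : ∀ k, ∫ x, (hessian (fun y => c k * v k y) x).det * φ x = c k ^ N * T k := by
      intro k
      rw [hT, ← integral_const_mul]
      congr 1; ext x
      rw [hessian_const_mul (hv k).1, Matrix.det_smul, Fintype.card_fin, mul_assoc]
    simp_rw [h1]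
    have h2 : Tendsto (fun k => T k ^ (1 / 2 : ℝ)) atTop atTop :=
      (tendsto_rpow_atTop (by norm_num)).comp hdet
    refine h2.congr' ?_
    filter_upwards [hdet.eventually_gt_atTop 0] with k hk
    have hk' : 0 < T k := hk
    rw [hc]
    dsimp only
    rw [← Real.rpow_natCast, ← Real.rpow_mul hk'.le]
    nth_rewrite 3 [← Real.rpow_one (T k)]
    rw [← Real.rpow_add hk']
    congr 1
    field_simp
    norm_num

/-! ### The radial profile -/

/-- The radial profile of the concentrating sequence. -/
def profile (N : ℕ) (y : Eu N) : ℝ := 1 - Real.smoothTransition (‖y‖ ^ 2)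

theorem contDiff_smoothTransition : ContDiff ℝ ∞ Real.smoothTransition :=
  Real.smoothTransition.contDiff

theorem contDiff_deriv_smoothTransition : ContDiff ℝ ∞ (deriv Real.smoothTransition) :=
  contDiff_smoothTransition.deriv'

theorem profile_eq_zero {N : ℕ} {y : Eu N} (hy : y ∉ Metric.closedBall (0 : Eu N) 1) :
    profile N y = 0 := by
  have : 1 < ‖y‖ := by simpa using hy
  rw [profile, Real.smoothTransition.one_of_one_le (by nlinarith), sub_self]

theorem isTest_of_eq_zero {N : ℕ} {u : Eu N → ℝ} (hu : ContDiff ℝ ∞ u) {R : ℝ}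
    (h : ∀ x, x ∉ Metric.closedBall (0 : Eu N) R → u x = 0) : IsTest u :=
  ⟨hu, HasCompactSupport.intro (isCompact_closedBall _ _) h⟩

theorem isTest_profile (N : ℕ) : IsTest (profile N) :=
  isTest_of_eq_zero (contDiff_const.sub (contDiff_smoothTransition.comp (contDiff_norm_sq ℝ)))
    fun _ => profile_eq_zero

theorem hasFDerivAt_norm_sq {N : ℕ} (y : Eu N) :
    HasFDerivAt (fun y : Eu N => ‖y‖ ^ 2) (2 • innerSL ℝ y) y :=
  (hasStrictFDerivAt_norm_sq y).hasFDerivAt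

theorem innerSL_single {N : ℕ} (y : Eu N) (i : Fin N) :
    innerSL ℝ y (EuclideanSpace.single i 1) = y i := by
  rw [innerSL_apply_apply, EuclideanSpace.inner_single_right]; simp

theorem fderiv_profile {N : ℕ} (y : Eu N) (j : Fin N) :
    fderiv ℝ (profile N) y (EuclideanSpace.single j 1) =
      -(2 * deriv Real.smoothTransition (‖y‖ ^ 2) * y j) := by
  have hS : HasDerivAt Real.smoothTransition (deriv Real.smoothTransition (‖y‖ ^ 2)) (‖y‖ ^ 2) :=
    (contDiff_smoothTransition.differentiable (by simp) _).hasDerivAt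
  have h1 := (hS.comp_hasFDerivAt y (hasFDerivAt_norm_sq y)).const_sub 1
  have h2 : fderiv ℝ (profile N) y = _ := h1.fderiv
  rw [h2]
  simp only [neg_apply, smul_apply, innerSL_single, smul_eq_mul, nsmul_eq_mul]
  ring

theorem hessian_profile {N : ℕ} (y : Eu N) :
    hessian (profile N) y = (-2 * deriv Real.smoothTransition (‖y‖ ^ 2)) • (1 : Matrix _ _ ℝ) +
      (-4 * deriv (deriv Real.smoothTransition) (‖y‖ ^ 2)) •
        Matrix.vecMulVec (fun i => y i) (fun i => y i) := by
  ext i j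
  simp only [hessian, Matrix.of_apply, fderiv_profile]
  have hS' : HasDerivAt (deriv Real.smoothTransition)
      (deriv (deriv Real.smoothTransition) (‖y‖ ^ 2)) (‖y‖ ^ 2) :=
    (contDiff_deriv_smoothTransition.differentiable (by simp) _).hasDerivAt
  have h1 := hS'.comp_hasFDerivAt y (hasFDerivAt_norm_sq y)
  have h2 : HasFDerivAt (fun y : Eu N => y j) (EuclideanSpace.proj j : Eu N →L[ℝ] ℝ) y :=
    (EuclideanSpace.proj j : Eu N →L[ℝ] ℝ).hasFDerivAt
  have h3 := ((h1.const_mul 2).mul h2).neg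
  have h4 : fderiv ℝ (fun y : Eu N => -(2 * deriv Real.smoothTransition (‖y‖ ^ 2) * y j)) y = _ :=
    h3.fderiv
  have hproj : (EuclideanSpace.proj j : Eu N →L[ℝ] ℝ) (EuclideanSpace.single i 1) =
      if j = i then 1 else 0 := by simp
  rw [h4]
  simp only [Matrix.add_apply, Matrix.smul_apply, Matrix.one_apply, Matrix.vecMulVec_apply,
    neg_apply, add_apply, smul_apply, innerSL_single, smul_eq_mul, nsmul_eq_mul,
    hproj]
  by_cases h : i = j
  · subst h; simp; ring
  · simp [h, Ne.symm h]; ring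

/-- The matrix determinant lemma for a rank-one perturbation. For `α = 0` the matrix has rank at
most one, so its determinant vanishes since `N ≥ 2`. -/
theorem det_smul_one_add_smul_vecMulVec {N : ℕ} (hN : 2 ≤ N) (α β : ℝ) (y : Fin N → ℝ) :
    (α • (1 : Matrix (Fin N) (Fin N) ℝ) + β • Matrix.vecMulVec y y).det =
      α ^ N + α ^ (N - 1) * β * ∑ i, y i ^ 2 := by
  by_cases hα : α = 0
  · have : Nontrivial (Fin N) := Fin.nontrivial_iff_two_le.2 hN
    rw [hα, zero_smul, zero_add, Matrix.det_smul, Matrix.det_vecMulVec, zero_pow (by omega),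
      zero_pow (by omega)]
    ring
  · have h1 : α • (1 : Matrix (Fin N) (Fin N) ℝ) + β • Matrix.vecMulVec y y =
        α • (1 + Matrix.replicateCol Unit ((β / α) • y) * Matrix.replicateRow Unit y) := by
      ext i j
      simp [Matrix.vecMulVec_apply, Matrix.mul_apply]
      field_simp
    rw [h1, Matrix.det_smul, Matrix.det_one_add_replicateCol_mul_replicateRow, Fintype.card_fin]
    have h2 : y ⬝ᵥ ((β / α) • y) = β / α * ∑ i, y i ^ 2 := by
      simp [dotProduct, Finset.mul_sum]
      refine Finset.sum_congr rfl fun i _ => by ring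
    have h3 : α ^ N = α ^ (N - 1) * α := by rw [← pow_succ]; congr 1; omega
    rw [h2, h3]
    field_simp

theorem det_hessian_profile {N : ℕ} (hN : 2 ≤ N) (y : Eu N) :
    (hessian (profile N) y).det = (-2 * deriv Real.smoothTransition (‖y‖ ^ 2)) ^ N +
      (-2 * deriv Real.smoothTransition (‖y‖ ^ 2)) ^ (N - 1) *
        (-4 * deriv (deriv Real.smoothTransition) (‖y‖ ^ 2)) * ‖y‖ ^ 2 := by
  rw [hessian_profile, det_smul_one_add_smul_vecMulVec hN]
  congr 2
  rw [EuclideanSpace.norm_sq_eq]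
  simp

theorem deriv_smoothTransition_nonneg (t : ℝ) : 0 ≤ deriv Real.smoothTransition t :=
  Real.smoothTransition.monotone.deriv_nonneg

theorem deriv_smoothTransition_eq_zero {t : ℝ} (ht : 1 < t) :
    deriv Real.smoothTransition t = 0 := by
  have : Real.smoothTransition =ᶠ[𝓝 t] fun _ => 1 := by
    filter_upwards [lt_mem_nhds ht] with x hx using Real.smoothTransition.one_of_one_le hx.le
  rw [this.deriv_eq, deriv_const]

theorem exists_deriv_smoothTransition : ∃ t : ℝ, 0 < t ∧ t < 1 ∧
    0 < deriv Real.smoothTransition t := by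
  obtain ⟨t, ht, h⟩ := exists_deriv_eq_slope Real.smoothTransition (zero_lt_one' ℝ)
    contDiff_smoothTransition.continuous.continuousOn
    (contDiff_smoothTransition.differentiable (by simp)).differentiableOn
  refine ⟨t, ht.1, ht.2, ?_⟩
  rw [h]; simp

/-- The second moment of the Hessian determinant of the profile does not vanish. -/
theorem integral_det_hessian_profile_pos {N : ℕ} (hN : 2 ≤ N) :
    0 < ∫ y, (hessian (profile N) y).det * ((-1) ^ (N + 1) * ‖y‖ ^ 2) := by
  have hN0 : 0 < N := by omega
  have hNpos : (0 : ℝ) < N := by exact_mod_cast hN0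
  have : Nonempty (Fin N) := ⟨⟨0, hN0⟩⟩
  set Q : ℝ → ℝ := fun r => -2 * deriv Real.smoothTransition (r ^ 2) with hQ
  set Q' : ℝ → ℝ := fun r => -4 * deriv (deriv Real.smoothTransition) (r ^ 2) with hQ'
  have hS'c := contDiff_deriv_smoothTransition
  have hQc : Continuous Q := by
    have := hS'c.continuous
    fun_prop
  have hQ'c : Continuous Q' := by
    have := (hS'c.continuous_deriv (by simp))
    fun_prop
  have hQd : ∀ r, HasDerivAt Q (Q' r * r) r := by
    intro r
    have h1 : HasDerivAt (deriv Real.smoothTransition)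
      (deriv (deriv Real.smoothTransition) (r ^ 2)) (r ^ 2) :=
      (hS'c.differentiable (by simp) _).hasDerivAt
    have h2 := (HasDerivAt.comp (h := fun r : ℝ => r ^ 2) r h1 (hasDerivAt_pow 2 r)).const_mul (-2)
    refine h2.congr_deriv ?_
    simp [hQ']; ring
  set f : ℝ → ℝ := fun r => (Q r ^ N + Q r ^ (N - 1) * Q' r * r ^ 2) * ((-1) ^ (N + 1) * r ^ 2)
    with hf
  have e1 : ∫ y, (hessian (profile N) y).det * ((-1) ^ (N + 1) * ‖y‖ ^ 2) =
      ∫ y : Eu N, f ‖y‖ := by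
    congr 1; ext y; rw [det_hessian_profile hN]
  have hQ0 : ∀ r, 1 < r → Q r = 0 := by
    intro r hr
    simp only [hQ]
    rw [deriv_smoothTransition_eq_zero (by nlinarith), mul_zero]
  rw [e1, integral_fun_norm_addHaar, finrank_euclideanSpace_fin, nsmul_eq_mul, smul_eq_mul]
  refine mul_pos hNpos (mul_pos (volume_real_unit_ball_pos N) ?_)
  -- `Q` is known to vanish only for `r > 1`, hence the endpoint `2`, where the boundary term of the
  -- integration by parts disappears.
  have e2 : ∫ r in Set.Ioi (0 : ℝ), r ^ (N - 1) • f r = ∫ r in (0 : ℝ)..2, r ^ (N - 1) • f r := by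
    rw [intervalIntegral.integral_of_le (by norm_num)]
    refine (setIntegral_eq_of_subset_of_forall_sdiff_eq_zero measurableSet_Ioi
      (fun r hr => hr.1) fun r hr => ?_)
    have hr2 : 1 < r := by
      have h1 : 0 < r := hr.1
      by_contra hcon
      push Not at hcon
      exact hr.2 ⟨h1, by linarith⟩
    simp only [hf, hQ0 r hr2]
    rw [zero_pow (by omega), zero_pow (by omega)]
    simp
  rw [e2]
  -- Subtracting the exact derivative `P'` removes `Q'` from the integrand.
  set P : ℝ → ℝ := fun r => r ^ (N + 2) * Q r ^ N with hP
  have hPd : ∀ r, HasDerivAt P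
      ((N + 2) * r ^ (N + 1) * Q r ^ N + N * (r ^ (N + 3) * Q r ^ (N - 1) * Q' r)) r := by
    intro r
    have := (hasDerivAt_pow (N + 2) r).mul ((hQd r).pow N)
    refine this.congr_deriv ?_
    push_cast
    simp only [Pi.pow_apply]
    ring
  have hftc : ∫ r in (0 : ℝ)..2,
      ((N + 2) * r ^ (N + 1) * Q r ^ N + N * (r ^ (N + 3) * Q r ^ (N - 1) * Q' r)) = 0 := by
    rw [intervalIntegral.integral_eq_sub_of_hasDerivAt (fun r _ => hPd r)
      (Continuous.intervalIntegrable (by fun_prop) _ _)]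
    simp [hP, hQ0 2 (by norm_num), hN0.ne']
  -- The remainder has the definite sign of `(-Q) ^ N`, since `Q ≤ 0`; this is the reason for the
  -- factor `(-1) ^ (N + 1)` in the weight.
  have e3 : ∀ r : ℝ, r ^ (N - 1) • f r = (-1) ^ (N + 1) / N *
      ((N + 2) * r ^ (N + 1) * Q r ^ N + N * (r ^ (N + 3) * Q r ^ (N - 1) * Q' r)) +
      2 / N * (r ^ (N + 1) * (-Q r) ^ N) := by
    intro r
    obtain ⟨n, rfl⟩ : ∃ n, N = n + 1 := ⟨N - 1, by omega⟩
    simp only [hf, smul_eq_mul, Nat.add_sub_cancel]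
    rw [neg_pow (Q r)]
    field_simp
    ring
  simp_rw [e3]
  rw [intervalIntegral.integral_add, intervalIntegral.integral_const_mul, hftc, mul_zero, zero_add,
    intervalIntegral.integral_const_mul]
  · refine mul_pos (by positivity) ?_
    refine intervalIntegral.integral_pos (by norm_num) (Continuous.continuousOn (by fun_prop))
      (fun r hr => ?_) ?_
    · have h1 : 0 ≤ -Q r := by
        have := deriv_smoothTransition_nonneg (r ^ 2)
        simp only [hQ]; linarith
      have : 0 ≤ r := hr.1.le
      positivity
    · obtain ⟨t, ht0, ht1, ht⟩ := exists_deriv_smoothTransition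
      refine ⟨√t, ⟨Real.sqrt_nonneg _, ?_⟩, ?_⟩
      · rw [Real.sqrt_le_left (by norm_num)]; linarith
      · have h1 : 0 < -Q (√t) := by
          simp only [hQ, Real.sq_sqrt ht0.le]; linarith
        have h2 : 0 < √t := Real.sqrt_pos.2 ht0
        positivity
  · exact Continuous.intervalIntegrable (by fun_prop) _ _
  · exact Continuous.intervalIntegrable (by fun_prop) _ _

/-! ### The concentrating sequence -/

theorem fderiv_comp_smul_apply {N : ℕ} {g : Eu N → ℝ} (hg : Differentiable ℝ g) (r : ℝ)
    (x : Eu N) : fderiv ℝ (fun x => g (r • x)) x = r • fderiv ℝ g (r • x) := by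
  have h1 : HasFDerivAt (fun x : Eu N => r • x) (r • ContinuousLinearMap.id ℝ (Eu N)) x :=
    (hasFDerivAt_id x).const_smul r
  have h2 := HasFDerivAt.comp (f := fun x : Eu N => r • x) x (hg (r • x)).hasFDerivAt h1
  have h3 : fderiv ℝ (fun x => g (r • x)) x = _ := h2.fderiv
  rw [h3]
  ext v
  simp

theorem hessian_comp_smul {N : ℕ} {g : Eu N → ℝ} (hg : ContDiff ℝ ∞ g) (r : ℝ) (x : Eu N) :
    hessian (fun x => g (r • x)) x = (r ^ 2) • hessian g (r • x) := by
  ext i j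
  simp only [hessian, Matrix.of_apply, Matrix.smul_apply, smul_eq_mul,
    fderiv_comp_smul_apply (hg.differentiable (by simp)), smul_apply]
  have hd := differentiable_fderiv_apply hg (EuclideanSpace.single j 1)
  have h1 : Differentiable ℝ fun x : Eu N => fderiv ℝ g (r • x) (EuclideanSpace.single j 1) :=
    hd.comp (by fun_prop)
  rw [fderiv_const_mul (h1 x), fderiv_comp_smul_apply (g := fun y => fderiv ℝ g y
    (EuclideanSpace.single j 1)) hd]
  simp only [smul_apply, smul_eq_mul]
  ring

theorem hessian_eq_zero_of_notMem {N : ℕ} {g : Eu N → ℝ} {R : ℝ}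
    (h : ∀ x, x ∉ Metric.closedBall (0 : Eu N) R → g x = 0) {y : Eu N}
    (hy : y ∉ Metric.closedBall (0 : Eu N) R) : hessian g y = 0 := by
  have hopen := Metric.isClosed_closedBall (x := (0 : Eu N)) (ε := R) |>.isOpen_compl
  have h1 : ∀ z, z ∉ Metric.closedBall (0 : Eu N) R → fderiv ℝ g z = 0 := by
    intro z hz
    have : g =ᶠ[𝓝 z] fun _ => 0 := by
      filter_upwards [hopen.mem_nhds hz] with w hw using h w hw
    rw [this.fderiv_eq]; simp
  ext i j
  simp only [hessian, Matrix.of_apply, Matrix.zero_apply]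
  have h2 : (fun z => fderiv ℝ g z (EuclideanSpace.single j 1)) =ᶠ[𝓝 y] fun _ => 0 := by
    filter_upwards [hopen.mem_nhds hy] with w hw
    rw [h1 w hw]; simp
  rw [h2.fderiv_eq]; simp

/-- The test function equal to `±|x|²` near the origin. -/
theorem exists_quadratic_test (N : ℕ) (c : ℝ) : ∃ φ : Eu N → ℝ, IsTest φ ∧
    ∀ x, ‖x‖ ≤ 1 → φ x = c * ‖x‖ ^ 2 := by
  let b : ContDiffBump (0 : Eu N) := ⟨1, 2, one_pos, one_lt_two⟩
  refine ⟨fun x => (c * ‖x‖ ^ 2) * b x,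
    isTest_mul (contDiff_const.mul (contDiff_norm_sq ℝ)) ⟨b.contDiff, b.hasCompactSupport⟩, ?_⟩
  intro x hx
  dsimp only
  rw [b.one_of_mem_closedBall (by simpa [b] using hx), mul_one]

/-- Concentration at the origin. The amplitude `ρ ^ (N/p - s)` keeps the leading, scale-invariant
part of the norm bounded, and the supports stay where the test function equals `±‖x‖ ^ 2`. -/
theorem exists_sequence_of_subscaling {N : ℕ} (hN : 2 ≤ N) {s p : ℝ} (hp : 1 < p) (hs1 : 1 < s)
    (hs2 : s < 2) (hscale : s < N / p + 1 - 2 / (N : ℝ)) :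
    ∃ (u : ℕ → Eu N → ℝ) (φ : Eu N → ℝ), (∀ k, IsTest (u k)) ∧ IsTest φ ∧
      Tendsto (fun k => besovNorm s p (u k)) atTop (𝓝 0) ∧
      Tendsto (fun k => ∫ x, (hessian (u k) x).det * φ x) atTop atTop := by
  have hN0 : 0 < N := by omega
  have hNpos : (0 : ℝ) < N := by exact_mod_cast hN0
  have hp0 : 0 < p := by linarith
  set g := profile N with hg
  have hgt : IsTest g := isTest_profile N
  have hgz : ∀ y, y ∉ Metric.closedBall (0 : Eu N) 1 → g y = 0 := fun y => profile_eq_zero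
  obtain ⟨φ, hφ, hφq⟩ := exists_quadratic_test N ((-1) ^ (N + 1))
  set r : ℕ → ℝ := fun k => k + 1 with hr
  have hrpos : ∀ k, 0 < r k := fun k => by simp only [hr]; positivity
  have hr1 : ∀ k, 1 ≤ r k := fun k => by simp [hr]
  set c : ℕ → ℝ := fun k => r k ^ (N / p - s) with hc
  have hcpos : ∀ k, 0 < c k := fun k => Real.rpow_pos_of_pos (hrpos k) _
  set v : ℕ → Eu N → ℝ := fun k x => c k * g (r k • x) with hv
  have hgr : ∀ k, ContDiff ℝ ∞ fun x : Eu N => g (r k • x) := fun k =>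
    hgt.1.comp (by fun_prop)
  have hvz : ∀ k x, x ∉ Metric.closedBall (0 : Eu N) (r k)⁻¹ → v k x = 0 := by
    intro k x hx
    simp only [hv]
    rw [hgz, mul_zero]
    have h1 : (r k)⁻¹ < ‖x‖ := by simpa using hx
    rw [mem_closedBall_zero_iff, norm_smul, Real.norm_of_nonneg (hrpos k).le, not_le]
    calc 1 = r k * (r k)⁻¹ := (mul_inv_cancel₀ (hrpos k).ne').symm
      _ < _ := by gcongr
  have hvt : ∀ k, IsTest (v k) := fun k =>
    isTest_of_eq_zero (contDiff_const.mul (hgr k)) (hvz k)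
  obtain ⟨A, L, hA, hL⟩ : ∃ A L : ℝ, (∀ x, ‖gradient g x‖ ≤ A) ∧
      ∀ x y, ‖gradient g x - gradient g y‖ ≤ L * ‖x - y‖ := by
    have hcs : HasCompactSupport (gradient g) := by
      exact (hgt.2.fderiv ℝ).comp_left (g := (InnerProductSpace.toDual ℝ (Eu N)).symm) (map_zero _)
    obtain ⟨A, hA⟩ := hcs.exists_bound_of_continuous (contDiff_gradient hgt.1).continuous
    obtain ⟨L, hL⟩ := (contDiff_gradient hgt.1).lipschitzWith_of_hasCompactSupport hcs (by simp)
    exact ⟨A, L, hA, fun x y => by simpa [dist_eq_norm] using hL.dist_le_mul x y⟩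
  -- `M` dominates both the oscillation `2 * A` of the gradient and its Lipschitz constant.
  set M : ℝ := 2 * A + |L| with hM
  have hA0 : 0 ≤ A := (norm_nonneg _).trans (hA 0)
  have hM0 : 0 ≤ M := by positivity
  obtain ⟨C, hC, hnorm⟩ := besovNorm_le_of_lacunaryModulus hN0 hp hs1 hs2
  refine exists_sequence_of_bounded hN0 hp0 hvt hφ (C := C * 2 * M) (fun k => ?_) ?_
  · set ρ := r k with hρ
    have hρ0 : 0 < ρ := hrpos k
    have hgradv : ∀ x, gradient (v k) x = (c k * ρ) • gradient g (ρ • x) := by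
      intro x
      have h1 : fderiv ℝ (v k) x = (c k * ρ) • fderiv ℝ g (ρ • x) := by
        simp only [hv]
        rw [fderiv_const_mul ((hgr k).differentiable (by simp) x),
          fderiv_comp_smul_apply (hgt.1.differentiable (by simp)), smul_smul]
      rw [gradient, h1, map_smul, gradient]
    -- A single bump at scale `1/ρ` is treated as a lacunary sum with one term: `k = 1`, base
    -- frequency `ρ`, amplitude `c k * M * ρ ^ s`.
    have h1 := hnorm ρ⁻¹ (by positivity) ρ (hr1 k) 1 (fun _ => c k * M * ρ ^ s)
      (fun _ => by have := hcpos k; positivity) (v k) (hvt k) (hvz k) (fun x y => by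
        have hmod : lacunaryModulus (s - 1) ρ 1 (fun _ => c k * M * ρ ^ s) ‖x - y‖ =
            c k * ρ * (M * min 1 (ρ * ‖x - y‖)) := by
          simp only [lacunaryModulus, Finset.sum_range_one, pow_zero, one_mul]
          have : ρ ^ s * ρ ^ (-(s - 1)) = ρ := by
            rw [← Real.rpow_add hρ0]; simp
          linear_combination (c k * M * min 1 (ρ * ‖x - y‖)) * this
        rw [hmod, hgradv, hgradv, ← smul_sub, norm_smul,
          Real.norm_of_nonneg (mul_nonneg (hcpos k).le hρ0.le)]
        have := hcpos k
        gcongr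
        rcases le_total 1 (ρ * ‖x - y‖) with h | h
        · rw [min_eq_left h, mul_one]
          refine (norm_sub_le _ _).trans ?_
          have := abs_nonneg L
          linarith [hA (ρ • x), hA (ρ • y)]
        · rw [min_eq_right h]
          refine (hL _ _).trans ?_
          rw [← smul_sub, norm_smul, Real.norm_of_nonneg hρ0.le]
          gcongr
          linarith [le_abs_self L])
    refine h1.trans (ENNReal.ofReal_le_ofReal ?_)
    rw [Finset.sum_range_one, ← Real.rpow_mul (by have := hcpos k; positivity),
      mul_one_div_cancel hp0.ne', Real.rpow_one]
    have e : (ρ⁻¹) ^ (N / p) * (c k * M * ρ ^ s) = M := by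
      simp only [hc, ← hρ]
      rw [Real.inv_rpow hρ0.le, ← Real.rpow_neg hρ0.le]
      have : ρ ^ (-(N / p)) * (ρ ^ (N / p - s) * ρ ^ s) = 1 := by
        rw [← Real.rpow_add hρ0, ← Real.rpow_add hρ0]; simp
      linear_combination M * this
    rw [mul_assoc _ (ρ⁻¹ ^ (N / p)), e]
    have : ρ⁻¹ ≤ 1 := inv_le_one_of_one_le₀ (hr1 k)
    gcongr
    linarith
  · set I := ∫ y, (hessian g y).det * ((-1) ^ (N + 1) * ‖y‖ ^ 2) with hI
    have hIpos : 0 < I := integral_det_hessian_profile_pos hN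
    -- The power of `ρ` collects `N(N/p - s)` from the amplitudes, `2N` from the second derivatives,
    -- `-2` from the weight and `-N` from the change of variables.
    set e : ℝ := N * (N / p + 1 - 2 / (N : ℝ) - s) with he
    have hepos : 0 < e := mul_pos hNpos (by linarith)
    have hT : ∀ k, ∫ x, (hessian (v k) x).det * φ x = r k ^ e * I := by
      intro k
      set ρ := r k with hρ
      have hρ0 : 0 < ρ := hrpos k
      have h1 : ∀ x, (hessian (v k) x).det * φ x = (c k ^ N * ρ ^ (2 * N - 2 : ℝ)) *
          ((hessian g (ρ • x)).det * ((-1) ^ (N + 1) * ‖ρ • x‖ ^ 2)) := by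
        intro x
        have h2 : hessian (v k) x = (c k * ρ ^ 2) • hessian g (ρ • x) := by
          simp only [hv]
          rw [hessian_const_mul (hgr k), hessian_comp_smul hgt.1, smul_smul]
        rw [h2, Matrix.det_smul, Fintype.card_fin]
        by_cases hx : ρ • x ∈ Metric.closedBall (0 : Eu N) 1
        · have hx1 : ‖x‖ ≤ 1 := by
            rw [mem_closedBall_zero_iff, norm_smul, Real.norm_of_nonneg hρ0.le] at hx
            nlinarith [hr1 k, norm_nonneg x]
          rw [hφq x hx1, norm_smul, Real.norm_of_nonneg hρ0.le]
          have : ρ ^ (2 * N - 2 : ℝ) * ρ ^ 2 = (ρ ^ 2) ^ N := by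
            rw [← pow_mul, ← Real.rpow_natCast ρ 2, ← Real.rpow_natCast ρ (2 * N),
              ← Real.rpow_add hρ0]
            congr 1; push_cast; ring
          rw [mul_pow, mul_pow, ← this]
          ring
        · have : Nonempty (Fin N) := ⟨⟨0, hN0⟩⟩
          rw [hessian_eq_zero_of_notMem hgz hx, Matrix.det_zero]
          simp
      simp_rw [h1]
      rw [integral_const_mul, Measure.integral_comp_smul volume
        (fun y => (hessian g y).det * ((-1) ^ (N + 1) * ‖y‖ ^ 2)), ← hI,
        finrank_euclideanSpace_fin, abs_of_pos (by positivity), smul_eq_mul, ← mul_assoc]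
      congr 1
      simp only [hc, ← hρ]
      rw [← Real.rpow_natCast (ρ ^ _), ← Real.rpow_mul hρ0.le, ← Real.rpow_natCast ρ N,
        ← Real.rpow_neg hρ0.le, ← Real.rpow_add hρ0, ← Real.rpow_add hρ0]
      congr 1
      rw [he]; field_simp; ring
    simp_rw [hT]
    refine Tendsto.atTop_mul_const hIpos ((tendsto_rpow_atTop hepos).comp ?_)
    exact tendsto_atTop_add_const_right _ _ tendsto_natCast_atTop_atTop

/-! ### A bordered determinant -/

theorem det_diagonal_add_const {m : ℕ} {d : Fin m → ℝ} (hd : ∀ i, d i ≠ 0) (a : ℝ) :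
    (Matrix.diagonal d + Matrix.of fun _ _ => a).det =
      ∏ i, d i + a * ∑ i, ∏ j ∈ Finset.univ.erase i, d j := by
  have h1 : Matrix.diagonal d + Matrix.of (fun _ _ => a) = Matrix.diagonal d *
      (1 + Matrix.replicateCol Unit (fun i => a / d i) * Matrix.replicateRow Unit fun _ : Fin m => (1 : ℝ)) := by
    ext i j
    have := hd i
    rw [Matrix.diagonal_mul]
    by_cases h : i = j
    · subst h
      simp [Matrix.mul_apply]
      field_simp
    · simp [Matrix.mul_apply, h]
      field_simp
  rw [h1, Matrix.det_mul, Matrix.det_diagonal, Matrix.det_one_add_replicateCol_mul_replicateRow,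
    mul_add, mul_one]
  congr 1
  simp only [dotProduct, one_mul, Finset.mul_sum]
  refine Finset.sum_congr rfl fun i _ => ?_
  rw [← Finset.mul_prod_erase Finset.univ d (Finset.mem_univ i)]
  have := hd i
  field_simp

/-- The Hessian-type matrix with diagonal `d`, constant block `a`, border `b` and corner `c`. -/
def bordered {m : ℕ} (d : Fin m → ℝ) (a b c : ℝ) : Matrix (Fin m ⊕ Fin 1) (Fin m ⊕ Fin 1) ℝ :=
  Matrix.fromBlocks (Matrix.diagonal d + Matrix.of fun _ _ => a) (Matrix.of fun _ _ => b)
    (Matrix.of fun _ _ => b) (Matrix.of fun _ _ => c)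

/-- The Schur complement of the corner `c` is again a diagonal plus a constant matrix, with constant
`a - b ^ 2 / c`. -/
theorem det_bordered_of_ne_zero {m : ℕ} {d : Fin m → ℝ} (hd : ∀ i, d i ≠ 0) (a b : ℝ) {c : ℝ}
    (hc : c ≠ 0) : (bordered d a b c).det =
      c * ∏ i, d i + (c * a - b ^ 2) * ∑ i, ∏ j ∈ Finset.univ.erase i, d j := by
  have hinv : ∀ {t : ℝ}, t ≠ 0 → (Matrix.of fun _ _ => t : Matrix (Fin 1) (Fin 1) ℝ) *
      (Matrix.of fun _ _ => t⁻¹ : Matrix (Fin 1) (Fin 1) ℝ) = 1 := by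
    intro t ht
    ext i j
    have : i = j := Subsingleton.elim _ _
    subst this
    simp [Matrix.mul_apply, ht]
  let : Invertible (Matrix.of fun _ _ => c : Matrix (Fin 1) (Fin 1) ℝ) :=
    ⟨Matrix.of fun _ _ => c⁻¹, by simpa using hinv (inv_ne_zero hc), hinv hc⟩
  have h2 : ⅟(Matrix.of fun _ _ => c : Matrix (Fin 1) (Fin 1) ℝ) = Matrix.of fun _ _ => c⁻¹ := rfl
  rw [bordered, Matrix.det_fromBlocks₂₂, h2]
  have h3 : Matrix.diagonal d + Matrix.of (fun _ _ => a) -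
      (Matrix.of fun _ _ => b : Matrix (Fin m) (Fin 1) ℝ) *
        (Matrix.of fun _ _ => c⁻¹ : Matrix (Fin 1) (Fin 1) ℝ) *
        (Matrix.of fun _ _ => b : Matrix (Fin 1) (Fin m) ℝ) =
      Matrix.diagonal d + Matrix.of fun _ _ => (a - b ^ 2 / c) := by
    ext i j
    simp [Matrix.mul_apply]
    field_simp
    ring
  rw [h3, det_diagonal_add_const hd]
  simp only [Matrix.det_fin_one, Matrix.of_apply]
  field_simp

/-- Both sides are continuous in a shift of `d` and `c` by `ε`, and all shifted entries are nonzero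
for small `ε ≠ 0`; let `ε → 0`. -/
theorem det_bordered {m : ℕ} (d : Fin m → ℝ) (a b c : ℝ) : (bordered d a b c).det =
      c * ∏ i, d i + (c * a - b ^ 2) * ∑ i, ∏ j ∈ Finset.univ.erase i, d j := by
  have hcont : Continuous fun ε : ℝ => (bordered (fun i => d i + ε) a b (c + ε)).det := by
    refine Continuous.matrix_det ?_
    unfold bordered
    refine Continuous.matrix_fromBlocks ?_ ?_ ?_ ?_
    · refine Continuous.add (Continuous.matrix_diagonal (by fun_prop)) continuous_const
    · exact continuous_const
    · exact continuous_const
    · exact continuous_matrix fun _ _ => by simp only [Matrix.of_apply]; fun_prop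
  have hcont' : Continuous fun ε : ℝ => (c + ε) * ∏ i, (d i + ε) +
      ((c + ε) * a - b ^ 2) * ∑ i, ∏ j ∈ Finset.univ.erase i, (d j + ε) := by fun_prop
  have hne : ∀ t : ℝ, ∀ᶠ ε in 𝓝[≠] (0 : ℝ), t + ε ≠ 0 := by
    intro t
    by_cases ht : t = 0
    · subst ht
      filter_upwards [self_mem_nhdsWithin] with ε hε
      simpa using hε
    · refine nhdsWithin_le_nhds ?_
      exact (continuous_const.add continuous_id).continuousAt.eventually_ne (by simpa using ht)
  have hev : (fun ε : ℝ => (bordered (fun i => d i + ε) a b (c + ε)).det) =ᶠ[𝓝[≠] 0]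
      fun ε : ℝ => (c + ε) * ∏ i, (d i + ε) +
        ((c + ε) * a - b ^ 2) * ∑ i, ∏ j ∈ Finset.univ.erase i, (d j + ε) := by
    filter_upwards [eventually_all.2 fun i => hne (d i), hne c] with ε h1 h2
    exact det_bordered_of_ne_zero h1 a b h2
  have h1 := (hcont.tendsto 0).mono_left (nhdsWithin_le_nhds (s := {(0 : ℝ)}ᶜ))
  have h2 := (hcont'.tendsto 0).mono_left (nhdsWithin_le_nhds (s := {(0 : ℝ)}ᶜ))
  have := tendsto_nhds_unique (h1.congr' hev) h2
  simpa using this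

/-! ### The oscillating model function -/

/-- The sum of the first `m` coordinates. -/
def coordSum (m : ℕ) : Eu (m + 1) →L[ℝ] ℝ :=
  ∑ i : Fin m, (EuclideanSpace.proj i.castSucc : Eu (m + 1) →L[ℝ] ℝ)

theorem coordSum_apply {m : ℕ} (x : Eu (m + 1)) : coordSum m x = ∑ i : Fin m, x i.castSucc := by
  simp [coordSum, sum_apply]

/-- The function `∑ f(x_i) + x_last² f(∑ x_i) / 2`. -/
def model {m : ℕ} (f : ℝ → ℝ) (x : Eu (m + 1)) : ℝ :=
  ∑ i : Fin m, f (x i.castSucc) + 1 / 2 * x (Fin.last m) ^ 2 * f (coordSum m x)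

theorem hasFDerivAt_coord {m : ℕ} (i : Fin (m + 1)) (x : Eu (m + 1)) :
    HasFDerivAt (fun x : Eu (m + 1) => x i) (EuclideanSpace.proj i : Eu (m + 1) →L[ℝ] ℝ) x :=
  (EuclideanSpace.proj i : Eu (m + 1) →L[ℝ] ℝ).hasFDerivAt

theorem hasFDerivAt_comp_clm {m : ℕ} {f f' : ℝ → ℝ} (hf : ∀ t, HasDerivAt f (f' t) t)
    (L : Eu (m + 1) →L[ℝ] ℝ) (x : Eu (m + 1)) :
    HasFDerivAt (fun x => f (L x)) (f' (L x) • L) x :=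
  (hf (L x)).comp_hasFDerivAt x L.hasFDerivAt

theorem fderiv_model {m : ℕ} {f f₁ : ℝ → ℝ} (hf : ∀ t, HasDerivAt f (f₁ t) t)
    (x v : Eu (m + 1)) :
    fderiv ℝ (model f) x v = ∑ i : Fin m, f₁ (x i.castSucc) * v i.castSucc +
      (x (Fin.last m) * v (Fin.last m) * f (coordSum m x) +
        1 / 2 * x (Fin.last m) ^ 2 * f₁ (coordSum m x) * coordSum m v) := by
  have h1 : HasFDerivAt (fun x : Eu (m + 1) => ∑ i : Fin m, f (x i.castSucc)) _ x :=
    HasFDerivAt.fun_sum fun i _ => hasFDerivAt_comp_clm hf (EuclideanSpace.proj i.castSucc) x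
  have h2 := ((hasFDerivAt_coord (Fin.last m) x).pow 2).const_mul (1 / 2)
  have h3 := h1.add (h2.mul (hasFDerivAt_comp_clm hf (coordSum m) x))
  have h4 : fderiv ℝ (model f) x = _ := h3.fderiv
  rw [h4]
  simp [sum_apply]
  ring

theorem fderiv_fderiv_model {m : ℕ} {f f₁ f₂ : ℝ → ℝ} (hf : ∀ t, HasDerivAt f (f₁ t) t)
    (hf₁ : ∀ t, HasDerivAt f₁ (f₂ t) t) (x v w : Eu (m + 1)) :
    fderiv ℝ (fun y => fderiv ℝ (model f) y v) x w =
      ∑ i : Fin m, f₂ (x i.castSucc) * v i.castSucc * w i.castSucc +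
      (v (Fin.last m) * w (Fin.last m) * f (coordSum m x) +
        x (Fin.last m) * f₁ (coordSum m x) *
          (v (Fin.last m) * coordSum m w + w (Fin.last m) * coordSum m v) +
        1 / 2 * x (Fin.last m) ^ 2 * f₂ (coordSum m x) * coordSum m v * coordSum m w) := by
  simp_rw [fderiv_model hf]
  have h1 : HasFDerivAt (fun x : Eu (m + 1) =>
      ∑ i : Fin m, f₁ (x i.castSucc) * v i.castSucc) _ x :=
    HasFDerivAt.fun_sum fun i _ =>
      (hasFDerivAt_comp_clm hf₁ (EuclideanSpace.proj i.castSucc) x).mul_const (v i.castSucc)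
  have h2 := ((hasFDerivAt_coord (Fin.last m) x).mul_const (v (Fin.last m))).mul
    (hasFDerivAt_comp_clm hf (coordSum m) x)
  have h3 := ((((hasFDerivAt_coord (Fin.last m) x).pow 2).const_mul (1 / 2)).mul
    (hasFDerivAt_comp_clm hf₁ (coordSum m) x)).mul_const (coordSum m v)
  have h4 : fderiv ℝ (fun x : Eu (m + 1) => ∑ i : Fin m, f₁ (x i.castSucc) * v i.castSucc +
      (x (Fin.last m) * v (Fin.last m) * f (coordSum m x) +
        1 / 2 * x (Fin.last m) ^ 2 * f₁ (coordSum m x) * coordSum m v)) x = _ :=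
    (h1.add (h2.add h3)).fderiv
  rw [h4]
  simp [sum_apply]
  have : ∀ i : Fin m, v i.castSucc * (f₂ (x i.castSucc) * w i.castSucc) =
    f₂ (x i.castSucc) * v i.castSucc * w i.castSucc := fun i => by ring
  simp_rw [this]
  ring

/-- With the last coordinate as border, the Hessian is a `bordered` matrix whose corner is `f`,
while the constant block and the square of the border carry `x_last ^ 2`. Hence only the product
term is free of this factor. -/
theorem det_hessian_model {m : ℕ} {f f₁ f₂ : ℝ → ℝ} (hf : ∀ t, HasDerivAt f (f₁ t) t)
    (hf₁ : ∀ t, HasDerivAt f₁ (f₂ t) t) (x : Eu (m + 1)) :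
    (hessian (model f) x).det = f (coordSum m x) * ∏ i : Fin m, f₂ (x i.castSucc) +
      x (Fin.last m) ^ 2 *
        ((1 / 2 * f (coordSum m x) * f₂ (coordSum m x) - f₁ (coordSum m x) ^ 2) *
          ∑ i : Fin m, ∏ j ∈ Finset.univ.erase i, f₂ (x j.castSucc)) := by
  have h1 : (hessian (model f) x).submatrix finSumFinEquiv finSumFinEquiv =
      bordered (fun i : Fin m => f₂ (x i.castSucc))
        (1 / 2 * x (Fin.last m) ^ 2 * f₂ (coordSum m x))
        (x (Fin.last m) * f₁ (coordSum m x)) (f (coordSum m x)) := by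
    have hc : ∀ i : Fin m, finSumFinEquiv (m := m) (n := 1) (Sum.inl i) = i.castSucc := fun i => rfl
    have hl : ∀ i : Fin 1, finSumFinEquiv (m := m) (n := 1) (Sum.inr i) = Fin.last m := by
      intro i
      have : i = 0 := Subsingleton.elim _ _
      subst this; rfl
    have hsc : ∀ i : Fin m, coordSum m (EuclideanSpace.single i.castSucc 1) = 1 := by
      intro i; simp [coordSum_apply]
    have hsl : coordSum m (EuclideanSpace.single (Fin.last m) 1) = 0 := by
      simp [coordSum_apply]
    ext a b
    rcases a with i | i <;> rcases b with j | j
    · simp only [Matrix.submatrix_apply, hc, hessian, Matrix.of_apply,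
        fderiv_fderiv_model hf hf₁, hsc, bordered, Matrix.fromBlocks_apply₁₁, Matrix.add_apply,
        Matrix.diagonal_apply]
      by_cases h : i = j
      · subst h
        simp [(Fin.castSucc_ne_last _).symm]
      · simp [(Fin.castSucc_ne_last _).symm, h]
    · simp only [Matrix.submatrix_apply, hc, hl, hessian, Matrix.of_apply,
        fderiv_fderiv_model hf hf₁, hsc, hsl, bordered, Matrix.fromBlocks_apply₁₂]
      simp [(Fin.castSucc_ne_last _).symm]
    · simp only [Matrix.submatrix_apply, hc, hl, hessian, Matrix.of_apply,
        fderiv_fderiv_model hf hf₁, hsc, hsl, bordered, Matrix.fromBlocks_apply₂₁]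
      simp [(Fin.castSucc_ne_last _).symm]
    · simp only [Matrix.submatrix_apply, hl, hessian, Matrix.of_apply,
        fderiv_fderiv_model hf hf₁, hsl, bordered, Matrix.fromBlocks_apply₂₂]
      simp
  rw [← Matrix.det_submatrix_equiv_self finSumFinEquiv, h1, det_bordered]
  ring

/-! ### Cutoffs orthogonal to the oscillations -/

/-- A smooth cutoff whose integer translates by the period `2π` add up to a constant. -/
def periodCutoff (t : ℝ) : ℝ :=
  Real.smoothTransition t - Real.smoothTransition (t - 2 * Real.pi)

theorem contDiff_periodCutoff : ContDiff ℝ ∞ periodCutoff :=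
  contDiff_smoothTransition.sub (contDiff_smoothTransition.comp (contDiff_id.sub contDiff_const))

theorem periodCutoff_eq_zero {t : ℝ} (ht : t ∉ Set.Icc (0 : ℝ) (2 * Real.pi + 1)) :
    periodCutoff t = 0 := by
  have hpi := Real.pi_pos
  rw [Set.mem_Icc, not_and_or, not_le, not_le] at ht
  rcases ht with h | h
  · rw [periodCutoff, Real.smoothTransition.zero_of_nonpos h.le,
      Real.smoothTransition.zero_of_nonpos (by linarith), sub_self]
  · rw [periodCutoff, Real.smoothTransition.one_of_one_le (by linarith),
      Real.smoothTransition.one_of_one_le (by linarith), sub_self]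

theorem hasCompactSupport_periodCutoff : HasCompactSupport periodCutoff :=
  HasCompactSupport.intro isCompact_Icc fun _ => periodCutoff_eq_zero

theorem integral_periodCutoff_pos : 0 < ∫ t, periodCutoff t := by
  have hpi := Real.pi_gt_three
  refine contDiff_periodCutoff.continuous.integral_pos_of_hasCompactSupport_nonneg_nonzero
    hasCompactSupport_periodCutoff (fun t => ?_) (x := 1) ?_
  · exact sub_nonneg.2 (Real.smoothTransition.monotone (by linarith))
  · rw [periodCutoff, Real.smoothTransition.one_of_one_le le_rfl,
      Real.smoothTransition.zero_of_nonpos (by linarith)]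
    norm_num

theorem hasCompactSupport_deriv_smoothTransition :
    HasCompactSupport (deriv Real.smoothTransition) := by
  refine HasCompactSupport.intro (isCompact_Icc (a := (0 : ℝ)) (b := 1)) fun t ht => ?_
  rw [Set.mem_Icc, not_and_or, not_le, not_le] at ht
  rcases ht with h | h
  · have : Real.smoothTransition =ᶠ[𝓝 t] fun _ => 0 := by
      filter_upwards [gt_mem_nhds h] with x hx using Real.smoothTransition.zero_of_nonpos hx.le
    rw [this.deriv_eq, deriv_const]
  · exact deriv_smoothTransition_eq_zero h

/-- Integrate by parts. The derivative of the cutoff is a bump minus its translate by `2π`, and the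
exponential is `2π`-periodic, so the two integrals cancel. Orthogonality is therefore exact, with no
error terms to estimate. -/
theorem integral_periodCutoff_mul_cexp {n : ℤ} (hn : n ≠ 0) :
    ∫ t : ℝ, (periodCutoff t : ℂ) * Complex.exp (n * Complex.I * t) = 0 := by
  set D : ℝ → ℝ := deriv Real.smoothTransition with hD
  have hDc : Continuous D := contDiff_deriv_smoothTransition.continuous
  have hDs : HasCompactSupport D := hasCompactSupport_deriv_smoothTransition
  have hnI : (n : ℂ) * Complex.I ≠ 0 := mul_ne_zero (by exact_mod_cast hn) Complex.I_ne_zero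
  set E : ℝ → ℂ := fun t => Complex.exp (n * Complex.I * t) / (n * Complex.I) with hE
  have hEc : Continuous E := by fun_prop
  have hEd : ∀ t : ℝ, HasDerivAt E (Complex.exp (n * Complex.I * t)) t := by
    intro t
    have h1 : HasDerivAt (fun t : ℝ => (n : ℂ) * Complex.I * (t : ℂ)) ((n : ℂ) * Complex.I) t := by
      simpa using ((hasDerivAt_id t).ofReal_comp).const_mul ((n : ℂ) * Complex.I)
    refine (h1.cexp.div_const ((n : ℂ) * Complex.I)).congr_deriv ?_
    field_simp
  have hEp : ∀ t, E (t + 2 * Real.pi) = E t := by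
    intro t
    have h2 : Complex.exp ((n : ℂ) * Complex.I * ((t + 2 * Real.pi : ℝ) : ℂ)) =
        Complex.exp ((n : ℂ) * Complex.I * t) := by
      rw [Complex.exp_eq_exp_iff_exists_int]
      exact ⟨n, by push_cast; ring⟩
    simp only [hE, h2]
  have hSd : ∀ t, HasDerivAt periodCutoff (D t - D (t - 2 * Real.pi)) t := by
    intro t
    have h : ∀ x, HasDerivAt Real.smoothTransition (D x) x := fun x =>
      (contDiff_smoothTransition.differentiable (by simp) x).hasDerivAt
    exact (h t).sub ((h (t - 2 * Real.pi)).comp_sub_const t (2 * Real.pi))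
  have hcint : ∀ {g : ℝ → ℝ} {e : ℝ → ℂ}, Continuous g → HasCompactSupport g → Continuous e →
      Integrable fun t => (g t : ℂ) * e t := by
    intro g e hg hgs he
    refine Continuous.integrable_of_hasCompactSupport (by fun_prop) ?_
    refine HasCompactSupport.mul_right ?_
    exact hgs.comp_left (g := fun x : ℝ => (x : ℂ)) (by simp)
  have hDs' : HasCompactSupport fun t => D (t - 2 * Real.pi) :=
    hDs.comp_homeomorph (Homeomorph.subRight (2 * Real.pi))
  have hi1 := hcint hDc hDs hEc
  have hi2 : Integrable fun t => (D (t - 2 * Real.pi) : ℂ) * E t :=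
    hcint (g := fun t => D (t - 2 * Real.pi)) (by fun_prop) hDs' hEc
  have hpc := contDiff_periodCutoff.continuous
  have key := integral_mul_deriv_eq_deriv_mul_of_integrable
    (u := fun t => (periodCutoff t : ℂ)) (v := E)
    (u' := fun t => ((D t - D (t - 2 * Real.pi) : ℝ) : ℂ))
    (v' := fun t => Complex.exp (n * Complex.I * t))
    (fun t _ => (hSd t).ofReal_comp) (fun t _ => hEd t)
    (hcint hpc hasCompactSupport_periodCutoff (by fun_prop))
    (by
      refine (hi1.sub hi2).congr (ae_of_all _ fun t => ?_)
      simp [sub_mul])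
    (hcint hpc hasCompactSupport_periodCutoff hEc)
  rw [key, neg_eq_zero]
  have h3 : ∀ t, (((D t - D (t - 2 * Real.pi) : ℝ) : ℂ)) * E t =
      (D t : ℂ) * E t - (D (t - 2 * Real.pi) : ℂ) * E t := fun t => by push_cast; ring
  simp_rw [h3]
  rw [integral_sub hi1 hi2, sub_eq_zero,
    ← integral_add_right_eq_self (fun t => (D (t - 2 * Real.pi) : ℂ) * E t) (2 * Real.pi)]
  simp only [add_sub_cancel_right, hEp]

/-- There is a cutoff on the line with positive mean and vanishing second moment. -/
theorem exists_cutoff_moment : ∃ ψ : ℝ → ℝ, ContDiff ℝ ∞ ψ ∧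
    (∀ t, t ∉ Set.Icc (-4 : ℝ) 4 → ψ t = 0) ∧ 0 < ∫ t, ψ t ∧ ∫ t, t ^ 2 * ψ t = 0 := by
  let b : ContDiffBump (0 : ℝ) := ⟨1, 2, by norm_num, by norm_num⟩
  have hb : ContDiff ℝ ∞ b := b.contDiff
  have hbz : ∀ t : ℝ, 2 ≤ |t| → b t = 0 := fun t ht => b.zero_of_le_dist (by simpa using ht)
  have hbi : Integrable b := b.continuous.integrable_of_hasCompactSupport b.hasCompactSupport
  have hb2 : Integrable fun t => t ^ 2 * b t :=
    Continuous.integrable_of_hasCompactSupport (by have := b.continuous; fun_prop)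
      (b.hasCompactSupport.mul_left)
  have hbpos : 0 < ∫ t, b t :=
    b.continuous.integral_pos_of_hasCompactSupport_nonneg_nonzero b.hasCompactSupport
      (fun t => b.nonneg) (x := 0) (by
        rw [b.one_of_mem_closedBall (by simp [b.rIn_pos.le])]; exact one_ne_zero)
  have hh : (2 : ℝ) ≠ 0 := two_ne_zero
  -- Dilation by `2` multiplies the second moment by `8` and the mean by `2`: the former cancels,
  -- and three quarters of the latter survive.
  refine ⟨fun t => b t - 1 / 8 * b (t / 2), ?_, ?_, ?_, ?_⟩
  · exact hb.sub (contDiff_const.mul (hb.comp (contDiff_id.div_const 2)))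
  · intro t ht
    have : 4 < |t| := by
      by_contra hcon
      exact ht (abs_le.1 (not_lt.1 hcon))
    have h2 : 2 ≤ |t / 2| := by rw [abs_div, abs_two]; linarith
    simp only [hbz t (by linarith), hbz _ h2]; ring
  · rw [integral_sub hbi ((hbi.comp_div hh).const_mul _), integral_const_mul,
      Measure.integral_comp_div (fun t => b t) 2]
    simp only [abs_two, smul_eq_mul]
    linarith
  · have h1 : ∀ t : ℝ, t ^ 2 * (b t - 1 / 8 * b (t / 2)) =
        t ^ 2 * b t - 1 / 2 * ((t / 2) ^ 2 * b (t / 2)) := fun t => by ring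
    simp_rw [h1]
    rw [integral_sub hb2 ((hb2.comp_div hh).const_mul _), integral_const_mul,
      Measure.integral_comp_div (fun t => t ^ 2 * b t) 2]
    simp only [abs_two, smul_eq_mul]
    ring

/-! ### Lacunary cosine sums -/

/-- The lacunary sum `∑ c_l cos (2^l t)`. -/
def lacunary (k : ℕ) (c : ℕ → ℝ) (t : ℝ) : ℝ := ∑ l ∈ Finset.range k, c l * Real.cos (2 ^ l * t)

/-- The derivative of `lacunary`. -/
def lacunaryDeriv (k : ℕ) (c : ℕ → ℝ) (t : ℝ) : ℝ :=
  -∑ l ∈ Finset.range k, c l * 2 ^ l * Real.sin (2 ^ l * t)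

theorem hasDerivAt_lacunary (k : ℕ) (c : ℕ → ℝ) (t : ℝ) :
    HasDerivAt (lacunary k c) (lacunaryDeriv k c t) t := by
  have h := HasDerivAt.fun_sum (u := Finset.range k) fun l _ =>
    (((hasDerivAt_id t).const_mul ((2 : ℝ) ^ l)).cos).const_mul (c l)
  refine h.congr_deriv ?_
  rw [lacunaryDeriv, ← Finset.sum_neg_distrib]
  exact Finset.sum_congr rfl fun l _ => by simp; ring

theorem hasDerivAt_lacunaryDeriv (k : ℕ) (c : ℕ → ℝ) (t : ℝ) :
    HasDerivAt (lacunaryDeriv k c) (-lacunary k (fun l => c l * 4 ^ l) t) t := by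
  have h := (HasDerivAt.fun_sum (u := Finset.range k) fun l _ =>
    (((hasDerivAt_id t).const_mul ((2 : ℝ) ^ l)).sin).const_mul (c l * 2 ^ l)).neg
  refine h.congr_deriv ?_
  rw [lacunary]
  congr 1
  refine Finset.sum_congr rfl fun l _ => ?_
  have : (4 : ℝ) ^ l = 2 ^ l * 2 ^ l := by rw [← mul_pow]; norm_num
  rw [this]; simp; ring

theorem contDiff_lacunary (k : ℕ) (c : ℕ → ℝ) : ContDiff ℝ ∞ (lacunary k c) := by
  unfold lacunary
  exact ContDiff.sum fun l _ => contDiff_const.mul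
    (Real.contDiff_cos.comp (contDiff_const.mul contDiff_id))

theorem continuous_lacunaryDeriv (k : ℕ) (c : ℕ → ℝ) : Continuous (lacunaryDeriv k c) := by
  unfold lacunaryDeriv; fun_prop

/-- Among the frequencies `2 ^ l ± 2 ^ j` only `2 ^ l - 2 ^ l` vanishes; the factor `1/2` is the
weight of one exponential in the cosine. -/
theorem integral_lacunary_mul_cexp {k : ℕ} (c : ℕ → ℝ) {l : ℕ} (hl : l < k) :
    ∫ t : ℝ, ((lacunary k c t * periodCutoff t : ℝ) : ℂ) *
      Complex.exp (((2 ^ l : ℤ) : ℂ) * Complex.I * t) =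
      ((c l / 2 * ∫ t, periodCutoff t : ℝ) : ℂ) := by
  have hpc := contDiff_periodCutoff.continuous
  have hcint : ∀ n : ℤ, Integrable fun t : ℝ =>
      (periodCutoff t : ℂ) * Complex.exp (n * Complex.I * t) := by
    intro n
    refine Continuous.integrable_of_hasCompactSupport (by fun_prop) ?_
    refine HasCompactSupport.mul_right ?_
    exact hasCompactSupport_periodCutoff.comp_left (g := fun x : ℝ => (x : ℂ)) (by simp)
  have h1 : ∀ t : ℝ, ((lacunary k c t * periodCutoff t : ℝ) : ℂ) *
      Complex.exp (((2 ^ l : ℤ) : ℂ) * Complex.I * t) =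
      ∑ j ∈ Finset.range k, (c j / 2 : ℂ) *
        ((periodCutoff t : ℂ) * Complex.exp (((2 ^ l + 2 ^ j : ℤ) : ℂ) * Complex.I * t) +
        (periodCutoff t : ℂ) * Complex.exp (((2 ^ l - 2 ^ j : ℤ) : ℂ) * Complex.I * t)) := by
    intro t
    rw [lacunary]
    push_cast
    rw [Finset.sum_mul, Finset.sum_mul]
    refine Finset.sum_congr rfl fun j _ => ?_
    have e1 : Complex.exp (((2 : ℂ) ^ l + 2 ^ j) * Complex.I * t) =
        Complex.exp ((2 : ℂ) ^ l * Complex.I * t) * Complex.exp (((2 : ℂ) ^ j * t) * Complex.I) := by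
      rw [← Complex.exp_add]; congr 1; ring
    have e2 : Complex.exp (((2 : ℂ) ^ l - 2 ^ j) * Complex.I * t) =
        Complex.exp ((2 : ℂ) ^ l * Complex.I * t) *
          Complex.exp (-((2 : ℂ) ^ j * t) * Complex.I) := by
      rw [← Complex.exp_add]; congr 1; ring
    rw [e1, e2, Complex.cos]
    ring
  simp_rw [h1]
  rw [integral_finsetSum _ fun j _ =>
    ((hcint (2 ^ l + 2 ^ j)).fun_add (hcint (2 ^ l - 2 ^ j))).const_mul _]
  have h2 : ∀ j, ∫ t : ℝ, (c j / 2 : ℂ) *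
        ((periodCutoff t : ℂ) * Complex.exp (((2 ^ l + 2 ^ j : ℤ) : ℂ) * Complex.I * t) +
        (periodCutoff t : ℂ) * Complex.exp (((2 ^ l - 2 ^ j : ℤ) : ℂ) * Complex.I * t)) =
      if j = l then ((c l / 2 * ∫ t, periodCutoff t : ℝ) : ℂ) else 0 := by
    intro j
    rw [integral_const_mul, integral_add (hcint _) (hcint _),
      integral_periodCutoff_mul_cexp (by positivity), zero_add]
    split_ifs with h
    · subst h
      simp only [sub_self, Int.cast_zero, zero_mul, Complex.exp_zero, mul_one]
      rw [integral_complex_ofReal]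
      push_cast; ring
    · rw [integral_periodCutoff_mul_cexp, mul_zero]
      rw [sub_ne_zero]
      intro h3
      exact h (Nat.pow_right_injective le_rfl (by exact_mod_cast h3.symm))
  simp_rw [h2]
  simp [hl]

/-- Write `cos (2 ^ l ∑ y_i)` as the real part of `∏ exp (i 2 ^ l y_i)`. The integral factorises,
and every factor selects the same frequency `2 ^ l`, so no cross terms appear. -/
theorem integral_lacunary_sum_mul_prod (m k : ℕ) (c d : ℕ → ℝ) :
    ∫ y : Fin m → ℝ, lacunary k c (∑ i, y i) * ∏ i, (lacunary k d (y i) * periodCutoff (y i)) =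
      ∑ l ∈ Finset.range k, c l * (d l / 2 * ∫ t, periodCutoff t) ^ m := by
  have hpc := contDiff_periodCutoff.continuous
  have hdc := (contDiff_lacunary k d).continuous
  set G : ℕ → (Fin m → ℝ) → ℂ := fun l y =>
    ∏ i, (((lacunary k d (y i) * periodCutoff (y i) : ℝ) : ℂ) *
      Complex.exp (((2 ^ l : ℤ) : ℂ) * Complex.I * y i)) with hG
  have hGi : ∀ l, Integrable (G l) := by
    intro l
    have hcs : HasCompactSupport fun t => lacunary k d t * periodCutoff t :=
      hasCompactSupport_periodCutoff.mul_left
    have hcs' : HasCompactSupport fun t => ((lacunary k d t * periodCutoff t : ℝ) : ℂ) :=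
      hcs.comp_left (g := fun x : ℝ => (x : ℂ)) Complex.ofReal_zero
    have hi : Integrable fun t : ℝ => ((lacunary k d t * periodCutoff t : ℝ) : ℂ) *
        Complex.exp (((2 ^ l : ℤ) : ℂ) * Complex.I * t) :=
      Continuous.integrable_of_hasCompactSupport (by fun_prop) hcs'.mul_right
    exact Integrable.fintype_prod fun _ => hi
  have h1 : ∀ y : Fin m → ℝ, lacunary k c (∑ i, y i) *
      ∏ i, (lacunary k d (y i) * periodCutoff (y i)) =
      ∑ l ∈ Finset.range k, c l * (G l y).re := by
    intro y
    rw [lacunary, Finset.sum_mul]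
    refine Finset.sum_congr rfl fun l _ => ?_
    rw [mul_assoc]
    congr 1
    have : G l y = ((∏ i, (lacunary k d (y i) * periodCutoff (y i)) : ℝ) : ℂ) *
        Complex.exp (((2 ^ l * ∑ i, y i : ℝ) : ℂ) * Complex.I) := by
      simp only [hG]
      rw [Finset.prod_mul_distrib, ← Complex.exp_sum, Complex.ofReal_prod]
      congr 2
      push_cast
      rw [Finset.mul_sum, Finset.sum_mul]
      exact Finset.sum_congr rfl fun i _ => by ring
    rw [this, Complex.re_ofReal_mul, Complex.exp_ofReal_mul_I_re, mul_comm]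
  simp_rw [h1]
  have hGr : ∀ l, Integrable fun y => (G l y).re := fun l => (hGi l).re
  rw [integral_finsetSum _ fun l _ => (hGr l).const_mul _]
  refine Finset.sum_congr rfl fun l hl => ?_
  rw [integral_const_mul]
  congr 1
  have h2 : ∫ y, (G l y).re = (∫ y, G l y).re := by
    simpa using integral_re (𝕜 := ℂ) (hGi l)
  rw [h2]
  have h3 : ∫ y, G l y = ((d l / 2 * ∫ t, periodCutoff t : ℝ) : ℂ) ^ m := by
    simp only [hG]
    rw [integral_fintype_prod_volume_eq_prod (fun (_ : Fin m) (t : ℝ) =>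
      ((lacunary k d t * periodCutoff t : ℝ) : ℂ) *
        Complex.exp (((2 ^ l : ℤ) : ℂ) * Complex.I * t))]
    rw [Finset.prod_const, integral_lacunary_mul_cexp d (Finset.mem_range.1 hl)]
    simp
  rw [h3, ← Complex.ofReal_pow, Complex.ofReal_re]

/-! ### The distributional Hessian determinant of the model function -/

theorem integral_eq_integral_prod {m : ℕ} (F : ℝ → (Fin m → ℝ) → ℝ) :
    ∫ x : Eu (m + 1), F (x (Fin.last m)) (fun i => x i.castSucc) =
      ∫ z : ℝ × (Fin m → ℝ), F z.1 z.2 := by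
  rw [← (PiLp.volume_preserving_toLp (Fin (m + 1))).integral_comp
    (MeasurableEquiv.toLp 2 (Fin (m + 1) → ℝ)).measurableEmbedding,
    ← (volume_preserving_piFinSuccAbove (fun _ : Fin (m + 1) => ℝ) (Fin.last m)).integral_comp
      (MeasurableEquiv.measurableEmbedding _)]
  congr 1
  ext x
  simp [MeasurableEquiv.piFinSuccAbove, Fin.insertNthEquiv]
  rfl

/-- The weight against which the Hessian determinant of the model function is tested. -/
def weight (m : ℕ) (ψ : ℝ → ℝ) (x : Eu (m + 1)) : ℝ :=
  (-1) ^ m * (ψ (x (Fin.last m)) * ∏ i : Fin m, periodCutoff (x i.castSucc))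

theorem weight_eq_zero {m : ℕ} {ψ : ℝ → ℝ} (hψ : ∀ t, t ∉ Set.Icc (-4 : ℝ) 4 → ψ t = 0)
    {x : Eu (m + 1)} (hx : x ∉ Metric.closedBall (0 : Eu (m + 1)) (8 * (m + 1))) :
    weight m ψ x = 0 := by
  by_contra hne
  refine hx ?_
  have hpi := Real.pi_lt_d2
  have h1 : ψ (x (Fin.last m)) ≠ 0 := fun h => hne (by simp [weight, h])
  have h2 : ∀ i : Fin m, periodCutoff (x i.castSucc) ≠ 0 := fun i h => hne (by
    rw [weight, Finset.prod_eq_zero (Finset.mem_univ i) h]; simp)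
  -- Both `4` and `2π + 1` are below `8`, which explains the crude radius `8 * (m + 1)`.
  have h3 : ∀ i, ‖x i‖ ^ 2 ≤ 64 := by
    intro i
    have : |x i| ≤ 8 := by
      refine Fin.lastCases ?_ (fun i => ?_) i
      · have := not_imp_comm.1 (hψ _) h1
        exact abs_le.2 ⟨by linarith [this.1], by linarith [this.2]⟩
      · have := not_imp_comm.1 periodCutoff_eq_zero (h2 i)
        exact abs_le.2 ⟨by linarith [this.1], by linarith [this.2]⟩
    rw [Real.norm_eq_abs]
    nlinarith [abs_nonneg (x i)]
  rw [mem_closedBall_zero_iff, EuclideanSpace.norm_eq, Real.sqrt_le_left (by positivity)]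
  calc ∑ i, ‖x i‖ ^ 2 ≤ ∑ _i : Fin (m + 1), (64 : ℝ) := Finset.sum_le_sum fun i _ => h3 i
    _ = 64 * ((m : ℝ) + 1) := by simp; ring
    _ ≤ (8 * ((m : ℝ) + 1)) ^ 2 := by nlinarith [Nat.cast_nonneg (α := ℝ) m]

theorem contDiff_coord {m : ℕ} (i : Fin (m + 1)) : ContDiff ℝ ∞ fun x : Eu (m + 1) => x i :=
  (EuclideanSpace.proj i : Eu (m + 1) →L[ℝ] ℝ).contDiff

theorem isTest_weight {m : ℕ} {ψ : ℝ → ℝ} (hψc : ContDiff ℝ ∞ ψ)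
    (hψ : ∀ t, t ∉ Set.Icc (-4 : ℝ) 4 → ψ t = 0) : IsTest (weight m ψ) :=
  isTest_of_eq_zero (contDiff_const.mul ((hψc.comp (contDiff_coord _)).mul
    (contDiff_prod fun _ _ => contDiff_periodCutoff.comp (contDiff_coord _))))
    fun _ => weight_eq_zero hψ

theorem integrable_mul_prod_periodCutoff {m : ℕ} {G : (Fin m → ℝ) → ℝ} (hG : Continuous G) :
    Integrable fun y : Fin m → ℝ => G y * ∏ i, periodCutoff (y i) := by
  have hpc := contDiff_periodCutoff.continuous
  refine Continuous.integrable_of_hasCompactSupport (by fun_prop) ?_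
  refine HasCompactSupport.intro (isCompact_univ_pi fun _ : Fin m =>
    isCompact_Icc (a := (0 : ℝ)) (b := 2 * Real.pi + 1)) fun y hy => ?_
  simp only [Set.mem_pi, Set.mem_univ, true_implies, not_forall] at hy
  obtain ⟨i, hi⟩ := hy
  rw [Finset.prod_eq_zero (Finset.mem_univ i) (periodCutoff_eq_zero hi), mul_zero]

/-- The integrand splits into two products of a function of the last coordinate and one of the
others; the second vanishes by `hψ2`. The sign `(-1) ^ m` in the weight cancels the signs of the `m`
second derivatives. -/
theorem integral_det_hessian_model {m : ℕ} {ψ : ℝ → ℝ} (hψc : ContDiff ℝ ∞ ψ)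
    (hψ : ∀ t, t ∉ Set.Icc (-4 : ℝ) 4 → ψ t = 0) (hψ2 : ∫ t, t ^ 2 * ψ t = 0)
    (k : ℕ) (c : ℕ → ℝ) :
    ∫ x : Eu (m + 1), (hessian (model (lacunary k c)) x).det * weight m ψ x =
      (∫ t, ψ t) * ∑ l ∈ Finset.range k, c l * (c l * 4 ^ l / 2 * ∫ t, periodCutoff t) ^ m := by
  set d : ℕ → ℝ := fun l => c l * 4 ^ l with hd
  set P : (Fin m → ℝ) → ℝ := fun y =>
    lacunary k c (∑ i, y i) * ∏ i, (lacunary k d (y i) * periodCutoff (y i)) with hP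
  set Q₀ : (Fin m → ℝ) → ℝ := fun y => (-1) ^ m *
    ((1 / 2 * lacunary k c (∑ i, y i) * -lacunary k d (∑ i, y i) -
      lacunaryDeriv k c (∑ i, y i) ^ 2) *
        ∑ i : Fin m, ∏ j ∈ Finset.univ.erase i, -lacunary k d (y j)) with hQ₀
  have hcc := (contDiff_lacunary k c).continuous
  have hdc := (contDiff_lacunary k d).continuous
  have hcd := continuous_lacunaryDeriv k c
  have hPi : Integrable P := by
    have := integrable_mul_prod_periodCutoff (m := m)
      (G := fun y => lacunary k c (∑ i, y i) * ∏ i, lacunary k d (y i)) (by fun_prop)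
    refine this.congr (ae_of_all _ fun y => ?_)
    simp only [hP, Finset.prod_mul_distrib, mul_assoc]
  have hQi := integrable_mul_prod_periodCutoff (m := m) (G := Q₀) (by fun_prop)
  have hψs : HasCompactSupport ψ := HasCompactSupport.intro isCompact_Icc hψ
  have hψcont := hψc.continuous
  have hψi : Integrable ψ := hψcont.integrable_of_hasCompactSupport hψs
  have hψ2i : Integrable fun t => t ^ 2 * ψ t :=
    Continuous.integrable_of_hasCompactSupport (by fun_prop) hψs.mul_left
  have h1 : ∀ x : Eu (m + 1), (hessian (model (lacunary k c)) x).det * weight m ψ x =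
      ψ (x (Fin.last m)) * P (fun i => x i.castSucc) + x (Fin.last m) ^ 2 * ψ (x (Fin.last m)) *
        (Q₀ (fun i => x i.castSucc) * ∏ i : Fin m, periodCutoff (x i.castSucc)) := by
    intro x
    rw [det_hessian_model (hasDerivAt_lacunary k c) (hasDerivAt_lacunaryDeriv k c), coordSum_apply]
    simp only [hP, hQ₀, weight, Finset.prod_neg, Finset.prod_mul_distrib, Finset.card_univ,
      Fintype.card_fin]
    have hsq : ((-1 : ℝ) ^ m) * (-1) ^ m = 1 := by rw [← mul_pow]; norm_num
    linear_combination (lacunary k c (∑ i : Fin m, x i.castSucc) *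
      (∏ i : Fin m, lacunary k d (x i.castSucc)) * ψ (x (Fin.last m)) *
      ∏ i : Fin m, periodCutoff (x i.castSucc)) * hsq
  simp_rw [h1]
  rw [integral_eq_integral_prod (fun t y => ψ t * P y + t ^ 2 * ψ t *
    (Q₀ y * ∏ i : Fin m, periodCutoff (y i))), Measure.volume_eq_prod,
    integral_add (hψi.mul_prod hPi) (hψ2i.mul_prod hQi), integral_prod_mul,
    integral_prod_mul (fun t => t ^ 2 * ψ t) (fun y => Q₀ y * ∏ i : Fin m, periodCutoff (y i)),
    hψ2, zero_mul, add_zero]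
  congr 1
  exact integral_lacunary_sum_mul_prod m k c d

/-! ### Moduli of continuity of the oscillating functions -/

theorem hasFDerivAt_mul_cos {m : ℕ} {χ : Eu (m + 1) → ℝ} (hχ : Differentiable ℝ χ)
    (L : Eu (m + 1) →L[ℝ] ℝ) (n : ℝ) (x : Eu (m + 1)) :
    HasFDerivAt (fun x => χ x * Real.cos (n * L x))
      (Real.cos (n * L x) • fderiv ℝ χ x - (n * (χ x * Real.sin (n * L x))) • L) x := by
  have h1 : HasFDerivAt (fun x => n * L x) (n • L) x := L.hasFDerivAt.const_mul n
  have h2 := (hχ x).hasFDerivAt.mul h1.cos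
  refine h2.congr_fderiv ?_
  ext v
  simp
  ring

theorem norm_mul_sub_mul_le {G : Type*} [NormedAddCommGroup G] [NormedSpace ℝ G] {e e' A B t D : ℝ}
    {g g' : G} (he' : |e'| ≤ 1) (hg : ‖g‖ ≤ A) (hee : |e - e'| ≤ D * t) (hgg : ‖g - g'‖ ≤ B * t)
    (hDt : 0 ≤ D * t) :
    ‖e • g - e' • g'‖ ≤ (D * A + B) * t := by
  have h : e • g - e' • g' = (e - e') • g + e' • (g - g') := by module
  have hA := (norm_nonneg g).trans hg
  calc ‖e • g - e' • g'‖ ≤ |e - e'| * ‖g‖ + |e'| * ‖g - g'‖ := by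
        rw [h]
        refine (norm_add_le _ _).trans ?_
        rw [norm_smul, norm_smul, Real.norm_eq_abs, Real.norm_eq_abs]
    _ ≤ D * t * A + 1 * (B * t) := by gcongr
    _ = _ := by ring

/-- For `n ≥ 1` the gradient has size `O(n)` and Lipschitz constant `O(n ^ 2)`, with constants
independent of `n`; the minimum combines the two bounds. -/
theorem exists_modulus_mul_cos {m : ℕ} {χ : Eu (m + 1) → ℝ} (hχ : IsTest χ)
    (L : Eu (m + 1) →L[ℝ] ℝ) : ∃ M : ℝ, 0 ≤ M ∧ ∀ n : ℝ, 1 ≤ n → ∀ x y : Eu (m + 1),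
      ‖fderiv ℝ (fun x => χ x * Real.cos (n * L x)) x -
        fderiv ℝ (fun x => χ x * Real.cos (n * L x)) y‖ ≤ M * (n * min 1 (n * ‖x - y‖)) := by
  have hfc : ContDiff ℝ ∞ (fderiv ℝ χ) := hχ.1.fderiv_right (m := ∞) (by norm_num)
  have hfs : HasCompactSupport (fderiv ℝ χ) := hχ.2.fderiv ℝ
  obtain ⟨A₀, hA₀⟩ := hχ.2.exists_bound_of_continuous hχ.1.continuous
  obtain ⟨B₀, hB₀⟩ := hχ.1.lipschitzWith_of_hasCompactSupport hχ.2 (by simp)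
  obtain ⟨A₁, hA₁⟩ := hfs.exists_bound_of_continuous hfc.continuous
  obtain ⟨B₁, hB₁⟩ := hfc.lipschitzWith_of_hasCompactSupport hfs (by simp)
  have hA₀0 : 0 ≤ A₀ := (norm_nonneg _).trans (hA₀ 0)
  have hA₁0 : 0 ≤ A₁ := (norm_nonneg _).trans (hA₁ 0)
  have hB₀0 : (0 : ℝ) ≤ B₀ := B₀.2
  have hB₁0 : (0 : ℝ) ≤ B₁ := B₁.2
  set K := ‖L‖ with hK
  have hK0 : 0 ≤ K := norm_nonneg L
  -- The first summand serves distances `‖x - y‖ ≥ 1/n`, the remaining ones shorter distances.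
  refine ⟨2 * (A₁ + A₀ * K) + ((K * A₁ + B₁) + (K * A₀ + B₀) * K), by positivity,
    fun n hn x y => ?_⟩
  have hn0 : 0 ≤ n := by linarith
  set t := ‖x - y‖ with ht
  have ht0 : 0 ≤ t := norm_nonneg _
  rw [(hasFDerivAt_mul_cos (hχ.1.differentiable (by simp)) L n x).fderiv,
    (hasFDerivAt_mul_cos (hχ.1.differentiable (by simp)) L n y).fderiv]
  have hL : |n * L x - n * L y| ≤ n * K * t := by
    rw [← mul_sub, ← map_sub, abs_mul, abs_of_nonneg hn0, mul_assoc]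
    exact mul_le_mul_of_nonneg_left (L.le_opNorm _) hn0
  have hcos : |Real.cos (n * L x) - Real.cos (n * L y)| ≤ n * K * t :=
    (Real.abs_cos_sub_cos_le _ _).trans hL
  have hsin : |Real.sin (n * L x) - Real.sin (n * L y)| ≤ n * K * t :=
    (Real.abs_sin_sub_sin_le _ _).trans hL
  have hsize : ∀ z, ‖Real.cos (n * L z) • fderiv ℝ χ z -
      (n * (χ z * Real.sin (n * L z))) • L‖ ≤ n * (A₁ + A₀ * K) := by
    intro z
    calc _ ≤ ‖Real.cos (n * L z) • fderiv ℝ χ z‖ + ‖(n * (χ z * Real.sin (n * L z))) • L‖ :=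
          norm_sub_le _ _
      _ = |Real.cos (n * L z)| * ‖fderiv ℝ χ z‖ + n * (‖χ z‖ * |Real.sin (n * L z)|) * K := by
          rw [norm_smul, norm_smul, norm_mul, norm_mul, Real.norm_eq_abs n, abs_of_nonneg hn0,
            Real.norm_eq_abs, Real.norm_eq_abs (Real.sin _)]
      _ ≤ 1 * A₁ + n * (A₀ * 1) * K := by
          gcongr
          · exact Real.abs_cos_le_one _
          · exact hA₁ z
          · exact hA₀ z
          · exact Real.abs_sin_le_one _
      _ ≤ n * (A₁ + A₀ * K) := by nlinarith
  rcases le_total 1 (n * t) with h | h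
  · rw [min_eq_left h]
    refine (norm_sub_le _ _).trans ?_
    have h1 := hsize x
    have h2 := hsize y
    have h3 : 0 ≤ ((K * A₁ + B₁) + (K * A₀ + B₀) * K) * n := by positivity
    linarith
  · rw [min_eq_right h]
    have h1 := norm_mul_sub_mul_le (Real.abs_cos_le_one (n * L y)) (hA₁ x) hcos
      (by simpa [dist_eq_norm] using hB₁.dist_le_mul x y) (by positivity)
    have h2 := norm_mul_sub_mul_le (Real.abs_sin_le_one (n * L y)) (hA₀ x) hsin
      (by simpa [dist_eq_norm] using hB₀.dist_le_mul x y) (by positivity)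
    have h3 : ‖(n * (χ x * Real.sin (n * L x))) • L - (n * (χ y * Real.sin (n * L y))) • L‖ ≤
        n * ((n * K * A₀ + B₀) * t) * K := by
      have e : (n * (χ x * Real.sin (n * L x))) • L - (n * (χ y * Real.sin (n * L y))) • L =
          (n * (χ x * Real.sin (n * L x) - χ y * Real.sin (n * L y))) • L := by
        ext v; simp; ring
      rw [e, norm_smul, norm_mul, Real.norm_eq_abs n, abs_of_nonneg hn0]
      gcongr
      simpa [mul_comm] using h2
    calc _ ≤ ‖Real.cos (n * L x) • fderiv ℝ χ x - Real.cos (n * L y) • fderiv ℝ χ y‖ +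
          ‖(n * (χ x * Real.sin (n * L x))) • L - (n * (χ y * Real.sin (n * L y))) • L‖ := by
          rw [sub_sub_sub_comm]
          exact norm_sub_le _ _
      _ ≤ (n * K * A₁ + B₁) * t + n * ((n * K * A₀ + B₀) * t) * K := add_le_add h1 h3
      _ ≤ (n * n * (K * A₁ + B₁)) * t + n * (n * (K * A₀ + B₀) * t) * K := by
          have hnn : n ≤ n * n := by nlinarith
          have e1 : n * K * A₁ + B₁ ≤ n * n * (K * A₁ + B₁) := by
            have : n * (K * A₁) ≤ n * n * (K * A₁) := by gcongr
            have : 1 * (B₁ : ℝ) ≤ n * n * B₁ := by gcongr; nlinarith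
            nlinarith
          have e2 : n * K * A₀ + B₀ ≤ n * (K * A₀ + B₀) := by nlinarith
          gcongr
      _ ≤ _ := by
          have : 0 ≤ 2 * (A₁ + A₀ * K) * (n * (n * t)) := by positivity
          nlinarith

theorem contDiff_model {m : ℕ} {f : ℝ → ℝ} (hf : ContDiff ℝ ∞ f) :
    ContDiff ℝ ∞ (model f : Eu (m + 1) → ℝ) := by
  unfold model
  exact (ContDiff.sum fun i _ => hf.comp (contDiff_coord _)).add
    ((contDiff_const.mul ((contDiff_coord _).pow 2)).mul (hf.comp (coordSum m).contDiff))

theorem contDiff_cos_mul (n : ℝ) : ContDiff ℝ ∞ fun t => Real.cos (n * t) :=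
  Real.contDiff_cos.comp (contDiff_const.mul contDiff_id)

/-- The cut-off model is a finite sum of plane waves with smooth compactly supported amplitudes, the
factor `x_last ^ 2 / 2` being absorbed into the cutoff. -/
theorem exists_modulus_model_cos {m : ℕ} {χ : Eu (m + 1) → ℝ} (hχ : IsTest χ) :
    ∃ M : ℝ, 0 ≤ M ∧ ∀ n : ℝ, 1 ≤ n → ∀ x y : Eu (m + 1),
      ‖fderiv ℝ (fun x => χ x * model (fun t => Real.cos (n * t)) x) x -
        fderiv ℝ (fun x => χ x * model (fun t => Real.cos (n * t)) x) y‖ ≤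
      M * (n * min 1 (n * ‖x - y‖)) := by
  choose M hM0 hM using fun i : Fin m =>
    exists_modulus_mul_cos hχ (EuclideanSpace.proj i.castSucc : Eu (m + 1) →L[ℝ] ℝ)
  have hχ' : IsTest fun x : Eu (m + 1) => 1 / 2 * x (Fin.last m) ^ 2 * χ x :=
    isTest_mul (contDiff_const.mul ((contDiff_coord _).pow 2)) hχ
  obtain ⟨M', hM'0, hM'⟩ := exists_modulus_mul_cos hχ' (coordSum m)
  refine ⟨∑ i, M i + M', add_nonneg (Finset.sum_nonneg fun i _ => hM0 i) hM'0,
    fun n hn x y => ?_⟩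
  set g : Fin m → Eu (m + 1) → ℝ := fun i x =>
    χ x * Real.cos (n * (EuclideanSpace.proj i.castSucc : Eu (m + 1) →L[ℝ] ℝ) x) with hg
  set g' : Eu (m + 1) → ℝ := fun x =>
    1 / 2 * x (Fin.last m) ^ 2 * χ x * Real.cos (n * coordSum m x) with hg'
  have hgd : ∀ i, Differentiable ℝ (g i) := fun i x =>
    (hasFDerivAt_mul_cos (hχ.1.differentiable (by simp)) _ n x).differentiableAt
  have hgd' : Differentiable ℝ g' := fun x =>
    (hasFDerivAt_mul_cos (hχ'.1.differentiable (by simp)) _ n x).differentiableAt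
  have hproj : ∀ (i : Fin m) (x : Eu (m + 1)),
      (EuclideanSpace.proj i.castSucc : Eu (m + 1) →L[ℝ] ℝ) x = x i.castSucc := fun _ _ => rfl
  have he : (fun x => χ x * model (fun t => Real.cos (n * t)) x) = fun x => ∑ i, g i x + g' x := by
    ext x
    simp only [model, hg, hg', mul_add, Finset.mul_sum, hproj]
    ring
  have hfd : ∀ z, fderiv ℝ (fun x => ∑ i, g i x + g' x) z =
      ∑ i, fderiv ℝ (g i) z + fderiv ℝ g' z := fun z =>
    ((HasFDerivAt.fun_sum fun i _ => (hgd i z).hasFDerivAt).add (hgd' z).hasFDerivAt).fderiv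
  rw [he, hfd, hfd, add_sub_add_comm, ← Finset.sum_sub_distrib, add_mul, Finset.sum_mul]
  refine (norm_add_le _ _).trans (add_le_add ?_ (hM' n hn x y))
  exact (norm_sum_le _ _).trans (Finset.sum_le_sum fun i _ => hM i n hn x y)

theorem model_lacunary {m : ℕ} (k : ℕ) (c : ℕ → ℝ) (x : Eu (m + 1)) :
    model (lacunary k c) x =
      ∑ l ∈ Finset.range k, c l * model (fun t => Real.cos (2 ^ l * t)) x := by
  simp only [model, lacunary, mul_add, Finset.sum_add_distrib, Finset.mul_sum]
  rw [Finset.sum_comm]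
  congr 1
  exact Finset.sum_congr rfl fun l _ => by ring

/-- Differentiation costs one factor `2 ^ l`, turning the coefficient `a_l 2 ^ (-l s)` into `a_l 2 ^
(-l (s - 1))`, the form required by the modulus of order `s - 1`. -/
theorem norm_gradient_sub_le_lacunaryModulus {m : ℕ} {χ : Eu (m + 1) → ℝ} (hχ : IsTest χ) (s : ℝ) :
    ∃ M : ℝ, 0 ≤ M ∧ ∀ (k : ℕ) (a : ℕ → ℝ), (∀ l, 0 ≤ a l) → ∀ x y : Eu (m + 1),
      ‖gradient (fun x => χ x * model (lacunary k fun l => a l * (2 ^ l) ^ (-s)) x) x -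
        gradient (fun x => χ x * model (lacunary k fun l => a l * (2 ^ l) ^ (-s)) x) y‖ ≤
      lacunaryModulus (s - 1) 1 k (fun l => M * a l) ‖x - y‖ := by
  obtain ⟨M, hM0, hM⟩ := exists_modulus_model_cos hχ
  refine ⟨M, hM0, fun k a ha x y => ?_⟩
  set g : ℕ → Eu (m + 1) → ℝ := fun l x => χ x * model (fun t => Real.cos (2 ^ l * t)) x with hg
  have hgd : ∀ l, Differentiable ℝ (g l) := fun l =>
    (hχ.1.mul (contDiff_model (contDiff_cos_mul _))).differentiable (by simp)
  have he : (fun x => χ x * model (lacunary k fun l => a l * (2 ^ l) ^ (-s)) x) =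
      fun x => ∑ l ∈ Finset.range k, (a l * (2 ^ l) ^ (-s)) * g l x := by
    ext x
    rw [model_lacunary, Finset.mul_sum]
    exact Finset.sum_congr rfl fun l _ => by simp only [hg]; ring
  have hfd : ∀ z, fderiv ℝ (fun x => ∑ l ∈ Finset.range k, (a l * (2 ^ l) ^ (-s)) * g l x) z =
      ∑ l ∈ Finset.range k, (a l * (2 ^ l) ^ (-s)) • fderiv ℝ (g l) z := fun z =>
    (HasFDerivAt.fun_sum fun l _ => (hgd l z).hasFDerivAt.const_mul _).fderiv
  rw [norm_gradient_sub, he, hfd, hfd, ← Finset.sum_sub_distrib, lacunaryModulus]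
  refine (norm_sum_le _ _).trans (Finset.sum_le_sum fun l _ => ?_)
  have h2 : (1 : ℝ) ≤ 2 ^ l := one_le_pow₀ (by norm_num)
  have h0 : (0 : ℝ) < 2 ^ l := by positivity
  have hal := ha l
  rw [← smul_sub, norm_smul, Real.norm_eq_abs, abs_of_nonneg (by positivity), mul_one]
  calc a l * (2 ^ l) ^ (-s) * ‖fderiv ℝ (g l) x - fderiv ℝ (g l) y‖
      ≤ a l * (2 ^ l) ^ (-s) * (M * (2 ^ l * min 1 (2 ^ l * ‖x - y‖))) := by
        gcongr
        exact hM _ h2 x y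
    _ = _ := by
        have : ((2 : ℝ) ^ l) ^ (-(s - 1)) = (2 ^ l) ^ (-s) * 2 ^ l := by
          rw [neg_sub, sub_eq_add_neg, Real.rpow_add h0, Real.rpow_one, mul_comm]
        rw [this]; ring

theorem hessian_congr {N : ℕ} {f g : Eu N → ℝ} {x : Eu N} (h : f =ᶠ[𝓝 x] g) :
    hessian f x = hessian g x := by
  ext i j
  have h1 : (fun y => fderiv ℝ f y (EuclideanSpace.single j 1)) =ᶠ[𝓝 x]
      fun y => fderiv ℝ g y (EuclideanSpace.single j 1) :=
    (h.fderiv (𝕜 := ℝ)).mono fun y hy => by simp only [hy]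
  simp only [hessian, Matrix.of_apply, h1.fderiv_eq]

/-! ### Failure at low smoothness -/

/-- The norms see `∑ a_l ^ p` and the determinants see `∑ a_l ^ N 2 ^ (l (2m - sN))` with `N = m +
1`; it remains to choose amplitudes for which the first converges and the second diverges. -/
theorem exists_sequence_of_lacunary {m : ℕ} {s p : ℝ} (hp : 1 < p) (hs1 : 1 < s) (hs2 : s < 2)
    {a : ℕ → ℝ} (ha : ∀ l, 0 ≤ a l) (hsum : Summable fun l => a l ^ p)
    (hdiv : ¬ Summable fun l => a l ^ (m + 1) * (2 ^ l : ℝ) ^ (2 * (m : ℝ) - s * (m + 1))) :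
    ∃ (u : ℕ → Eu (m + 1) → ℝ) (φ : Eu (m + 1) → ℝ), (∀ k, IsTest (u k)) ∧ IsTest φ ∧
      Tendsto (fun k => besovNorm s p (u k)) atTop (𝓝 0) ∧
      Tendsto (fun k => ∫ x, (hessian (u k) x).det * φ x) atTop atTop := by
  have hp0 : 0 < p := by linarith
  obtain ⟨ψ, hψc, hψ, hψpos, hψ2⟩ := exists_cutoff_moment
  set R : ℝ := 8 * (m + 1) with hR
  have hR0 : 0 < R := by positivity
  -- The cutoff equals `1` on a ball strictly larger than the one carrying the weight, so that the
  -- Hessians agree wherever the weight is nonzero.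
  let b : ContDiffBump (0 : Eu (m + 1)) := ⟨R + 1, R + 2, by positivity, by linarith⟩
  have hb : IsTest b := ⟨b.contDiff, b.hasCompactSupport⟩
  set c : ℕ → ℝ := fun l => a l * (2 ^ l) ^ (-s) with hc
  set v : ℕ → Eu (m + 1) → ℝ := fun k x => b x * model (lacunary k c) x with hv
  have hvt : ∀ k, IsTest (v k) := fun k =>
    ⟨b.contDiff.mul (contDiff_model (contDiff_lacunary k c)), b.hasCompactSupport.mul_right⟩
  have hv0 : ∀ k x, x ∉ Metric.closedBall (0 : Eu (m + 1)) (R + 2) → v k x = 0 := by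
    intro k x hx
    have : b x = 0 := b.zero_of_le_dist (by
      rw [Metric.mem_closedBall, not_le] at hx; exact hx.le)
    simp [hv, this]
  obtain ⟨M, hM0, hM⟩ := norm_gradient_sub_le_lacunaryModulus hb s
  obtain ⟨C, hC0, hC⟩ := besovNorm_le_of_lacunaryModulus (N := m + 1) (by omega) hp hs1 hs2
  set T := ∑' l, (M * a l) ^ p with hT
  have hMsum : Summable fun l => (M * a l) ^ p := by
    simp_rw [Real.mul_rpow hM0 (ha _)]
    exact hsum.mul_left _
  refine exists_sequence_of_bounded (by omega) hp0 hvt (isTest_weight hψc hψ)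
    (C := C * (1 + (R + 2)) * (R + 2) ^ (((m + 1 : ℕ) : ℝ) / p) * T ^ (1 / p)) (fun k => ?_) ?_
  · refine (hC (R + 2) (by positivity) 1 le_rfl k (fun l => M * a l)
      (fun l => mul_nonneg hM0 (ha l)) (v k) (hvt k) (hv0 k) (hM k a ha)).trans ?_
    refine ENNReal.ofReal_le_ofReal ?_
    have hnn : ∀ l, 0 ≤ (M * a l) ^ p := fun l => Real.rpow_nonneg (mul_nonneg hM0 (ha l)) _
    have h1 : ∑ l ∈ Finset.range k, (M * a l) ^ p ≤ T :=
      hMsum.sum_le_tsum _ fun l _ => hnn l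
    have h0 : 0 ≤ ∑ l ∈ Finset.range k, (M * a l) ^ p := Finset.sum_nonneg fun l _ => hnn l
    gcongr
  · set I := ∫ t, periodCutoff t with hI
    have hIpos : 0 < I := integral_periodCutoff_pos
    have h1 : ∀ k, ∫ x, (hessian (v k) x).det * weight m ψ x =
        ((∫ t, ψ t) * (I / 2) ^ m) * ∑ l ∈ Finset.range k,
          a l ^ (m + 1) * (2 ^ l : ℝ) ^ (2 * (m : ℝ) - s * (m + 1)) := by
      intro k
      have e1 : ∀ x, (hessian (v k) x).det * weight m ψ x =
          (hessian (model (lacunary k c)) x).det * weight m ψ x := by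
        intro x
        by_cases hx : x ∈ Metric.closedBall (0 : Eu (m + 1)) R
        · have : v k =ᶠ[𝓝 x] model (lacunary k c) := by
            have hx' : x ∈ Metric.ball (0 : Eu (m + 1)) (R + 1) :=
              Metric.closedBall_subset_ball (by linarith) hx
            filter_upwards [Metric.isOpen_ball.mem_nhds hx'] with y hy
            simp only [hv]
            rw [b.one_of_mem_closedBall (Metric.ball_subset_closedBall hy), one_mul]
          rw [hessian_congr this]
        · rw [weight_eq_zero hψ hx, mul_zero, mul_zero]
      simp_rw [e1]
      rw [integral_det_hessian_model hψc hψ hψ2, mul_assoc, Finset.mul_sum (a := (I / 2) ^ m)]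
      congr 1
      refine Finset.sum_congr rfl fun l _ => ?_
      have h0 : (0 : ℝ) < 2 ^ l := by positivity
      have h4 : (4 : ℝ) ^ l = (2 ^ l) ^ (2 : ℝ) := by
        rw [Real.rpow_two, ← pow_mul, mul_comm, pow_mul]; norm_num
      have h5 : ((2 : ℝ) ^ l) ^ (2 * (m : ℝ) - s * (m + 1)) =
          ((2 ^ l) ^ (-s)) ^ (m + 1) * (4 ^ l) ^ m := by
        rw [h4, ← Real.rpow_natCast (((2 : ℝ) ^ l) ^ (-s)),
          ← Real.rpow_natCast (((2 : ℝ) ^ l) ^ (2 : ℝ)), ← Real.rpow_mul h0.le, ← Real.rpow_mul h0.le, ← Real.rpow_add h0]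
        congr 1
        push_cast; ring
      rw [h5]
      simp only [hc, ← hI]
      generalize ((2 : ℝ) ^ l) ^ (-s) = X
      generalize (4 : ℝ) ^ l = Y
      ring
    simp_rw [h1]
    refine Tendsto.const_mul_atTop (by positivity) ?_
    refine (not_summable_iff_tendsto_nat_atTop_of_nonneg fun l => ?_).1 hdiv
    exact mul_nonneg (pow_nonneg (ha l) _) (Real.rpow_nonneg (by positivity) _)

/-- Below the critical order the exponent `δ = 2m - s(m + 1)` is positive, so geometric growth beats
the amplitudes `1 / (l + 1)`, which are `p`-summable because `p > 1`. -/
theorem exists_sequence_of_lt_critical {m : ℕ} {s p : ℝ} (hp : 1 < p) (hs1 : 1 < s) (hs2 : s < 2)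
    (hs : s < 2 - 2 / ((m + 1 : ℕ) : ℝ)) :
    ∃ (u : ℕ → Eu (m + 1) → ℝ) (φ : Eu (m + 1) → ℝ), (∀ k, IsTest (u k)) ∧ IsTest φ ∧
      Tendsto (fun k => besovNorm s p (u k)) atTop (𝓝 0) ∧
      Tendsto (fun k => ∫ x, (hessian (u k) x).det * φ x) atTop atTop := by
  have hm : (0 : ℝ) < (m : ℝ) + 1 := by positivity
  set δ : ℝ := 2 * (m : ℝ) - s * (m + 1) with hδ
  have hδpos : 0 < δ := by
    push_cast at hs
    have h := mul_lt_mul_of_pos_right hs hm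
    have : (2 - 2 / ((m : ℝ) + 1)) * (m + 1) = 2 * m := by field_simp; ring
    linarith
  refine exists_sequence_of_lacunary (a := fun l : ℕ => ((l : ℝ) + 1) ^ (-1 : ℝ)) hp hs1 hs2
    (fun l => by positivity) ?_ ?_
  · have h1 : Summable fun l : ℕ => (((l + 1 : ℕ) : ℝ)) ^ (-p) :=
      (summable_nat_add_iff 1).2 (Real.summable_nat_rpow.2 (by linarith))
    refine h1.congr fun l => ?_
    rw [← Real.rpow_mul (by positivity)]
    push_cast; congr 1; ring
  · intro hsum
    have h0 := hsum.tendsto_atTop_zero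
    have hr : 1 < (2 : ℝ) ^ δ := Real.one_lt_rpow (by norm_num) hδpos
    have h2 : Tendsto (fun l : ℕ => ((l : ℝ)) ^ (m + 1) / ((2 : ℝ) ^ δ) ^ l) atTop (𝓝 0) :=
      tendsto_pow_const_div_const_pow_of_one_lt (m + 1) hr
    -- If the terms tended to zero, so would this product; yet it is constantly `(2 ^ δ)⁻¹`.
    have h3 := h0.mul ((tendsto_add_atTop_iff_nat 1).2 h2)
    have h4 : Tendsto (fun _ : ℕ => ((2 : ℝ) ^ δ)⁻¹) atTop (𝓝 0) := by
      rw [mul_zero] at h3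
      refine h3.congr fun l => ?_
      have hl : (0 : ℝ) < (l : ℝ) + 1 := by positivity
      have e1 : ((2 : ℝ) ^ l) ^ δ = ((2 : ℝ) ^ δ) ^ l := by
        rw [← Real.rpow_natCast, ← Real.rpow_natCast, ← Real.rpow_mul (by norm_num),
          ← Real.rpow_mul (by norm_num), mul_comm]
      rw [e1, Real.rpow_neg_one, inv_pow, pow_succ ((2 : ℝ) ^ δ)]
      push_cast
      have : (0 : ℝ) < 2 ^ δ := by positivity
      field_simp
    have h5 := tendsto_nhds_unique h4 tendsto_const_nhds
    exact (inv_pos.2 (zero_lt_one.trans hr)).ne h5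

/-- At the critical order the geometric factor is `1`. The amplitudes `(l + 1) ^ (-1/N)` with `N = m
+ 1` make the determinant sum harmonic, while their `p`-th powers are summable because `p > N`. -/
theorem exists_sequence_of_eq_critical {m : ℕ} {s p : ℝ} (hp : 1 < p) (hs1 : 1 < s) (hs2 : s < 2)
    (hs : s = 2 - 2 / ((m + 1 : ℕ) : ℝ)) (hpN : ((m + 1 : ℕ) : ℝ) < p) :
    ∃ (u : ℕ → Eu (m + 1) → ℝ) (φ : Eu (m + 1) → ℝ), (∀ k, IsTest (u k)) ∧ IsTest φ ∧
      Tendsto (fun k => besovNorm s p (u k)) atTop (𝓝 0) ∧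
      Tendsto (fun k => ∫ x, (hessian (u k) x).det * φ x) atTop atTop := by
  have hm : (0 : ℝ) < (m : ℝ) + 1 := by positivity
  push_cast at hs hpN
  refine exists_sequence_of_lacunary (a := fun l : ℕ => ((l : ℝ) + 1) ^ (-(1 / ((m : ℝ) + 1))))
    hp hs1 hs2 (fun l => by positivity) ?_ ?_
  · have h1 : Summable fun l : ℕ => (((l + 1 : ℕ) : ℝ)) ^ (-(p / ((m : ℝ) + 1))) := by
      refine (summable_nat_add_iff 1).2 (Real.summable_nat_rpow.2 ?_)
      rw [neg_lt_neg_iff, one_lt_div hm]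
      exact hpN
    refine h1.congr fun l => ?_
    rw [← Real.rpow_mul (by positivity)]
    push_cast; congr 1; ring
  · intro hsum
    have h1 : Summable fun l : ℕ => (((l + 1 : ℕ) : ℝ)) ^ (-1 : ℝ) := by
      refine hsum.congr fun l => ?_
      have e : 2 * (m : ℝ) - s * (m + 1) = 0 := by
        rw [hs]; field_simp; ring
      rw [e, Real.rpow_zero, mul_one, ← Real.rpow_natCast, ← Real.rpow_mul (by positivity)]
      push_cast; congr 1; field_simp
    have h2 := Real.summable_nat_rpow.1
      ((summable_nat_add_iff (f := fun n : ℕ => (n : ℝ) ^ (-1 : ℝ)) 1).1 h1)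
    exact lt_irrefl _ h2

end HessianDet

end

theorem mainTheorem3 (N : ℕ) (hN : 2 ≤ N) (s p : ℝ) (hp : 1 < p) (hs1 : 1 < s) (hs2 : s < 2)
    (hincl : ¬ ∀ f : EuclideanSpace ℝ (Fin N) → ℝ,
      HessianDet.MemBesov s p f → HessianDet.MemCriticalLoc f) :
    ∃ (u : ℕ → EuclideanSpace ℝ (Fin N) → ℝ) (φ : EuclideanSpace ℝ (Fin N) → ℝ),
      (∀ k, HessianDet.IsTest (u k)) ∧ HessianDet.IsTest φ ∧
      Tendsto (fun k => HessianDet.besovNorm s p (u k)) atTop (𝓝 0) ∧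
      Tendsto (fun k => ∫ x, (HessianDet.hessian (u k) x).det * φ x) atTop atTop := by
  by_cases hscale : s < N / p + 1 - 2 / (N : ℝ)
  · exact HessianDet.exists_sequence_of_subscaling hN hp hs1 hs2 hscale
  obtain ⟨m, rfl⟩ : ∃ m, N = m + 1 := ⟨N - 1, by omega⟩
  by_cases hlt : s < 2 - 2 / ((m + 1 : ℕ) : ℝ)
  · exact HessianDet.exists_sequence_of_lt_critical hp hs1 hs2 hlt
  by_cases heq : s = 2 - 2 / ((m + 1 : ℕ) : ℝ) ∧ ((m + 1 : ℕ) : ℝ) < p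
  · exact HessianDet.exists_sequence_of_eq_critical hp hs1 hs2 heq.1 heq.2
  -- In the remaining range all three conditions for the embedding hold, which contradicts `hincl`.
  · exact absurd (fun f hf => HessianDet.MemBesov.memCriticalLoc hN hp hs1 hs2 (not_lt.1 hscale)
      (not_lt.1 hlt) (fun h => not_lt.1 fun h' => heq ⟨h, h'⟩) hf) hincl
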